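/- **Setting.** Let $G$ be a finite undirected graph with vertex set $\mathcal A$ (the arms), and let $\mathcal V_a$ be the set of neighbours of $a$. Let $p(m)$ be either the Gaussian law $\mathcal N(m,1)$, $m\in\Theta=\mathbb R$, or the Bernoulli law of mean $m$, $m\in\Theta=(0,1)$, and let $\mathrm{KL}(m|m')$ be the Kullback–Leibler divergence of $p(m)$ from $p(m')$ (extended to $m,m'\in[0,1]$ in the Bernoulli case, with values in $[0,\infty]$). Let $\nu=(p(\mu_a))_{a\in\mathcal A}$, $\mu_a\in\Theta$, be unimodal for $G$: there is a unique optimal arm $a^\star=\operatorname{argmax}_a\mu_a$, and every arm $a\ne a^\star$ is joined to $a^\star$ by a path of $G$ along which the means increase strictly. Put $\mu^\star=\mu_{a^\star}$, $\Delta_a=\mu^\star-\mu_a$. At each round $t\ge1$ the learner pulls an arm $a_t$ based only on the past (and possibly on additional randomisation), then observes a reward $X_t$ which, given the past and $a_t$, has law $\nu_{a_t}$. The regret is $R(\nu,T)=\mathbb E\big[\sum_{t=1}^T(\mu^\star-X_t)\big]$. Let $N_a(t)$ be the number of pulls of $a$ in rounds $1,\dots,t$, let $\hat\mu_a(t)$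 be the empirical mean of the rewards of $a$ in these rounds ($0$ if $N_a(t)=0$), $\hat\mu^\star(t)=\max_a\hat\mu_a(t)$, and $\hat{\mathcal A}^\star(t)=\operatorname{argmax}_a\hat\mu_a(t)$. We use $0\times\infty=0$ and $\log 0=-\infty$. **Strategies.** The first arm $a_1$ is arbitrary. For each $t\ge1$, a current best arm $\hat a^\star_t\in\operatorname{argmin}_{a\in\hat{\mathcal A}^\star(t)}N_a(t)$ is chosen; all ties are broken arbitrarily. * IMED-UB pulls $a_{t+1}\in\operatorname{argmin}_{a\in\{\hat a^\star_t\}\cup\mathcal V_{\hat a^\star_t}}I_a(t)$, where $I_a(t)=N_a(t)\,\mathrm{KL}(\hat\mu_a(t)|\hat\mu^\star(t))+\log N_a(t)$. * KLUCB-UB pulls $a_{t+1}\in\operatorname{argmax}_{a\in\{\hat a^\star_t\}\cup\mathcal V_{\hat a^\star_t}}U_a(t)$, where $U_a(t)=\sup\{u\in\overline\Theta:\ u\ge\hat\mu_a(t),\ N_a(t)\,\mathrm{KL}(\hat\mu_a(t)|u)+\log N_a(t)\le\log N_{\hat a^\star_t}(t)\}$ in $[-\infty,+\infty]$ if $N_a(t)\le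 N_{\hat a^\star_t}(t)$, and $U_a(t)=\hat\mu_a(t)$ otherwise. * d-IMED-UB (for $G$ a tree) chooses $\underline a_t\in\operatorname{argmin}_{a\in\{\hat a^\star_t\}\cup\mathcal V_{\hat a^\star_t}}I_a(t)$. If $\underline a_t=\hat a^\star_t$ it pulls $a_{t+1}=\underline a_t$. Otherwise it pulls $a_{t+1}\in\operatorname{argmin}_{a\in\mathcal S_t}I_a^{(\underline a_t)}(t)$, where $\mathcal S_t$ is an arbitrary set of arms (for instance a sub-tree) containing $\underline a_t$ and contained in the sub-tree containing $\underline a_t$ obtained from $G$ by cutting the edge $(\underline a_t,\hat a^\star_t)$, and $I^{(a')}_a(t)=N_a(t)\,\mathrm{KL}^+(\hat\mu_a(t)|\hat\mu_{a'}(t))+\log N_a(t)$, with $\mathrm{KL}^+(m|m')=\mathrm{KL}(m|m')$ if $m<m'$ and $0$ otherwise. **Corollary (Asymptotic optimality).** The rewards $X_t$ are integrable, and under IMED-UB and under KLUCB-UB $$\limsup_{T\to\infty}\frac{R(\nu,T)}{\log T}\ \le\ c(\nu)=\sum_{a\in\mathcal V_{a^\star}}\frac{\Delta_a}{\mathrm{KL}(\mu_a|\mu^\star)}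 .$$ If $G$ is a tree, the same holds under d-IMED-UB. -/

import Mathlib

open MeasureTheory ProbabilityTheory Filter Topology
open scoped ENNReal

namespace UnimodalBandit

/-! ### The reward families -/

/-- The two families of reward distributions: real Gaussian distributions with variance `1`, and
Bernoulli distributions on `{0, 1}`. Both are parametrised by their mean. -/
inductive RewardFamily : Type
  | gaussian
  | bernoulli

namespace RewardFamily

/-- The set `Θ` of means of the distributions of the family. -/
def means : RewardFamily → Set ℝ
  | gaussian => Set.univ
  | bernoulli => Set.Ioo 0 1

/-- The closure of `Θ` in `ℝ`, where empirical means live and on which the divergence is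
extended. -/
def extendedMeans : RewardFamily → Set ℝ
  | gaussian => Set.univ
  | bernoulli => Set.Icc 0 1

/-- The distribution `p(m)` with mean `m`: `N(m, 1)`, resp. mass `m` at `1` and `1 - m` at `0`.
In the Bernoulli case only `m ∈ [0, 1]` is meaningful (other values are clamped to `[0, 1]`). -/
noncomputable def law : RewardFamily → ℝ → Measure ℝ
  | gaussian, m => gaussianReal m 1
  | bernoulli, m => bernoulliMeasure (1 : ℝ) 0 (Set.projIcc 0 1 zero_le_one m)

/-- `KL(m | m')`, the Kullback-Leibler divergence of `p(m)` from `p(m')`, in `[0, ∞]`. -/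
noncomputable def KL (fam : RewardFamily) (m m' : ℝ) : ℝ≥0∞ :=
  InformationTheory.klDiv (fam.law m) (fam.law m')

/-- `KL⁺(m | m')`, equal to `KL(m | m')` if `m < m'` and to `0` otherwise. -/
noncomputable def KLplus (fam : RewardFamily) (m m' : ℝ) : ℝ≥0∞ :=
  if m < m' then fam.KL m m' else 0

end RewardFamily

/-! ### Unimodal configurations, the complexity constant, the regret -/

section Configuration

variable {A : Type*}

/-- The configuration `ν = (p(μ a))_a` is unimodal for the graph `G`, with optimal arm `astar`:
the means lie in `Θ`, `astar` is the unique optimal arm, and every other arm is joined to `astar`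
by a path of `G` along which the means increase strictly. -/
structure IsUnimodal (fam : RewardFamily) (G : SimpleGraph A) (μ : A → ℝ) (astar : A) : Prop where
  mem_means : ∀ a, μ a ∈ fam.means
  lt_optimal : ∀ a, a ≠ astar → μ a < μ astar
  increasing_path : ∀ a, a ≠ astar →
    ∃ p : G.Walk a astar, List.IsChain (fun b b' => μ b < μ b') p.support

open scoped Classical in
/-- `c(ν) = ∑_{a ∈ V_{a*}} Δ_a / KL(μ_a | μ*)`, where `V_{a*}` is the set of neighbours of the
optimal arm, `μ*` the largest mean and `Δ_a = μ* - μ_a`. -/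
noncomputable def complexity [Fintype A] (fam : RewardFamily) (G : SimpleGraph A) (μ : A → ℝ)
    (astar : A) : ℝ :=
  ∑ a : A with G.Adj astar a, ((⨆ b, μ b) - μ a) / (fam.KL (μ a) (⨆ b, μ b)).toReal

variable {Ω : Type*} [MeasurableSpace Ω]

/-- The pulled arms `arm 1, arm 2, …` and the rewards `X 1, X 2, …` (index `0` is not used) form an
interaction of a learner with the bandit `ν`: for every `t ≥ 0`, the arm `arm (t + 1)` is determined
by the information `ℱ t` available after `t` rounds (past arms and rewards, and possibly additional
randomisation), and given `ℱ t` the reward `X (t + 1)` has distribution `ν (arm (t + 1))`. -/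
structure IsBanditProcess (ν : A → Measure ℝ) (P : Measure Ω) (ℱ : Filtration ℕ ‹MeasurableSpace Ω›)
    (arm : ℕ → Ω → A) (X : ℕ → Ω → ℝ) : Prop where
  arm_predictable : ∀ (t : ℕ) (a : A), MeasurableSet[ℱ t] {ω | arm (t + 1) ω = a}
  reward_adapted : ∀ t : ℕ, Measurable[ℱ (t + 1)] (X (t + 1))
  reward_law : ∀ (t : ℕ) (B : Set ℝ), MeasurableSet B →
    P⟦X (t + 1) ⁻¹' B | ℱ t⟧ =ᵐ[P] fun ω => (ν (arm (t + 1) ω)).real B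

/-- The regret `R(ν, T) = E[∑_{t = 1}^T (μ* - X_t)]`, with `μ*` the largest mean. -/
noncomputable def regret (μ : A → ℝ) (P : Measure Ω) (X : ℕ → Ω → ℝ) (T : ℕ) : ℝ :=
  ∫ ω, ∑ t ∈ Finset.Icc 1 T, ((⨆ a, μ a) - X t ω) ∂P

end Configuration

/-! ### Statistics of a trajectory

Below, `arm : ℕ → A` and `X : ℕ → ℝ` are the arms and rewards along one trajectory. -/

section Trajectory

variable {A : Type*}

open scoped Classical in
/-- `N_a(t)`, the number of pulls of arm `a` in the rounds `1, …, t`. -/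
noncomputable def pulls (arm : ℕ → A) (a : A) (t : ℕ) : ℕ :=
  ((Finset.Icc 1 t).filter fun s => arm s = a).card

open scoped Classical in
/-- The empirical mean of arm `a` after `t` rounds, which is `0` if `a` has not been pulled. -/
noncomputable def empMean (arm : ℕ → A) (X : ℕ → ℝ) (a : A) (t : ℕ) : ℝ :=
  if pulls arm a t = 0 then 0
  else (∑ s ∈ (Finset.Icc 1 t).filter (fun s => arm s = a), X s) / pulls arm a t

/-- The current best empirical mean. -/
noncomputable def bestEmpMean (arm : ℕ → A) (X : ℕ → ℝ) (t : ℕ) : ℝ :=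
  ⨆ a, empMean arm X a t

/-- The arms with the largest empirical mean after `t` rounds. -/
def bestArms (arm : ℕ → A) (X : ℕ → ℝ) (t : ℕ) : Set A :=
  {h | ∀ b, empMean arm X b t ≤ empMean arm X h t}

/-- The possible choices of the current best arm: the arms that have been pulled least among those
with the largest empirical mean. -/
def leaders (arm : ℕ → A) (X : ℕ → ℝ) (t : ℕ) : Set A :=
  {h | h ∈ bestArms arm X t ∧ ∀ b ∈ bestArms arm X t, pulls arm h t ≤ pulls arm b t}

/-- `{h} ∪ V_h`. -/
def closedNbhd (G : SimpleGraph A) (h : A) : Set A := {h} ∪ G.neighborSet h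

/-- `n * k + log n` in the extended reals, with `0 * ∞ = 0` and `log 0 = -∞`. -/
noncomputable def penalizedCost (n : ℕ) (k : ℝ≥0∞) : EReal :=
  (((n : ℝ≥0∞) * k : ℝ≥0∞) : EReal) + ENNReal.log (n : ℝ≥0∞)

/-- The IMED index of arm `a` after `t` rounds. -/
noncomputable def imedIndex (fam : RewardFamily) (arm : ℕ → A) (X : ℕ → ℝ) (t : ℕ) (a : A) :
    EReal :=
  penalizedCost (pulls arm a t) (fam.KL (empMean arm X a t) (bestEmpMean arm X t))

/-- The second order IMED index of arm `a` relative to arm `a'` after `t` rounds. -/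
noncomputable def imedIndex₂ (fam : RewardFamily) (arm : ℕ → A) (X : ℕ → ℝ) (t : ℕ) (a' a : A) :
    EReal :=
  penalizedCost (pulls arm a t) (fam.KLplus (empMean arm X a t) (empMean arm X a' t))

open scoped Classical in
/-- The upper confidence bound of arm `a` after `t` rounds when `h` is the current best arm: the
largest `u` above the empirical mean with `N_a KL(empMean_a | u) + log N_a ≤ log N_h`, and the
empirical mean itself if `log N_h < log N_a`. It is a maximum, except that it is `+∞` for a Gaussian
arm that has not been pulled. -/
noncomputable def ucbIndex (fam : RewardFamily) (arm : ℕ → A) (X : ℕ → ℝ) (t : ℕ) (h a : A) :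
    EReal :=
  if ENNReal.log (pulls arm h t : ℝ≥0∞) < ENNReal.log (pulls arm a t : ℝ≥0∞) then
    (empMean arm X a t : EReal)
  else
    sSup ((fun u : ℝ => (u : EReal)) '' {u : ℝ | u ∈ fam.extendedMeans ∧ empMean arm X a t ≤ u ∧
      penalizedCost (pulls arm a t) (fam.KL (empMean arm X a t) u) ≤
        ENNReal.log (pulls arm h t : ℝ≥0∞)})

/-- The nodes of the component of `a'` obtained from `G` by cutting the edge `(a', h)`. -/
def cutSubtree (G : SimpleGraph A) (h a' : A) : Set A :=
  {a | (G.deleteEdges {s(a', h)}).Reachable a' a}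

/-! ### The strategies

Each predicate says which arms the strategy may pull in round `t + 1`, given the first `t` rounds;
all ties may be broken arbitrarily. -/

/-- One step of IMED-UB. -/
def ImedUBStep (fam : RewardFamily) (G : SimpleGraph A) (arm : ℕ → A) (X : ℕ → ℝ) (t : ℕ) : Prop :=
  ∃ h ∈ leaders arm X t, arm (t + 1) ∈ closedNbhd G h ∧
    IsMinOn (imedIndex fam arm X t) (closedNbhd G h) (arm (t + 1))

/-- One step of KLUCB-UB. -/
def KlucbUBStep (fam : RewardFamily) (G : SimpleGraph A) (arm : ℕ → A) (X : ℕ → ℝ) (t : ℕ) : Prop :=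
  ∃ h ∈ leaders arm X t, arm (t + 1) ∈ closedNbhd G h ∧
    IsMaxOn (ucbIndex fam arm X t h) (closedNbhd G h) (arm (t + 1))

/-- One step of d-IMED-UB. The exploration set `S` may be any set of nodes of the cut sub-tree of
`g` that contains `g`; in particular it may be any sub-tree. -/
def DImedUBStep (fam : RewardFamily) (G : SimpleGraph A) (arm : ℕ → A) (X : ℕ → ℝ) (t : ℕ) : Prop :=
  ∃ h ∈ leaders arm X t, ∃ g ∈ closedNbhd G h,
    IsMinOn (imedIndex fam arm X t) (closedNbhd G h) g ∧
    ((g = h ∧ arm (t + 1) = g) ∨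
      (g ≠ h ∧ ∃ S : Set A, g ∈ S ∧ S ⊆ cutSubtree G h g ∧ arm (t + 1) ∈ S ∧
        IsMinOn (imedIndex₂ fam arm X t g) S (arm (t + 1))))

variable {Ω : Type*} [MeasurableSpace Ω]

/-- The process almost surely follows IMED-UB (the first arm is arbitrary). -/
def FollowsImedUB (fam : RewardFamily) (G : SimpleGraph A) (P : Measure Ω) (arm : ℕ → Ω → A)
    (X : ℕ → Ω → ℝ) : Prop :=
  ∀ᵐ ω ∂P, ∀ t : ℕ, 1 ≤ t → ImedUBStep fam G (fun s => arm s ω) (fun s => X s ω) t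

/-- The process almost surely follows KLUCB-UB (the first arm is arbitrary). -/
def FollowsKlucbUB (fam : RewardFamily) (G : SimpleGraph A) (P : Measure Ω) (arm : ℕ → Ω → A)
    (X : ℕ → Ω → ℝ) : Prop :=
  ∀ᵐ ω ∂P, ∀ t : ℕ, 1 ≤ t → KlucbUBStep fam G (fun s => arm s ω) (fun s => X s ω) t

/-- The process almost surely follows d-IMED-UB (the first arm is arbitrary). -/
def FollowsDImedUB (fam : RewardFamily) (G : SimpleGraph A) (P : Measure Ω) (arm : ℕ → Ω → A)
    (X : ℕ → Ω → ℝ) : Prop :=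
  ∀ᵐ ω ∂P, ∀ t : ℕ, 1 ≤ t → DImedUBStep fam G (fun s => arm s ω) (fun s => X s ω) t

end Trajectory

end UnimodalBandit

/-!
For all three policies it is enough to bound the expected number of pulls of each suboptimal arm
`a`: the regret is `∑ a, Δ a * E N_a(T)` (`regret_eq`), so asymptotic optimality follows once
`E N_a(T) ≤ log T / KL(μ_a | μ*) + o(log T)` for the neighbours of the optimal arm and
`E N_a(T) = o(log T)` for the other suboptimal arms.

*Exceptional levels.* Fix a precision `ε` that is small compared with the gaps between the means. A
level `n` is `Exceptional` along a trajectory if some arm `b` is misestimated by `ε` after at least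
`n` pulls, or is at some time so unlucky that
`log n ≤ N_b * KL(empMean_b | μ_b - ε) + log N_b` with empirical mean at most `μ_b - ε`. These events
have probability `o(1 / n)` (`tendsto_mul_measure_exceptional`): the first by Ville's inequality for
exponential supermartingales, the second by a union bound over the number `N_b` of pulls and
dominated convergence. Summing over `n ≤ T`, there are `o(log T)` exceptional levels in expectation
(`exists_exceptionalCount_le`). An arm reaches each level `n = N_a(t)` only once, so it remains to
study pulls of `a` at non-exceptional levels (`pulls_le_of_forall`).

*IMED-UB and d-IMED-UB.* At a non-exceptional level the minimality of the index of the pulled arm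
forces the current best arm to be optimal: were it suboptimal, its neighbour on an increasing path
would have an index below `log n`. Comparing then with the current best arm, whose index is at most
`log T`, gives `n * KL(μ_a + ε | μ* - ε) ≤ log T` when `a` is a neighbour of the optimal arm. In
d-IMED-UB the arm pulled may differ from the neighbour `g` that passed the first test. In a tree the
means then decrease away from `g`, and the second test gives `c * n ≤ log N_g = O(log log T)`.

*KLUCB-UB.* If the pulled arm has been pulled at most as often as the current best arm, the same
comparison gives the rate above when the current best arm is optimal, and `c * n ≤ log N_h` when it
is some suboptimal arm `h`; the latter is at most an arbitrarily small multiple of the number of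
suboptimal pulls, plus a constant. Otherwise the pulled arm is tied with the current best arm
(`IsTie`). Given the past, a tie is followed with a fixed positive probability by a reward well below
the mean, which breaks it (`IsBanditProcess.integral_brokenTies`), and broken ties can be charged to
exceptional levels and suboptimal pulls (`exists_brokenTies_le`).

In each case this yields `HasPullRate`: the rate claimed, up to a small multiple of `log T` and of
the expected number of suboptimal pulls. Summing over the suboptimal arms absorbs the latter
(`limsup_regret_le`); letting `ε` tend to `0` gives the constant `c(ν)`, by continuity of the
divergence.
-/

namespace UnimodalBandit

/-! ### Conditional law of the rewards -/

section Interaction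

variable {A : Type*} {Ω : Type*} {mΩ : MeasurableSpace Ω} {ν : A → Measure ℝ} {P : Measure Ω}
  {ℱ : Filtration ℕ mΩ} {arm : ℕ → Ω → A} {X : ℕ → Ω → ℝ}

lemma IsBanditProcess.measurable_reward (h : IsBanditProcess ν P ℱ arm X) (t : ℕ) :
    Measurable (X (t + 1)) :=
  (h.reward_adapted t).mono (ℱ.le _) le_rfl

/-- On an event of the past on which arm `a` is pulled, the next reward has law `ν a` and is
independent of the past. -/
lemma IsBanditProcess.measure_inter_preimage [IsProbabilityMeasure P]
    [∀ a, IsProbabilityMeasure (ν a)] (h : IsBanditProcess ν P ℱ arm X) {t : ℕ} {a : A}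
    {F : Set Ω} (hF : MeasurableSet[ℱ t] F) (hFa : F ⊆ {ω | arm (t + 1) ω = a})
    {B : Set ℝ} (hB : MeasurableSet B) :
    P (F ∩ X (t + 1) ⁻¹' B) = P F * ν a B := by
  have hpre : MeasurableSet (X (t + 1) ⁻¹' B) := h.measurable_reward t hB
  have hF' : MeasurableSet F := ℱ.le t _ hF
  have h1 : ∫ ω in F, (P⟦X (t + 1) ⁻¹' B | ℱ t⟧) ω ∂P
      = ∫ ω in F, (X (t + 1) ⁻¹' B).indicator (fun _ => (1 : ℝ)) ω ∂P :=
    setIntegral_condExp (ℱ.le t) ((integrable_const 1).indicator hpre) hF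
  have h2 : ∫ ω in F, (P⟦X (t + 1) ⁻¹' B | ℱ t⟧) ω ∂P = ∫ ω in F, (ν a).real B ∂P := by
    refine setIntegral_congr_ae hF' ?_
    filter_upwards [h.reward_law t B hB] with ω hω hωF
    rw [hω, hFa hωF]
  rw [h2, setIntegral_const, integral_indicator hpre, integral_const] at h1
  simp only [measureReal_restrict_apply MeasurableSet.univ, Set.univ_inter, smul_eq_mul,
    mul_one] at h1
  rw [measureReal_restrict_apply hpre, Set.inter_comm] at h1
  rw [← ENNReal.toReal_eq_toReal_iff' (measure_ne_top _ _)
    (ENNReal.mul_ne_top (measure_ne_top _ _) (measure_ne_top _ _)), ENNReal.toReal_mul]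
  exact h1.symm

lemma IsBanditProcess.map_restrict [IsProbabilityMeasure P]
    [∀ a, IsProbabilityMeasure (ν a)] (h : IsBanditProcess ν P ℱ arm X) {t : ℕ} {a : A}
    {F : Set Ω} (hF : MeasurableSet[ℱ t] F) (hFa : F ⊆ {ω | arm (t + 1) ω = a}) :
    (P.restrict F).map (X (t + 1)) = P F • ν a := by
  ext B hB
  rw [Measure.map_apply (h.measurable_reward t) hB,
    Measure.restrict_apply (h.measurable_reward t hB), Set.inter_comm,
    h.measure_inter_preimage hF hFa hB]
  simp

lemma IsBanditProcess.setLIntegral_mul_reward [IsProbabilityMeasure P]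
    [∀ a, IsProbabilityMeasure (ν a)] (h : IsBanditProcess ν P ℱ arm X) {t : ℕ} {a : A}
    {F : Set Ω} (hF : MeasurableSet[ℱ t] F) (hFa : F ⊆ {ω | arm (t + 1) ω = a})
    {g : ℝ → ℝ≥0∞} (hg : Measurable g) {f : Ω → ℝ≥0∞} (hf : Measurable[ℱ t] f) :
    ∫⁻ ω in F, f ω * g (X (t + 1) ω) ∂P = (∫⁻ ω in F, f ω ∂P) * ∫⁻ x, g x ∂(ν a) := by
  have hgX : Measurable fun ω => g (X (t + 1) ω) := hg.comp (h.measurable_reward t)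
  refine @Measurable.ennreal_induction Ω (ℱ t) (fun f => ∫⁻ ω in F, f ω * g (X (t + 1) ω) ∂P
    = (∫⁻ ω in F, f ω ∂P) * ∫⁻ x, g x ∂(ν a)) ?_ ?_ ?_ f hf
  · intro c s hs
    have hs' : MeasurableSet s := ℱ.le t _ hs
    have e1 : ∀ ω, s.indicator (fun _ => c) ω * g (X (t + 1) ω)
        = s.indicator (fun ω => c * g (X (t + 1) ω)) ω := by
      intro ω; by_cases hω : ω ∈ s <;> simp [hω]
    simp_rw [e1]
    rw [lintegral_indicator hs', lintegral_indicator hs', Measure.restrict_restrict hs',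
      lintegral_const_mul _ hgX, lintegral_const,
      ← lintegral_map hg (h.measurable_reward t),
      h.map_restrict (hs.inter hF) (Set.inter_subset_right.trans hFa), lintegral_smul_measure]
    simp [mul_assoc]
  · intro f g' _ hf hg' ihf ihg
    have hf' : Measurable f := hf.mono (ℱ.le t) le_rfl
    simp_rw [Pi.add_apply, add_mul]
    rw [lintegral_add_left (f := fun ω => f ω * g (X (t + 1) ω)) (hf'.mul hgX), ihf, ihg,
      lintegral_add_left hf', add_mul]
  · intro f hf hmono ih
    have hf' : ∀ n, Measurable (f n) := fun n => (hf n).mono (ℱ.le t) le_rfl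
    simp_rw [ENNReal.iSup_mul]
    rw [lintegral_iSup (f := fun n ω => f n ω * g (X (t + 1) ω)) (fun n => (hf' n).mul hgX)
        (fun i j hij ω => mul_le_mul_left (hmono hij ω) _),
      lintegral_iSup hf' hmono, ENNReal.iSup_mul]
    exact iSup_congr ih

lemma IsBanditProcess.measurableSet_arm (h : IsBanditProcess ν P ℱ arm X) {s t : ℕ} (hs : 1 ≤ s)
    (hst : s ≤ t + 1) (a : A) : MeasurableSet[ℱ t] {ω | arm s ω = a} := by
  obtain ⟨s, rfl⟩ := Nat.exists_eq_add_of_le' hs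
  exact ℱ.mono (by omega : s ≤ t) _ (h.arm_predictable s a)

lemma IsBanditProcess.measurable_reward_of_le (h : IsBanditProcess ν P ℱ arm X) {s t : ℕ}
    (hs : 1 ≤ s) (hst : s ≤ t) : Measurable[ℱ t] (X s) := by
  obtain ⟨s, rfl⟩ := Nat.exists_eq_add_of_le' hs
  exact (h.reward_adapted s).mono (ℱ.mono hst) le_rfl

/-! ### A maximal inequality for the rewards of one arm -/

open scoped Classical in
/-- The product of the factors `g (X s)` over the rounds `s ≤ t` in which arm `b` is pulled. -/
noncomputable def rewardProduct (arm : ℕ → Ω → A) (X : ℕ → Ω → ℝ) (b : A) (g : ℝ → ℝ≥0∞) (t : ℕ)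
    (ω : Ω) : ℝ≥0∞ :=
  ∏ s ∈ Finset.Icc 1 t, if arm s ω = b then g (X s ω) else 1

lemma rewardProduct_zero (b : A) (g : ℝ → ℝ≥0∞) (ω : Ω) : rewardProduct arm X b g 0 ω = 1 := by
  simp [rewardProduct]

open scoped Classical in
lemma rewardProduct_succ (b : A) (g : ℝ → ℝ≥0∞) (t : ℕ) (ω : Ω) :
    rewardProduct arm X b g (t + 1) ω
      = rewardProduct arm X b g t ω * if arm (t + 1) ω = b then g (X (t + 1) ω) else 1 := by
  simp [rewardProduct, Finset.prod_Icc_succ_top]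

lemma IsBanditProcess.measurable_rewardProduct (h : IsBanditProcess ν P ℱ arm X) (b : A)
    {g : ℝ → ℝ≥0∞} (hg : Measurable g) (t : ℕ) : Measurable[ℱ t] (rewardProduct arm X b g t) := by
  classical
  refine Finset.measurable_fun_prod _ fun s hs => ?_
  rw [Finset.mem_Icc] at hs
  exact Measurable.ite (h.measurableSet_arm hs.1 (by omega) b)
    (hg.comp (h.measurable_reward_of_le hs.1 hs.2)) measurable_const

/-- `rewardProduct` is a supermartingale as soon as `g` has integral at most `1`. -/
lemma IsBanditProcess.setLIntegral_rewardProduct_succ_le [IsProbabilityMeasure P]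
    [∀ a, IsProbabilityMeasure (ν a)] (h : IsBanditProcess ν P ℱ arm X) {b : A}
    {g : ℝ → ℝ≥0∞} (hg : Measurable g) (hg1 : ∫⁻ x, g x ∂(ν b) ≤ 1) {t : ℕ} {F : Set Ω}
    (hF : MeasurableSet[ℱ t] F) :
    ∫⁻ ω in F, rewardProduct arm X b g (t + 1) ω ∂P ≤ ∫⁻ ω in F, rewardProduct arm X b g t ω ∂P := by
  have hE : MeasurableSet[ℱ t] {ω | arm (t + 1) ω = b} := h.arm_predictable t b
  have hE' := ℱ.le t _ hE
  rw [← lintegral_inter_add_sdiff (μ := P) _ F hE', ← lintegral_inter_add_sdiff (μ := P) _ F hE']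
  refine add_le_add ?_ (le_of_eq ?_)
  · have e : ∫⁻ ω in F ∩ {ω | arm (t + 1) ω = b}, rewardProduct arm X b g (t + 1) ω ∂P
        = ∫⁻ ω in F ∩ {ω | arm (t + 1) ω = b},
          rewardProduct arm X b g t ω * g (X (t + 1) ω) ∂P := by
      refine setLIntegral_congr_fun ((ℱ.le t _ hF).inter hE') fun ω hω => ?_
      have hb : arm (t + 1) ω = b := hω.2
      simp [rewardProduct_succ, hb]
    rw [e, h.setLIntegral_mul_reward (hF.inter hE) Set.inter_subset_right hg
      (h.measurable_rewardProduct b hg t)]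
    exact mul_le_of_le_one_right' hg1
  · refine setLIntegral_congr_fun ((ℱ.le t _ hF).diff hE') fun ω hω => ?_
    have hb : arm (t + 1) ω ≠ b := hω.2
    simp [rewardProduct_succ, hb]

/-- Doob's maximal inequality between the rounds `t` and `t + d`, on an event of the past. -/
lemma IsBanditProcess.mul_measure_exists_le_rewardProduct_le [IsProbabilityMeasure P]
    [∀ a, IsProbabilityMeasure (ν a)] (h : IsBanditProcess ν P ℱ arm X) {b : A}
    {g : ℝ → ℝ≥0∞} (hg : Measurable g) (hg1 : ∫⁻ x, g x ∂(ν b) ≤ 1) (c : ℝ≥0∞) (d : ℕ) :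
    ∀ {t : ℕ} {F : Set Ω}, MeasurableSet[ℱ t] F →
      c * P (F ∩ {ω | ∃ s, t ≤ s ∧ s ≤ t + d ∧ c ≤ rewardProduct arm X b g s ω})
        ≤ ∫⁻ ω in F, rewardProduct arm X b g t ω ∂P := by
  -- The part of `F` where the threshold is reached at time `t`.
  have base : ∀ {t : ℕ} {F : Set Ω}, MeasurableSet[ℱ t] F →
      c * P (F ∩ {ω | c ≤ rewardProduct arm X b g t ω})
        ≤ ∫⁻ ω in F ∩ {ω | c ≤ rewardProduct arm X b g t ω}, rewardProduct arm X b g t ω ∂P := by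
    intro t F hF
    have hS : MeasurableSet {ω | c ≤ rewardProduct arm X b g t ω} :=
      measurableSet_le measurable_const ((h.measurable_rewardProduct b hg t).mono (ℱ.le t) le_rfl)
    rw [← setLIntegral_const]
    exact setLIntegral_mono' ((ℱ.le t _ hF).inter hS) fun ω hω => hω.2
  induction d with
  | zero =>
    intro t F hF
    refine le_trans ?_ ((base hF).trans (lintegral_mono_set Set.inter_subset_left))
    gcongr with ω
    rintro ⟨s, h1, h2, h3⟩
    obtain rfl : s = t := by omega
    exact h3
  | succ d ih =>
    intro t F hF
    have hS : MeasurableSet[ℱ t] {ω | c ≤ rewardProduct arm X b g t ω} :=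
      measurableSet_le measurable_const (h.measurable_rewardProduct b hg t)
    rw [← lintegral_inter_add_sdiff (μ := P) _ F (ℱ.le t _ hS)]
    have hsub : F ∩ {ω | ∃ s, t ≤ s ∧ s ≤ t + (d + 1) ∧ c ≤ rewardProduct arm X b g s ω}
        ⊆ (F ∩ {ω | c ≤ rewardProduct arm X b g t ω}) ∪
          ((F \ {ω | c ≤ rewardProduct arm X b g t ω}) ∩
            {ω | ∃ s, t + 1 ≤ s ∧ s ≤ t + 1 + d ∧ c ≤ rewardProduct arm X b g s ω}) := by
      rintro ω ⟨hω, s, h1, h2, h3⟩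
      by_cases hc : c ≤ rewardProduct arm X b g t ω
      · exact Or.inl ⟨hω, hc⟩
      · refine Or.inr ⟨⟨hω, hc⟩, s, ?_, by omega, h3⟩
        rcases h1.eq_or_lt with rfl | h1
        · exact absurd h3 hc
        · exact h1
    calc _ ≤ c * (P (F ∩ {ω | c ≤ rewardProduct arm X b g t ω}) +
          P ((F \ {ω | c ≤ rewardProduct arm X b g t ω}) ∩
            {ω | ∃ s, t + 1 ≤ s ∧ s ≤ t + 1 + d ∧ c ≤ rewardProduct arm X b g s ω})) := by
          gcongr
          exact (measure_mono hsub).trans (measure_union_le _ _)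
      _ ≤ _ := by
          rw [mul_add]
          refine add_le_add (base hF) ((ih (ℱ.mono (Nat.le_succ t) _ (hF.diff hS))).trans ?_)
          exact h.setLIntegral_rewardProduct_succ_le hg hg1 (hF.diff hS)

/-- Ville's inequality for `rewardProduct`. -/
lemma IsBanditProcess.mul_measure_exists_le_one [IsProbabilityMeasure P]
    [∀ a, IsProbabilityMeasure (ν a)] (h : IsBanditProcess ν P ℱ arm X) {b : A}
    {g : ℝ → ℝ≥0∞} (hg : Measurable g) (hg1 : ∫⁻ x, g x ∂(ν b) ≤ 1) (c : ℝ≥0∞) :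
    c * P {ω | ∃ t, c ≤ rewardProduct arm X b g t ω} ≤ 1 := by
  have hU : {ω | ∃ t, c ≤ rewardProduct arm X b g t ω}
      = ⋃ d : ℕ, {ω | ∃ s, 0 ≤ s ∧ s ≤ 0 + d ∧ c ≤ rewardProduct arm X b g s ω} := by
    ext ω
    simp only [Set.mem_ofPred_eq, Set.mem_iUnion]
    exact ⟨fun ⟨t, ht⟩ => ⟨t, t, Nat.zero_le _, by omega, ht⟩, fun ⟨_, t, _, _, ht⟩ => ⟨t, ht⟩⟩
  have hmono : Monotone fun d : ℕ =>
      {ω | ∃ s, 0 ≤ s ∧ s ≤ 0 + d ∧ c ≤ rewardProduct arm X b g s ω} := by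
    rintro d e hde ω ⟨s, h1, h2, h3⟩
    exact ⟨s, h1, by omega, h3⟩
  rw [hU, hmono.measure_iUnion, ENNReal.mul_iSup]
  refine iSup_le fun d => ?_
  have := h.mul_measure_exists_le_rewardProduct_le hg hg1 c d (t := 0) (F := Set.univ)
    MeasurableSet.univ
  simpa [rewardProduct_zero] using this

/-! ### Statistics of the process -/

open scoped Classical in
/-- The sum of the rewards of arm `a` in the rounds `1, …, t`. -/
noncomputable def rewardSum (arm : ℕ → A) (X : ℕ → ℝ) (a : A) (t : ℕ) : ℝ :=
  ∑ s ∈ (Finset.Icc 1 t).filter (fun s => arm s = a), X s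

lemma rewardSum_eq_pulls_mul_empMean (arm : ℕ → A) (X : ℕ → ℝ) (a : A) (t : ℕ) :
    rewardSum arm X a t = pulls arm a t * empMean arm X a t := by
  classical
  rw [empMean]
  split_ifs with h
  · rw [pulls, Finset.card_eq_zero] at h
    rw [rewardSum]
    have : (Finset.Icc 1 t).filter (fun s => arm s = a) = ∅ := by convert h
    simp [this]
  · rw [mul_div_cancel₀ _ (by exact_mod_cast h)]
    rw [rewardSum]

lemma empMean_eq_div (arm : ℕ → A) (X : ℕ → ℝ) (a : A) (t : ℕ) :
    empMean arm X a t = rewardSum arm X a t / pulls arm a t := by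
  rcases Nat.eq_zero_or_pos (pulls arm a t) with h | h
  · simp [empMean, h]
  · rw [rewardSum_eq_pulls_mul_empMean, mul_div_cancel_left₀]
    exact_mod_cast h.ne'

lemma pulls_zero (arm : ℕ → A) (a : A) : pulls arm a 0 = 0 := by simp [pulls]

open scoped Classical in
lemma pulls_succ (arm : ℕ → A) (a : A) (t : ℕ) :
    pulls arm a (t + 1) = pulls arm a t + if arm (t + 1) = a then 1 else 0 := by
  simp only [pulls, Finset.card_filter]
  rw [Finset.sum_Icc_succ_top (by omega)]

open scoped Classical in
lemma rewardSum_succ (arm : ℕ → A) (X : ℕ → ℝ) (a : A) (t : ℕ) :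
    rewardSum arm X a (t + 1) = rewardSum arm X a t + if arm (t + 1) = a then X (t + 1) else 0 := by
  simp only [rewardSum, Finset.sum_filter]
  rw [Finset.sum_Icc_succ_top (by omega)]

lemma pulls_mono (arm : ℕ → A) (a : A) : Monotone (pulls arm a) :=
  monotone_nat_of_le_succ fun t => by rw [pulls_succ]; omega

lemma pulls_le (arm : ℕ → A) (a : A) (t : ℕ) : pulls arm a t ≤ t := by
  classical
  rw [pulls]
  refine (Finset.card_filter_le _ _).trans ?_
  simp

lemma IsBanditProcess.measurable_pulls (h : IsBanditProcess ν P ℱ arm X) (b : A) (t : ℕ) :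
    Measurable[ℱ t] fun ω => pulls (fun s => arm s ω) b t := by
  classical
  simp_rw [pulls, Finset.card_filter]
  refine Finset.measurable_fun_sum _ fun s hs => ?_
  rw [Finset.mem_Icc] at hs
  exact Measurable.ite (h.measurableSet_arm hs.1 (by omega) b) measurable_const measurable_const

lemma IsBanditProcess.measurable_empMean (h : IsBanditProcess ν P ℱ arm X) (b : A) (t : ℕ) :
    Measurable[ℱ t] fun ω => empMean (fun s => arm s ω) (fun s => X s ω) b t := by
  classical
  simp_rw [empMean_eq_div]
  refine Measurable.div ?_ (measurable_from_top.comp (h.measurable_pulls b t))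
  simp_rw [rewardSum, Finset.sum_filter]
  refine Finset.measurable_fun_sum _ fun s hs => ?_
  rw [Finset.mem_Icc] at hs
  exact Measurable.ite (h.measurableSet_arm hs.1 (by omega) b)
    (h.measurable_reward_of_le hs.1 hs.2) measurable_const

lemma rewardProduct_exp (b : A) (α β : ℝ) (t : ℕ) (ω : Ω) :
    rewardProduct arm X b (fun x => ENNReal.ofReal (Real.exp (α * x + β))) t ω
      = ENNReal.ofReal (Real.exp (α * rewardSum (fun s => arm s ω) (fun s => X s ω) b t
        + β * pulls (fun s => arm s ω) b t)) := by
  classical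
  induction t with
  | zero => simp [rewardProduct_zero, rewardSum, pulls]
  | succ t ih =>
    rw [rewardProduct_succ, ih, rewardSum_succ, pulls_succ]
    split_ifs with hb
    · rw [← ENNReal.ofReal_mul (Real.exp_pos _).le, ← Real.exp_add]
      congr 2
      push_cast
      ring
    · simp

/-- A Chernoff bound, uniform in time, for the rewards of one arm. -/
lemma IsBanditProcess.measure_exists_le_rewardSum [IsProbabilityMeasure P]
    [∀ a, IsProbabilityMeasure (ν a)] (h : IsBanditProcess ν P ℱ arm X) {b : A} {α β : ℝ}
    (hint : ∫⁻ x, ENNReal.ofReal (Real.exp (α * x + β)) ∂(ν b) ≤ 1) (y : ℝ) :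
    P.real {ω | ∃ t, y ≤ α * rewardSum (fun s => arm s ω) (fun s => X s ω) b t
      + β * pulls (fun s => arm s ω) b t} ≤ Real.exp (-y) := by
  have := h.mul_measure_exists_le_one (by fun_prop) hint (ENNReal.ofReal (Real.exp y))
  simp_rw [rewardProduct_exp, ENNReal.ofReal_le_ofReal_iff (Real.exp_pos _).le,
    Real.exp_le_exp] at this
  have h2 := ENNReal.toReal_mono ENNReal.one_ne_top this
  rw [ENNReal.toReal_mul, ENNReal.toReal_ofReal (Real.exp_pos _).le] at h2
  rw [Real.exp_neg, ← one_div, le_div_iff₀ (Real.exp_pos _), mul_comm]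
  simpa [measureReal_def] using h2

end Interaction

/-! ### Kullback-Leibler divergences in the two families -/

namespace RewardFamily

instance (fam : RewardFamily) (m : ℝ) : IsProbabilityMeasure (fam.law m) := by
  cases fam
  · exact inferInstanceAs (IsProbabilityMeasure (gaussianReal m 1))
  · exact inferInstanceAs (IsProbabilityMeasure (bernoulliMeasure _ _ _))

/-- Closed form of `KL(x | u)` for `u` in the interior of the parameter space. In the Bernoulli case
the boundary values `x = 0` and `x = 1` are covered thanks to `0 * log 0 = 0`. -/
noncomputable def klFormula : RewardFamily → ℝ → ℝ → ℝ
  | gaussian, x, u => (x - u) ^ 2 / 2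
  | bernoulli, x, u =>
      x * Real.log x + (1 - x) * Real.log (1 - x) - x * Real.log u - (1 - x) * Real.log (1 - u)

lemma means_subset_extendedMeans (fam : RewardFamily) : fam.means ⊆ fam.extendedMeans := by
  cases fam
  · exact subset_rfl
  · exact Set.Ioo_subset_Icc_self

lemma ordConnected_means (fam : RewardFamily) : fam.means.OrdConnected := by
  cases fam
  · exact Set.ordConnected_univ
  · exact Set.ordConnected_Ioo

lemma isOpen_means (fam : RewardFamily) : IsOpen fam.means := by
  cases fam
  · exact isOpen_univ
  · exact isOpen_Ioo

lemma gaussianReal_eq_withDensity (x u : ℝ) :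
    gaussianReal x 1 = (gaussianReal u 1).withDensity
      (fun y => ENNReal.ofReal (Real.exp ((x - u) * y + (u ^ 2 - x ^ 2) / 2))) := by
  rw [gaussianReal_of_var_ne_zero _ one_ne_zero, gaussianReal_of_var_ne_zero _ one_ne_zero,
    ← withDensity_mul _ (measurable_gaussianPDF _ _) (by fun_prop)]
  congr 1
  ext y
  simp only [Pi.mul_apply, gaussianPDF, gaussianPDFReal]
  rw [← ENNReal.ofReal_mul (by positivity)]
  congr 1
  rw [mul_assoc _ (Real.exp _) (Real.exp _), ← Real.exp_add]
  congr 2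
  simp only [NNReal.coe_one]
  ring

lemma KL_gaussian (x u : ℝ) :
    gaussian.KL x u = ENNReal.ofReal (gaussian.klFormula x u) := by
  have hac : gaussianReal x 1 ≪ gaussianReal u 1 :=
    (gaussianReal_absolutelyContinuous x one_ne_zero).trans
      (gaussianReal_absolutelyContinuous' u one_ne_zero)
  have hllr : llr (gaussianReal x 1) (gaussianReal u 1)
      =ᵐ[gaussianReal x 1] fun y => (x - u) * y + (u ^ 2 - x ^ 2) / 2 := by
    have h : (gaussianReal x 1).rnDeriv (gaussianReal u 1) =ᵐ[gaussianReal u 1]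
        (fun y => ENNReal.ofReal (Real.exp ((x - u) * y + (u ^ 2 - x ^ 2) / 2))) := by
      conv_lhs => rw [gaussianReal_eq_withDensity x u]
      exact Measure.rnDeriv_withDensity _ (by fun_prop)
    filter_upwards [hac.ae_le h] with y hy
    rw [llr, hy, ENNReal.toReal_ofReal (Real.exp_pos _).le, Real.log_exp]
  have hid : Integrable (fun y : ℝ => y) (gaussianReal x 1) :=
    (memLp_id_gaussianReal 1).integrable le_rfl
  have hint : Integrable (llr (gaussianReal x 1) (gaussianReal u 1)) (gaussianReal x 1) :=
    ((hid.const_mul _).add (integrable_const _)).congr hllr.symm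
  rw [KL, law, law, InformationTheory.klDiv_of_ac_of_integrable hac hint,
    integral_congr_ae hllr, integral_add (hid.const_mul _) (integrable_const _),
    integral_const_mul, integral_id_gaussianReal]
  simp only [probReal_univ, integral_const, smul_eq_mul, one_mul, klFormula]
  congr 1
  ring

lemma law_bernoulli {m : ℝ} (hm : m ∈ Set.Icc (0 : ℝ) 1) :
    bernoulli.law m = ENNReal.ofReal m • Measure.dirac 1
      + ENNReal.ofReal (1 - m) • Measure.dirac 0 := by
  rw [law, Set.projIcc_of_mem zero_le_one hm, bernoulliMeasure_def]
  have e1 : ENNReal.ofReal m = (unitInterval.toNNReal ⟨m, hm⟩ : ℝ≥0∞) := by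
    rw [ENNReal.ofReal, Real.toNNReal_of_nonneg hm.1]; rfl
  have e2 : ENNReal.ofReal (1 - m)
      = (unitInterval.toNNReal (unitInterval.symm ⟨m, hm⟩) : ℝ≥0∞) := by
    rw [ENNReal.ofReal, Real.toNNReal_of_nonneg (sub_nonneg.2 hm.2)]; rfl
  rw [e1, e2]
  rfl

lemma lintegral_law_bernoulli {m : ℝ} (hm : m ∈ Set.Icc (0 : ℝ) 1) (f : ℝ → ℝ≥0∞) :
    ∫⁻ x, f x ∂(bernoulli.law m) = ENNReal.ofReal m * f 1 + ENNReal.ofReal (1 - m) * f 0 := by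
  rw [law_bernoulli hm, lintegral_add_measure, lintegral_smul_measure, lintegral_smul_measure,
    lintegral_dirac, lintegral_dirac]
  rfl

lemma integral_law_bernoulli {m : ℝ} (hm : m ∈ Set.Icc (0 : ℝ) 1) (f : ℝ → ℝ) :
    ∫ x, f x ∂(bernoulli.law m) = m * f 1 + (1 - m) * f 0 := by
  rw [law, Set.projIcc_of_mem zero_le_one hm, integral_bernoulliMeasure]
  rfl

lemma bernoulli_eq_withDensity {x u : ℝ} (hx : x ∈ Set.Icc (0 : ℝ) 1)
    (hu : u ∈ Set.Ioo (0 : ℝ) 1) :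
    bernoulli.law x = (bernoulli.law u).withDensity
      (fun y => ENNReal.ofReal (if y = 1 then x / u else (1 - x) / (1 - u))) := by
  have hu1 : 0 < 1 - u := by linarith [hu.2]
  ext s hs
  rw [withDensity_apply _ hs, ← lintegral_indicator hs,
    lintegral_law_bernoulli (Set.Ioo_subset_Icc_self hu), law_bernoulli hx]
  have e1 : ENNReal.ofReal u * ENNReal.ofReal (x / u) = ENNReal.ofReal x := by
    rw [← ENNReal.ofReal_mul hu.1.le, mul_div_cancel₀ _ hu.1.ne']
  have e2 : ENNReal.ofReal (1 - u) * ENNReal.ofReal ((1 - x) / (1 - u))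
      = ENNReal.ofReal (1 - x) := by
    rw [← ENNReal.ofReal_mul hu1.le, mul_div_cancel₀ _ hu1.ne']
  by_cases h1 : (1 : ℝ) ∈ s <;> by_cases h0 : (0 : ℝ) ∈ s <;> simp [h1, h0, hs, e1, e2]

lemma KL_bernoulli {x u : ℝ} (hx : x ∈ Set.Icc (0 : ℝ) 1) (hu : u ∈ Set.Ioo (0 : ℝ) 1) :
    bernoulli.KL x u = ENNReal.ofReal (bernoulli.klFormula x u) := by
  have hu1 : 0 < 1 - u := by linarith [hu.2]
  have hx1 : 0 ≤ 1 - x := by linarith [hx.2]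
  have hd := bernoulli_eq_withDensity hx hu
  have hmeas : Measurable fun y : ℝ =>
      ENNReal.ofReal (if y = 1 then x / u else (1 - x) / (1 - u)) :=
    (Measurable.ite (measurableSet_singleton 1) measurable_const measurable_const).ennreal_ofReal
  have hac : bernoulli.law x ≪ bernoulli.law u := by
    rw [hd]; exact withDensity_absolutelyContinuous _ _
  have hrn : (bernoulli.law x).rnDeriv (bernoulli.law u) =ᵐ[bernoulli.law u]
      (fun y => ENNReal.ofReal (if y = 1 then x / u else (1 - x) / (1 - u))) := by
    conv_lhs => rw [hd]
    exact Measure.rnDeriv_withDensity _ hmeas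
  have hr1 : 0 ≤ x / u := div_nonneg hx.1 hu.1.le
  have hr0 : 0 ≤ (1 - x) / (1 - u) := div_nonneg hx1 hu1.le
  rw [KL, InformationTheory.klDiv_eq_lintegral_klFun_of_ac hac]
  have hcongr : ∫⁻ y, ENNReal.ofReal (InformationTheory.klFun
        ((bernoulli.law x).rnDeriv (bernoulli.law u) y).toReal) ∂(bernoulli.law u)
      = ∫⁻ y, ENNReal.ofReal (InformationTheory.klFun
        (if y = 1 then x / u else (1 - x) / (1 - u))) ∂(bernoulli.law u) := by
    refine lintegral_congr_ae ?_
    filter_upwards [hrn] with y hy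
    rw [hy, ENNReal.toReal_ofReal]
    split_ifs <;> assumption
  rw [hcongr, lintegral_law_bernoulli (Set.Ioo_subset_Icc_self hu)]
  simp only [if_true, zero_ne_one, if_false]
  rw [← ENNReal.ofReal_mul hu.1.le, ← ENNReal.ofReal_mul hu1.le, ← ENNReal.ofReal_add
    (mul_nonneg hu.1.le (InformationTheory.klFun_nonneg hr1))
    (mul_nonneg hu1.le (InformationTheory.klFun_nonneg hr0))]
  congr 1
  have key : ∀ {p q : ℝ}, 0 ≤ p → 0 < q →
      q * InformationTheory.klFun (p / q) = p * Real.log p - p * Real.log q + q - p := by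
    intro p q hp hq
    rw [InformationTheory.klFun]
    rcases hp.eq_or_lt with rfl | hp
    · simp
    · rw [Real.log_div hp.ne' hq.ne']
      field_simp
  rw [key hx.1 hu.1, key hx1 hu1, klFormula]
  ring

lemma KL_eq_ofReal {fam : RewardFamily} {x u : ℝ} (hx : x ∈ fam.extendedMeans)
    (hu : u ∈ fam.means) : fam.KL x u = ENNReal.ofReal (fam.klFormula x u) := by
  cases fam
  · exact KL_gaussian x u
  · exact KL_bernoulli hx hu

lemma KL_self (fam : RewardFamily) (x : ℝ) : fam.KL x x = 0 :=
  InformationTheory.klDiv_self _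

lemma KL_bernoulli_one {x : ℝ} (hx : x ∈ Set.Ico (0 : ℝ) 1) : bernoulli.KL x 1 = ∞ := by
  refine InformationTheory.klDiv_of_not_ac fun hac => ?_
  have h0 : bernoulli.law 1 {0} = 0 := by
    rw [law_bernoulli ⟨zero_le_one, le_rfl⟩]; simp
  have := hac h0
  rw [law_bernoulli ⟨hx.1, hx.2.le⟩] at this
  simp at this
  linarith [hx.2]

lemma mul_log_sub_log_le {x u : ℝ} (hx : 0 ≤ x) (hu : 0 < u) :
    x * Real.log u - x * Real.log x ≤ u - x := by
  rcases hx.eq_or_lt with rfl | hx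
  · simpa using hu.le
  · have h := Real.log_le_sub_one_of_pos (div_pos hu hx)
    rw [Real.log_div hu.ne' hx.ne'] at h
    have := mul_le_mul_of_nonneg_left h hx.le
    have e : x * (u / x - 1) = u - x := by field_simp
    linarith [this, e, mul_sub x (Real.log u) (Real.log x)]

lemma klFormula_nonneg {fam : RewardFamily} {x u : ℝ} (hx : x ∈ fam.extendedMeans)
    (hu : u ∈ fam.means) : 0 ≤ fam.klFormula x u := by
  cases fam
  · simp only [klFormula]; positivity
  · have h1 := mul_log_sub_log_le hx.1 hu.1
    have h2 := mul_log_sub_log_le (sub_nonneg.2 hx.2) (sub_pos.2 hu.2)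
    simp only [klFormula]
    linarith

lemma toReal_KL {fam : RewardFamily} {x u : ℝ} (hx : x ∈ fam.extendedMeans)
    (hu : u ∈ fam.means) : (fam.KL x u).toReal = fam.klFormula x u := by
  rw [KL_eq_ofReal hx hu, ENNReal.toReal_ofReal (klFormula_nonneg hx hu)]

/-- A one-sided Pythagorean inequality. -/
lemma klFormula_add_le {fam : RewardFamily} {x u v : ℝ} (hu : u ∈ fam.means) (hv : v ∈ fam.means)
    (hxu : x ≤ u) (huv : u ≤ v) :
    fam.klFormula x u + fam.klFormula u v ≤ fam.klFormula x v := by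
  cases fam
  · simp only [klFormula]
    nlinarith [mul_nonneg (sub_nonneg.2 hxu) (sub_nonneg.2 huv)]
  · have h1 : Real.log u ≤ Real.log v := Real.log_le_log hu.1 huv
    have h2 : Real.log (1 - v) ≤ Real.log (1 - u) :=
      Real.log_le_log (by linarith [hv.2]) (by linarith)
    simp only [klFormula]
    nlinarith [mul_nonneg (sub_nonneg.2 hxu) (sub_nonneg.2 h1),
      mul_nonneg (sub_nonneg.2 hxu) (sub_nonneg.2 h2)]

lemma klFormula_add_le' {fam : RewardFamily} {x y u : ℝ} (hy : y ∈ fam.means) (hu : u ∈ fam.means)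
    (hxy : x ≤ y) (hyu : y ≤ u) : fam.klFormula y u ≤ fam.klFormula x u - fam.klFormula x y := by
  linarith [klFormula_add_le hy hu hxy hyu]

lemma klFormula_pos {fam : RewardFamily} {x u : ℝ} (hx : x ∈ fam.means) (hu : u ∈ fam.means)
    (hxu : x < u) : 0 < fam.klFormula x u := by
  cases fam
  · simp only [klFormula]; nlinarith [sq_pos_of_pos (sub_pos.2 hxu)]
  · have h2 := mul_log_sub_log_le (sub_nonneg.2 hx.2.le) (sub_pos.2 hu.2)
    -- Strictness comes from the first term.
    have h1 : x * Real.log u - x * Real.log x < u - x := by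
      have h := Real.log_lt_sub_one_of_pos (div_pos hu.1 hx.1) (by
        rw [ne_eq, div_eq_one_iff_eq hx.1.ne']; exact hxu.ne')
      rw [Real.log_div hu.1.ne' hx.1.ne'] at h
      have := mul_lt_mul_of_pos_left h hx.1
      have e : x * (u / x - 1) = u - x := by field_simp [hx.1.ne']
      linarith [this, e, mul_sub x (Real.log u) (Real.log x)]
    simp only [klFormula]
    linarith

/-- `KL(x | u)` decreases when `x ≤ u` get closer to each other, also at the boundary of the
parameter space. -/
lemma KL_mono {fam : RewardFamily} {x y u v : ℝ} (hx : x ∈ fam.extendedMeans)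
    (hv : v ∈ fam.extendedMeans) (hxy : x ≤ y) (hyu : y ≤ u) (huv : u ≤ v) :
    fam.KL y u ≤ fam.KL x v := by
  rcases hyu.eq_or_lt with rfl | hyu
  · rw [KL_self]; exact zero_le
  have main : ∀ {x y u v : ℝ}, x ∈ fam.extendedMeans → u ∈ fam.means → v ∈ fam.means →
      x ≤ y → y < u → u ≤ v → fam.klFormula y u ≤ fam.klFormula x v := by
    intro x y u v hx hu hv hxy hyu huv
    have hx' : x ∈ fam.means → fam.klFormula y u ≤ fam.klFormula x u := fun hxm => by
      have hy : y ∈ fam.means := fam.ordConnected_means.out hxm hu ⟨hxy, hyu.le⟩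
      linarith [klFormula_add_le' hy hu hxy hyu.le, klFormula_nonneg hx hy]
    have h2 : fam.klFormula y u ≤ fam.klFormula x u := by
      rcases hxy.eq_or_lt with rfl | hxy
      · exact le_rfl
      cases fam
      · exact hx' trivial
      · have hy : y ∈ bernoulli.means := ⟨hx.1.trans_lt hxy, hyu.trans hu.2⟩
        linarith [klFormula_add_le' hy hu hxy.le hyu.le, klFormula_nonneg hx hy]
    have h3 := klFormula_add_le hu hv (hxy.trans hyu.le) huv
    linarith [klFormula_nonneg (fam.means_subset_extendedMeans hu) hv]
  cases fam
  · rw [KL_gaussian, KL_gaussian]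
    exact ENNReal.ofReal_le_ofReal (main trivial trivial trivial hxy hyu huv)
  · have hx1 : x < 1 := hxy.trans_lt (hyu.trans_le (huv.trans hv.2))
    rcases hv.2.eq_or_lt with rfl | hv1
    · rw [KL_bernoulli_one ⟨hx.1, hx1⟩]; exact le_top
    have hu : u ∈ bernoulli.means := ⟨(hx.1.trans hxy).trans_lt hyu, huv.trans_lt hv1⟩
    have hv' : v ∈ bernoulli.means := ⟨hu.1.trans_le huv, hv1⟩
    rw [KL_bernoulli ⟨hx.1.trans hxy, hyu.le.trans hu.2.le⟩ hu, KL_bernoulli hx hv']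
    exact ENNReal.ofReal_le_ofReal (main hx hu hv' hxy hyu huv)

lemma tendsto_klFormula (fam : RewardFamily) {x u : ℝ} (hx : x ∈ fam.means) (hu : u ∈ fam.means) :
    Tendsto (fun ε : ℝ => fam.klFormula (x + ε) (u - ε)) (𝓝 0) (𝓝 (fam.klFormula x u)) := by
  have hc : ContinuousAt (fun ε : ℝ => fam.klFormula (x + ε) (u - ε)) 0 := by
    cases fam
    · simp only [klFormula]; fun_prop
    · have h1 : x + 0 ≠ 0 := by linarith [hx.1]
      have h2 : 1 - (x + 0) ≠ 0 := by linarith [hx.2]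
      have h3 : u - 0 ≠ 0 := by linarith [hu.1]
      have h4 : 1 - (u - 0) ≠ 0 := by linarith [hu.2]
      simp only [klFormula]
      fun_prop (disch := assumption)
  simpa [ContinuousAt] using hc

/-! ### Exponential moments -/

/-- Both families are sub-Gaussian with variance proxy `1`. -/
lemma lintegral_exp_le_one (fam : RewardFamily) {m : ℝ} (hm : m ∈ fam.means) (l : ℝ) :
    ∫⁻ x, ENNReal.ofReal (Real.exp (l * x + (-(l * m) - l ^ 2 / 2))) ∂(fam.law m) ≤ 1 := by
  cases fam
  · have h := gaussianReal_eq_withDensity (m + l) m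
    have h1 : (gaussianReal m 1).withDensity (fun y => ENNReal.ofReal
        (Real.exp ((m + l - m) * y + (m ^ 2 - (m + l) ^ 2) / 2))) Set.univ = 1 := by
      rw [← h]; exact measure_univ
    rw [withDensity_apply _ MeasurableSet.univ, Measure.restrict_univ] at h1
    refine le_of_eq ?_
    rw [← h1]
    refine lintegral_congr fun y => ?_
    congr 2
    ring
  · have hm' := Set.Ioo_subset_Icc_self hm
    have hsub : m * Real.exp l + (1 - m) ≤ Real.exp (l * m + l ^ 2 / 2) := by
      have hae : ∀ᵐ x ∂(bernoulli.law m), x ∈ Set.Icc (0 : ℝ) 1 := by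
        rw [law_bernoulli hm', ae_iff]
        simp
      -- Hoeffding's lemma
      have h := (hasSubgaussianMGF_of_mem_Icc (X := id) aemeasurable_id hae).mgf_le l
      simp only [mgf, id, integral_law_bernoulli hm'] at h
      have e : m * Real.exp l + (1 - m) = Real.exp (l * m)
          * (m * Real.exp (l * (1 - (m * 1 + (1 - m) * 0)))
            + (1 - m) * Real.exp (l * (0 - (m * 1 + (1 - m) * 0)))) := by
        rw [mul_add, mul_left_comm, mul_left_comm (Real.exp (l * m)) (1 - m), ← Real.exp_add,
          ← Real.exp_add]
        ring_nf
        simp only [Real.exp_zero]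
        ring
      rw [e, Real.exp_add]
      refine mul_le_mul_of_nonneg_left (h.trans (Real.exp_le_exp.2 ?_)) (Real.exp_pos _).le
      norm_num
      nlinarith [sq_nonneg l]
    rw [lintegral_law_bernoulli hm', ← ENNReal.ofReal_mul hm.1.le,
      ← ENNReal.ofReal_mul (by linarith [hm.2]), ← ENNReal.ofReal_add
        (mul_nonneg hm.1.le (Real.exp_pos _).le)
        (mul_nonneg (by linarith [hm.2]) (Real.exp_pos _).le), ← ENNReal.ofReal_one]
    refine ENNReal.ofReal_le_ofReal ?_
    have e : m * Real.exp (l * 1 + (-(l * m) - l ^ 2 / 2))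
        + (1 - m) * Real.exp (l * 0 + (-(l * m) - l ^ 2 / 2))
        = (m * Real.exp l + (1 - m)) * Real.exp (-(l * m + l ^ 2 / 2)) := by
      rw [Real.exp_add, show l * 0 + (-(l * m) - l ^ 2 / 2) = -(l * m + l ^ 2 / 2) by ring,
        show -(l * m) - l ^ 2 / 2 = -(l * m + l ^ 2 / 2) by ring]
      ring_nf
    rw [e, Real.exp_neg, ← div_eq_mul_inv, div_le_one (Real.exp_pos _)]
    exact hsub

lemma integrable_id_law (fam : RewardFamily) {m : ℝ} (hm : m ∈ fam.means) :
    Integrable (fun x : ℝ => x) (fam.law m) := by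
  cases fam
  · exact (memLp_id_gaussianReal 1).integrable le_rfl
  · rw [law_bernoulli (Set.Ioo_subset_Icc_self hm)]
    refine Integrable.add_measure ?_ ?_ <;>
    exact (integrable_dirac (by simp)).smul_measure ENNReal.ofReal_ne_top

lemma integral_id_law (fam : RewardFamily) {m : ℝ} (hm : m ∈ fam.means) :
    ∫ x, x ∂(fam.law m) = m := by
  cases fam
  · exact integral_id_gaussianReal
  · rw [integral_law_bernoulli (Set.Ioo_subset_Icc_self hm)]; ring

/-- Every half-line that starts below a point of the parameter space has positive mass. -/
lemma measureReal_law_Iio_pos (fam : RewardFamily) {m x : ℝ} (hm : m ∈ fam.means)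
    (hx : x ∈ fam.means) : 0 < (fam.law m).real (Set.Iio x) := by
  rw [measureReal_def, ENNReal.toReal_pos_iff]
  refine ⟨pos_iff_ne_zero.2 fun h => ?_, measure_lt_top _ _⟩
  cases fam
  · have := gaussianReal_absolutelyContinuous' m one_ne_zero h
    simp at this
  · rw [law_bernoulli (Set.Ioo_subset_Icc_self hm)] at h
    have : ¬ (1 : ℝ) ≤ m := not_le.2 hm.2
    simp [hx.1] at h
    exact this h.2

end RewardFamily

open RewardFamily

/-! ### Deviations of the empirical means -/

section Rates

variable {A : Type*} {Ω : Type*} {mΩ : MeasurableSpace Ω} {P : Measure Ω} [IsProbabilityMeasure P]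
  {ℱ : Filtration ℕ mΩ} {arm : ℕ → Ω → A} {X : ℕ → Ω → ℝ} {fam : RewardFamily} {μ : A → ℝ}

lemma IsBanditProcess.ae_reward_mem [Finite A] {ν : A → Measure ℝ}
    [∀ a, IsProbabilityMeasure (ν a)] (h : IsBanditProcess ν P ℱ arm X) {B : Set ℝ}
    (hB : MeasurableSet B) (hν : ∀ a, ν a Bᶜ = 0) : ∀ᵐ ω ∂P, ∀ t, X (t + 1) ω ∈ B := by
  rw [ae_all_iff]
  intro t
  have : {ω | ¬ X (t + 1) ω ∈ B} ⊆ ⋃ a, {ω | arm (t + 1) ω = a} ∩ X (t + 1) ⁻¹' Bᶜ := by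
    intro ω hω
    exact Set.mem_iUnion.2 ⟨arm (t + 1) ω, rfl, hω⟩
  refine measure_mono_null this (measure_iUnion_null fun a => ?_)
  rw [h.measure_inter_preimage (h.arm_predictable t a) subset_rfl hB.compl, hν, mul_zero]

lemma IsBanditProcess.ae_reward_eq_zero_or_one [Finite A] (hμ : ∀ a, μ a ∈ bernoulli.means)
    (h : IsBanditProcess (fun a => bernoulli.law (μ a)) P ℱ arm X) :
    ∀ᵐ ω ∂P, ∀ t, X (t + 1) ω ∈ ({0, 1} : Set ℝ) := by
  refine h.ae_reward_mem (by measurability) fun a => ?_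
  rw [law_bernoulli (Set.Ioo_subset_Icc_self (hμ a))]
  simp

omit [IsProbabilityMeasure P] in
lemma rewardSum_eq_natCast {arm : ℕ → A} {X : ℕ → ℝ} (hX : ∀ t, X (t + 1) ∈ ({0, 1} : Set ℝ))
    (b : A) (t : ℕ) : ∃ i : ℕ, i ≤ pulls arm b t ∧ rewardSum arm X b t = i := by
  classical
  induction t with
  | zero => exact ⟨0, by simp, by simp [rewardSum]⟩
  | succ t ih =>
    obtain ⟨i, hi, hS⟩ := ih
    rw [pulls_succ, rewardSum_succ, hS]
    by_cases hb : arm (t + 1) = b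
    · rcases hX t with h0 | h1
      · exact ⟨i, by simp [hb]; omega, by simp [hb, h0]⟩
      · rw [Set.mem_singleton_iff] at h1
        exact ⟨i + 1, by simp [hb]; omega, by simp [hb, h1]⟩
    · exact ⟨i, by simp [hb, hi], by simp [hb]⟩

/-- Empirical means lie in the closure of the parameter space. -/
lemma IsBanditProcess.ae_empMean_mem [Finite A] (hμ : ∀ a, μ a ∈ fam.means)
    (h : IsBanditProcess (fun a => fam.law (μ a)) P ℱ arm X) :
    ∀ᵐ ω ∂P, ∀ b t, empMean (fun s => arm s ω) (fun s => X s ω) b t ∈ fam.extendedMeans := by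
  cases fam
  · exact ae_of_all _ fun ω b t => trivial
  · filter_upwards [h.ae_reward_eq_zero_or_one hμ] with ω hω b t
    obtain ⟨i, hi, hS⟩ := rewardSum_eq_natCast (arm := fun s => arm s ω) (X := fun s => X s ω) hω b t
    rw [empMean_eq_div, hS]
    exact ⟨by positivity, div_le_one_of_le₀ (by exact_mod_cast hi) (by positivity)⟩

lemma IsBanditProcess.measure_exists_le_empMean_sub (hμ : ∀ a, μ a ∈ fam.means)
    (h : IsBanditProcess (fun a => fam.law (μ a)) P ℱ arm X) (b : A) (n : ℕ) {d : ℝ} (hd : 0 ≤ d) :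
    P.real {ω | ∃ t, n ≤ pulls (fun s => arm s ω) b t ∧
      d ≤ empMean (fun s => arm s ω) (fun s => X s ω) b t - μ b} ≤ Real.exp (-(n * d ^ 2 / 2)) := by
  refine (measureReal_mono ?_).trans
    (h.measure_exists_le_rewardSum (lintegral_exp_le_one fam (hμ b) d) (n * d ^ 2 / 2))
  rintro ω ⟨t, hn, hdev⟩
  refine ⟨t, ?_⟩
  rw [rewardSum_eq_pulls_mul_empMean]
  have hn' : (n : ℝ) ≤ pulls (fun s => arm s ω) b t := by exact_mod_cast hn
  have h1 := mul_le_mul_of_nonneg_left hdev hd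
  have h2 := mul_le_mul_of_nonneg_left h1 (Nat.cast_nonneg (α := ℝ) (pulls (fun s => arm s ω) b t))
  nlinarith [mul_le_mul_of_nonneg_right hn' (sq_nonneg d)]

lemma IsBanditProcess.measure_exists_le_sub_empMean (hμ : ∀ a, μ a ∈ fam.means)
    (h : IsBanditProcess (fun a => fam.law (μ a)) P ℱ arm X) (b : A) (n : ℕ) {d : ℝ} (hd : 0 ≤ d) :
    P.real {ω | ∃ t, n ≤ pulls (fun s => arm s ω) b t ∧
      d ≤ μ b - empMean (fun s => arm s ω) (fun s => X s ω) b t} ≤ Real.exp (-(n * d ^ 2 / 2)) := by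
  refine (measureReal_mono ?_).trans
    (h.measure_exists_le_rewardSum (lintegral_exp_le_one fam (hμ b) (-d)) (n * d ^ 2 / 2))
  rintro ω ⟨t, hn, hdev⟩
  refine ⟨t, ?_⟩
  rw [rewardSum_eq_pulls_mul_empMean]
  have hn' : (n : ℝ) ≤ pulls (fun s => arm s ω) b t := by exact_mod_cast hn
  have h1 := mul_le_mul_of_nonneg_left hdev hd
  have h2 := mul_le_mul_of_nonneg_left h1 (Nat.cast_nonneg (α := ℝ) (pulls (fun s => arm s ω) b t))
  nlinarith [mul_le_mul_of_nonneg_right hn' (sq_nonneg d)]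

/-- The probability that a Bernoulli arm ever has empirical mean `x` after `k` pulls. -/
lemma IsBanditProcess.measure_exists_empMean_eq (hμ : ∀ a, μ a ∈ bernoulli.means)
    (h : IsBanditProcess (fun a => bernoulli.law (μ a)) P ℱ arm X) (b : A) (k : ℕ) {x : ℝ}
    (hx : x ∈ Set.Ico (0 : ℝ) 1) :
    P.real {ω | ∃ t, pulls (fun s => arm s ω) b t = k ∧
      empMean (fun s => arm s ω) (fun s => X s ω) b t = x}
      ≤ Real.exp (-(k * bernoulli.klFormula x (μ b))) := by
  obtain ⟨hm0, hm1⟩ := hμ b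
  have hm1' : 0 < 1 - μ b := sub_pos.2 hm1
  -- The likelihood ratio of the Bernoulli laws with means `y` and `μ b`, for any `y ∈ (0, 1)`.
  have key : ∀ y ∈ Set.Ioo (0 : ℝ) 1, P.real {ω | ∃ t, pulls (fun s => arm s ω) b t = k ∧
      empMean (fun s => arm s ω) (fun s => X s ω) b t = x}
      ≤ Real.exp (-(k * (x * Real.log y + (1 - x) * Real.log (1 - y)
        - x * Real.log (μ b) - (1 - x) * Real.log (1 - μ b)))) := by
    rintro y ⟨hy0, hy1⟩
    have hy1' : 0 < 1 - y := sub_pos.2 hy1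
    have hint : ∫⁻ z, ENNReal.ofReal (Real.exp ((Real.log (y / μ b)
        - Real.log ((1 - y) / (1 - μ b))) * z + Real.log ((1 - y) / (1 - μ b))))
        ∂(bernoulli.law (μ b)) ≤ 1 := by
      rw [lintegral_law_bernoulli ⟨hm0.le, hm1.le⟩, mul_one, mul_zero, zero_add,
        sub_add_cancel, Real.exp_log (by positivity), Real.exp_log (by positivity),
        ← ENNReal.ofReal_mul hm0.le, ← ENNReal.ofReal_mul hm1'.le,
        ← ENNReal.ofReal_add (by positivity) (by positivity), mul_div_cancel₀ _ hm0.ne',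
        mul_div_cancel₀ _ hm1'.ne']
      simp
    refine (measureReal_mono ?_).trans (h.measure_exists_le_rewardSum hint _)
    rintro ω ⟨t, hk, hmean⟩
    refine ⟨t, le_of_eq ?_⟩
    rw [rewardSum_eq_pulls_mul_empMean, hk, hmean, Real.log_div hy0.ne' hm0.ne',
      Real.log_div hy1'.ne' hm1'.ne']
    ring
  rcases hx.1.eq_or_lt with rfl | hx0
  · have hlim : Tendsto (fun y : ℝ => Real.exp (-(k * (0 * Real.log y + (1 - 0) * Real.log (1 - y)
        - 0 * Real.log (μ b) - (1 - 0) * Real.log (1 - μ b))))) (𝓝[>] 0)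
        (𝓝 (Real.exp (-(k * bernoulli.klFormula 0 (μ b))))) := by
      have hc : ContinuousAt (fun y : ℝ => Real.exp (-(k * ((1 - 0) * Real.log (1 - y)
        - 0 * Real.log (μ b) - (1 - 0) * Real.log (1 - μ b))))) 0 := by
        have : (1 : ℝ) - 0 ≠ 0 := by norm_num
        fun_prop (disch := assumption)
      have := hc.tendsto.mono_left (nhdsWithin_le_nhds (s := Set.Ioi 0))
      simpa [klFormula] using this
    refine ge_of_tendsto hlim ?_
    filter_upwards [Ioo_mem_nhdsGT (zero_lt_one' ℝ)] with y hy using key y hy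
  · exact key x ⟨hx0, hx.2⟩

/-! ### Rare events -/

/-- A union bound with rates: Tannery's theorem for `n * P (⋃ k, E n k)`. -/
lemma tendsto_mul_measure_iUnion {E : ℕ → ℕ → Set Ω} {q : ℕ → ℕ → ℝ} {D : ℕ → ℝ} (hD : Summable D)
    (hE : ∀ n k, 1 ≤ n → P.real (E n k) ≤ q n k) (hqD : ∀ n k, 1 ≤ n → n * q n k ≤ D k)
    (hq : ∀ k, Tendsto (fun n : ℕ => (n : ℝ) * q n k) atTop (𝓝 0)) :
    Tendsto (fun n : ℕ => (n : ℝ) * P.real (⋃ k, E n k)) atTop (𝓝 0) := by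
  have hq0 : ∀ n k, 1 ≤ n → 0 ≤ q n k := fun n k hn => measureReal_nonneg.trans (hE n k hn)
  have hlim : Tendsto (fun n : ℕ => ∑' k, (n : ℝ) * q n k) atTop (𝓝 0) := by
    have := tendsto_tsum_of_dominated_convergence (𝓕 := atTop) (g := fun _ => (0 : ℝ)) hD hq (by
      filter_upwards [eventually_ge_atTop 1] with n hn k
      rw [Real.norm_of_nonneg (mul_nonneg (by positivity) (hq0 n k hn))]
      exact hqD n k hn)
    simpa using this
  refine squeeze_zero' (Eventually.of_forall fun n => by positivity) ?_ hlim
  filter_upwards [eventually_ge_atTop 1] with n hn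
  have hn1 : (1 : ℝ) ≤ n := by exact_mod_cast hn
  have hs : Summable (q n) := Summable.of_nonneg_of_le (hq0 n · hn)
    (fun k => (le_mul_of_one_le_left (hq0 n k hn) hn1).trans (hqD n k hn)) hD
  rw [tsum_mul_left]
  refine mul_le_mul_of_nonneg_left ?_ (by positivity)
  rw [measureReal_def]
  refine ENNReal.toReal_le_of_le_ofReal (tsum_nonneg (hq0 n · hn)) ?_
  rw [ENNReal.ofReal_tsum_of_nonneg (hq0 n · hn) hs]
  refine (measure_iUnion_le _).trans (ENNReal.tsum_le_tsum fun k => ?_)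
  rw [← ofReal_measureReal]
  exact ENNReal.ofReal_le_ofReal (hE n k hn)

/-- Arm `b` has, at some time, been so unlucky that an index policy comparing it with an arm of mean
less than `μ b - ε` may leave it aside until that arm has been pulled `n` times. -/
def Underestimated (fam : RewardFamily) (μ : A → ℝ) (ε : ℝ) (arm : ℕ → A) (X : ℕ → ℝ) (b : A)
    (n : ℕ) : Prop :=
  ∃ t, 1 ≤ pulls arm b t ∧ empMean arm X b t ≤ μ b - ε ∧
    Real.log n ≤ pulls arm b t * fam.klFormula (empMean arm X b t) (μ b - ε)
      + Real.log (pulls arm b t)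

/-- Arm `b` is, at some time at which it has been pulled at least `n` times, badly estimated. -/
def Misestimated (μ : A → ℝ) (ε : ℝ) (arm : ℕ → A) (X : ℕ → ℝ) (b : A) (n : ℕ) : Prop :=
  ∃ t, n ≤ pulls arm b t ∧ ε ≤ |empMean arm X b t - μ b|

/-- The sample size `n` is exceptional: some arm is underestimated or misestimated at level `n`. -/
def Exceptional (fam : RewardFamily) (μ : A → ℝ) (ε : ℝ) (arm : ℕ → A) (X : ℕ → ℝ) (n : ℕ) : Prop :=
  ∃ b, Underestimated fam μ ε arm X b n ∨ Misestimated μ ε arm X b n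

lemma summable_sq_add_mul_exp {δ : ℝ} (hδ : 0 < δ) :
    Summable fun k : ℕ => ((k : ℝ) + 1) * k * Real.exp (-(k * δ)) := by
  have hr : ‖Real.exp (-δ)‖ < 1 := by
    rw [Real.norm_of_nonneg (Real.exp_pos _).le]; exact Real.exp_lt_one_iff.2 (by linarith)
  have h2 := summable_pow_mul_geometric_of_norm_lt_one 2 hr
  have h1 := summable_pow_mul_geometric_of_norm_lt_one 1 hr
  refine (h2.add h1).congr fun k => ?_
  rw [← Real.exp_nat_mul]
  ring_nf

/-- After `k` pulls, the condition defining `Underestimated` says that the empirical mean is below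
`μ b - ε - √(2 log (n / k) / k)`. By the Chernoff bound this has probability at most `k / n` times
`exp (-k ε ^ 2 / 2)`, which is summable in `k`, times a factor that tends to `0` with `n`. -/
lemma tendsto_mul_measure_underestimated_gaussian
    (h : IsBanditProcess (fun a => gaussian.law (μ a)) P ℱ arm X) (b : A) {ε : ℝ} (hε : 0 < ε) :
    Tendsto (fun n : ℕ => (n : ℝ) * P.real {ω | Underestimated gaussian μ ε (fun s => arm s ω)
      (fun s => X s ω) b n}) atTop (𝓝 0) := by
  set E : ℕ → ℕ → Set Ω := fun n k => {ω | 1 ≤ k ∧ ∃ t, k ≤ pulls (fun s => arm s ω) b t ∧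
    ε + √(2 * (Real.log (n / k) / k))
      ≤ μ b - empMean (fun s => arm s ω) (fun s => X s ω) b t} with hEdef
  set q : ℕ → ℕ → ℝ := fun n k => k / n * Real.exp (-(k * (ε ^ 2 / 2))) *
    Real.exp (-(k * ε * √(2 * (Real.log (n / k) / k)))) with hqdef
  have hnq : ∀ n k : ℕ, 1 ≤ n → n * q n k = k * Real.exp (-(k * (ε ^ 2 / 2))) *
      Real.exp (-(k * ε * √(2 * (Real.log (n / k) / k)))) := by
    intro n k hn
    have : (n : ℝ) ≠ 0 := by positivity
    simp only [hqdef]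
    field_simp
  have hsub : ∀ n : ℕ, 1 ≤ n → {ω | Underestimated gaussian μ ε (fun s => arm s ω)
      (fun s => X s ω) b n} ⊆ ⋃ k, E n k := by
    rintro n hn ω ⟨t, h1, h2, h3⟩
    refine Set.mem_iUnion.2 ⟨pulls (fun s => arm s ω) b t, h1, t, le_rfl, ?_⟩
    set k := pulls (fun s => arm s ω) b t
    set x := empMean (fun s => arm s ω) (fun s => X s ω) b t
    have hk : (0 : ℝ) < k := by exact_mod_cast h1
    have : √(2 * (Real.log (n / k) / k)) ≤ μ b - ε - x := by
      refine Real.sqrt_le_iff.2 ⟨by linarith, ?_⟩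
      rw [Real.log_div (by positivity) hk.ne', ← mul_div_assoc, div_le_iff₀ hk]
      simp only [klFormula] at h3
      nlinarith
    linarith
  have main : Tendsto (fun n : ℕ => (n : ℝ) * P.real (⋃ k, E n k)) atTop (𝓝 0) := by
    refine tendsto_mul_measure_iUnion (q := q)
      (summable_sq_add_mul_exp (δ := ε ^ 2 / 2) (by positivity)) ?_ ?_ ?_
    · intro n k hn
      rcases Nat.eq_zero_or_pos k with rfl | hk
      · simp [hEdef, hqdef]
      have hk' : (0 : ℝ) < k := by exact_mod_cast hk
      have hn' : (0 : ℝ) < n := by exact_mod_cast hn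
      refine (measureReal_mono (s₂ := {ω | ∃ t, k ≤ pulls (fun s => arm s ω) b t ∧
        ε + √(2 * (Real.log (n / k) / k))
          ≤ μ b - empMean (fun s => arm s ω) (fun s => X s ω) b t}) fun ω hω => hω.2).trans
        ((h.measure_exists_le_sub_empMean (fam := gaussian) (fun a => Set.mem_univ (μ a)) b k
          (by positivity)).trans ?_)
      simp only [hqdef]
      rw [← Real.exp_log (div_pos hk' hn'), ← Real.exp_add, ← Real.exp_add, Real.exp_le_exp]
      have e : Real.log ((k : ℝ) / n) = - Real.log (n / k) := by rw [← Real.log_inv, inv_div]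
      rw [e]
      rcases le_total 0 (2 * (Real.log ((n : ℝ) / k) / k)) with hz | hz
      · have hs := Real.sq_sqrt hz
        have e2 : (k : ℝ) * (2 * (Real.log ((n : ℝ) / k) / k)) = 2 * Real.log ((n : ℝ) / k) := by
          field_simp
        have e3 : (k : ℝ) * √(2 * (Real.log ((n : ℝ) / k) / k)) ^ 2 = 2 * Real.log ((n : ℝ) / k) := by
          rw [hs, e2]
        nlinarith
      · rw [Real.sqrt_eq_zero_of_nonpos hz]
        have : Real.log ((n : ℝ) / k) ≤ 0 := by
          by_contra! hc
          have : 0 < 2 * (Real.log ((n : ℝ) / k) / k) := by positivity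
          linarith
        nlinarith
    · intro n k hn
      rw [hnq n k hn]
      have h1 : Real.exp (-(k * ε * √(2 * (Real.log (n / k) / k)))) ≤ 1 := by
        rw [Real.exp_le_one_iff]
        have : 0 ≤ k * ε * √(2 * (Real.log ((n : ℝ) / k) / k)) := by positivity
        linarith
      refine (mul_le_of_le_one_right (by positivity) h1).trans ?_
      have : (0 : ℝ) ≤ k * (k * Real.exp (-(k * (ε ^ 2 / 2)))) := by positivity
      nlinarith
    · intro k
      rcases Nat.eq_zero_or_pos k with rfl | hk
      · simp [hqdef]
      have hk' : (0 : ℝ) < k := by exact_mod_cast hk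
      have h1 : Tendsto (fun n : ℕ => k * ε * √(2 * (Real.log ((n : ℝ) / k) / k))) atTop atTop := by
        refine Tendsto.const_mul_atTop (by positivity) (Real.tendsto_sqrt_atTop.comp ?_)
        refine Tendsto.const_mul_atTop two_pos (Tendsto.atTop_div_const hk' ?_)
        exact Real.tendsto_log_atTop.comp (tendsto_natCast_atTop_atTop.atTop_div_const hk')
      have h2 := (Real.tendsto_exp_neg_atTop_nhds_zero.comp h1).const_mul
        ((k : ℝ) * Real.exp (-(k * (ε ^ 2 / 2))))
      rw [mul_zero] at h2
      refine h2.congr' ?_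
      filter_upwards [eventually_ge_atTop 1] with n hn
      rw [hnq n k hn]
      rfl
  refine squeeze_zero' (Eventually.of_forall fun n => by positivity) ?_ main
  filter_upwards [eventually_ge_atTop 1] with n hn
  exact mul_le_mul_of_nonneg_left (measureReal_mono (hsub n hn)) (by positivity)

/-- After `k` pulls the empirical mean is one of the `k + 1` values `i / k`. At each of them with
`n ≤ k * exp (k * KL(i / k | μ b - ε))`, the Chernoff bound and the Pythagorean inequality
`klFormula_add_le` give the bound `k / n * exp (-k * KL(μ b - ε | μ b))`. As the divergences
`KL(i / k | μ b - ε)` are bounded, no value qualifies when `n` is large compared with `k`. -/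
lemma tendsto_mul_measure_underestimated_bernoulli [Finite A] (hμ : ∀ a, μ a ∈ bernoulli.means)
    (h : IsBanditProcess (fun a => bernoulli.law (μ a)) P ℱ arm X) (b : A) {ε : ℝ} (hε : 0 < ε)
    (hbε : μ b - ε ∈ bernoulli.means) :
    Tendsto (fun n : ℕ => (n : ℝ) * P.real {ω | Underestimated bernoulli μ ε (fun s => arm s ω)
      (fun s => X s ω) b n}) atTop (𝓝 0) := by
  set u := μ b - ε with hu
  have hub : u < μ b := by linarith
  set δ := bernoulli.klFormula u (μ b) with hδdef
  have hδ : 0 < δ := klFormula_pos hbε (hμ b) hub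
  set B := bernoulli.klFormula 0 u with hBdef
  have h0mem : (0 : ℝ) ∈ bernoulli.extendedMeans := ⟨le_rfl, zero_le_one⟩
  have hB : ∀ x, 0 ≤ x → x ≤ u → bernoulli.klFormula x u ≤ B := by
    intro x hx0 hxu
    have hx : x ∈ bernoulli.extendedMeans := ⟨hx0, hxu.trans hbε.2.le⟩
    have := KL_mono h0mem (bernoulli.means_subset_extendedMeans hbε) hx0 hxu le_rfl
    rw [KL_eq_ofReal hx hbε, KL_eq_ofReal h0mem hbε] at this
    exact (ENNReal.ofReal_le_ofReal_iff (klFormula_nonneg h0mem hbε)).1 this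
  set pt : ℕ → ℕ → Set Ω := fun k i => {ω | ∃ t, pulls (fun s => arm s ω) b t = k ∧
    empMean (fun s => arm s ω) (fun s => X s ω) b t = (i : ℝ) / k} with hpt
  classical
  set I : ℕ → ℕ → Finset ℕ := fun n k => (Finset.range (k + 1)).filter fun i =>
    1 ≤ k ∧ (i : ℝ) / k ≤ u ∧ Real.log n ≤ k * bernoulli.klFormula ((i : ℝ) / k) u + Real.log k
    with hI
  set E : ℕ → ℕ → Set Ω := fun n k => ⋃ i ∈ I n k, pt k i with hE
  set q : ℕ → ℕ → ℝ := fun n k => if Real.log n ≤ k * B + Real.log k then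
    (k + 1) * (k / n * Real.exp (-(k * δ))) else 0 with hq
  have hsub : ∀ n : ℕ, 1 ≤ n → {ω | Underestimated bernoulli μ ε (fun s => arm s ω)
      (fun s => X s ω) b n} ≤ᵐ[P] ((⋃ k, E n k : Set Ω) : Set Ω) := by
    intro n hn
    filter_upwards [h.ae_reward_eq_zero_or_one hμ] with ω hω
    rintro ⟨t, h1, h2, h3⟩
    obtain ⟨i, hi, hS⟩ := rewardSum_eq_natCast (arm := fun s => arm s ω) (X := fun s => X s ω) hω b t
    have hx := empMean_eq_div (fun s => arm s ω) (fun s => X s ω) b t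
    rw [hS] at hx
    refine Set.mem_iUnion.2 ⟨pulls (fun s => arm s ω) b t, Set.mem_iUnion₂.2 ⟨i, ?_, t, rfl, hx⟩⟩
    rw [← hu, hx] at h2 h3
    simp only [hI, Finset.mem_filter, Finset.mem_range]
    exact ⟨by omega, h1, h2, h3⟩
  have main : Tendsto (fun n : ℕ => (n : ℝ) * P.real (⋃ k, E n k)) atTop (𝓝 0) := by
    refine tendsto_mul_measure_iUnion (q := q) (summable_sq_add_mul_exp hδ) ?_ ?_ ?_
    · intro n k hn
      have hn' : (0 : ℝ) < n := by exact_mod_cast hn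
      have hpt_le : ∀ i ∈ I n k, P.real (pt k i) ≤ k / n * Real.exp (-(k * δ)) := by
        intro i hi
        simp only [hI, Finset.mem_filter, Finset.mem_range] at hi
        obtain ⟨-, hk, hiu, hlog⟩ := hi
        have hk' : (0 : ℝ) < k := by exact_mod_cast hk
        have hx0 : (0 : ℝ) ≤ (i : ℝ) / k := by positivity
        refine (h.measure_exists_empMean_eq hμ b k ⟨hx0, hiu.trans_lt hbε.2⟩).trans ?_
        rw [← Real.exp_log (div_pos hk' hn'), ← Real.exp_add, Real.exp_le_exp,
          Real.log_div hk'.ne' hn'.ne']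
        have := mul_le_mul_of_nonneg_left (klFormula_add_le hbε (hμ b) hiu hub.le) hk'.le
        linarith
      by_cases hc : Real.log n ≤ k * B + Real.log k
      · simp only [hq, if_pos hc]
        refine (measureReal_biUnion_finset_le _ _).trans
          ((Finset.sum_le_card_nsmul _ _ _ hpt_le).trans ?_)
        rw [nsmul_eq_mul]
        refine mul_le_mul_of_nonneg_right ?_ (by positivity)
        have : (I n k).card ≤ k + 1 := (Finset.card_filter_le _ _).trans (by simp)
        exact_mod_cast this
      · have hempty : I n k = ∅ := by
          rw [Finset.eq_empty_iff_forall_notMem]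
          intro i hi
          simp only [hI, Finset.mem_filter, Finset.mem_range] at hi
          obtain ⟨-, hk, hiu, hlog⟩ := hi
          have := mul_le_mul_of_nonneg_left (hB _ (by positivity : (0 : ℝ) ≤ (i : ℝ) / k) hiu)
            (Nat.cast_nonneg (α := ℝ) k)
          exact hc (by linarith)
        simp [hq, hc, hE, hempty]
    · intro n k hn
      have hn' : (n : ℝ) ≠ 0 := by positivity
      simp only [hq]
      split_ifs
      · refine le_of_eq ?_
        field_simp
      · rw [mul_zero]; positivity
    · intro k
      refine tendsto_const_nhds.congr' ?_
      have : Tendsto (fun n : ℕ => Real.log (n : ℝ)) atTop atTop :=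
        Real.tendsto_log_atTop.comp tendsto_natCast_atTop_atTop
      filter_upwards [this.eventually_gt_atTop (k * B + Real.log k)] with n hn
      simp only [hq, if_neg (not_le.2 hn), mul_zero]
  refine squeeze_zero' (Eventually.of_forall fun n => by positivity) ?_ main
  filter_upwards [eventually_ge_atTop 1] with n hn
  refine mul_le_mul_of_nonneg_left ?_ (by positivity)
  exact ENNReal.toReal_mono (measure_ne_top _ _) (measure_mono_ae (hsub n hn))

lemma tendsto_mul_measure_misestimated (hμ : ∀ a, μ a ∈ fam.means)
    (h : IsBanditProcess (fun a => fam.law (μ a)) P ℱ arm X) (b : A) {ε : ℝ} (hε : 0 < ε) :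
    Tendsto (fun n : ℕ => (n : ℝ) * P.real {ω | Misestimated μ ε (fun s => arm s ω)
      (fun s => X s ω) b n}) atTop (𝓝 0) := by
  have hb : ∀ n : ℕ, P.real {ω | Misestimated μ ε (fun s => arm s ω) (fun s => X s ω) b n}
      ≤ 2 * Real.exp (-(n * ε ^ 2 / 2)) := by
    intro n
    refine (measureReal_mono (s₂ := {ω | ∃ t, n ≤ pulls (fun s => arm s ω) b t ∧
      ε ≤ empMean (fun s => arm s ω) (fun s => X s ω) b t - μ b} ∪
      {ω | ∃ t, n ≤ pulls (fun s => arm s ω) b t ∧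
      ε ≤ μ b - empMean (fun s => arm s ω) (fun s => X s ω) b t}) ?_).trans
      ((measureReal_union_le _ _).trans ?_)
    · rintro ω ⟨t, hn, ht⟩
      rcases le_abs.1 ht with ht | ht
      · exact Or.inl ⟨t, hn, ht⟩
      · exact Or.inr ⟨t, hn, by linarith⟩
    · rw [two_mul]
      exact add_le_add (h.measure_exists_le_empMean_sub hμ b n hε.le)
        (h.measure_exists_le_sub_empMean hμ b n hε.le)
  have hr : ‖Real.exp (-(ε ^ 2 / 2))‖ < 1 := by
    rw [Real.norm_of_nonneg (Real.exp_pos _).le]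
    exact Real.exp_lt_one_iff.2 (by have := pow_pos hε 2; linarith)
  have hlim := ((summable_pow_mul_geometric_of_norm_lt_one 1 hr).tendsto_atTop_zero).const_mul 2
  rw [mul_zero] at hlim
  refine squeeze_zero (fun n => by positivity) (fun n => ?_) hlim
  refine (mul_le_mul_of_nonneg_left (hb n) (by positivity)).trans (le_of_eq ?_)
  rw [← Real.exp_nat_mul]
  ring_nf

/-- Exceptional sample sizes are rare: the level `n` is exceptional with probability `o(1 / n)`. -/
lemma tendsto_mul_measure_exceptional [Fintype A] (hμ : ∀ a, μ a ∈ fam.means)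
    (h : IsBanditProcess (fun a => fam.law (μ a)) P ℱ arm X) {ε : ℝ} (hε : 0 < ε)
    (hμε : ∀ a, μ a - ε ∈ fam.means) :
    Tendsto (fun n : ℕ => (n : ℝ) * P.real {ω | Exceptional fam μ ε (fun s => arm s ω)
      (fun s => X s ω) n}) atTop (𝓝 0) := by
  have hU : ∀ b, Tendsto (fun n : ℕ => (n : ℝ) * P.real {ω | Underestimated fam μ ε
      (fun s => arm s ω) (fun s => X s ω) b n}) atTop (𝓝 0) := by
    intro b
    cases fam
    · exact tendsto_mul_measure_underestimated_gaussian h b hε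
    · exact tendsto_mul_measure_underestimated_bernoulli hμ h b hε (hμε b)
  have hlim := tendsto_finsetSum (Finset.univ : Finset A) fun b _ =>
    (hU b).add (tendsto_mul_measure_misestimated hμ h b hε)
  simp only [add_zero, Finset.sum_const_zero] at hlim
  refine squeeze_zero (fun n => by positivity) (fun n => ?_) hlim
  simp_rw [← mul_add, ← Finset.mul_sum]
  refine mul_le_mul_of_nonneg_left ?_ (by positivity)
  have : {ω | Exceptional fam μ ε (fun s => arm s ω) (fun s => X s ω) n}
      = ⋃ b, ({ω | Underestimated fam μ ε (fun s => arm s ω) (fun s => X s ω) b n} ∪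
        {ω | Misestimated μ ε (fun s => arm s ω) (fun s => X s ω) b n}) := by
    ext ω; simp [Exceptional]
  rw [this]
  exact (measureReal_iUnion_fintype_le _).trans
    (Finset.sum_le_sum fun b _ => measureReal_union_le _ _)

end Rates

/-! ### Penalized costs -/

lemma ennrealLog_natCast {n : ℕ} (hn : 1 ≤ n) : ENNReal.log (n : ℝ≥0∞) = (Real.log n : EReal) := by
  have h : (0 : ℝ) < n := by exact_mod_cast hn
  rw [← ENNReal.ofReal_natCast, ENNReal.log_ofReal_of_pos h]

lemma penalizedCost_zero_left (k : ℝ≥0∞) : penalizedCost 0 k = ⊥ := by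
  simp [penalizedCost]

lemma penalizedCost_zero_right (n : ℕ) : penalizedCost n 0 = ENNReal.log (n : ℝ≥0∞) := by
  simp [penalizedCost]

lemma penalizedCost_mono (n : ℕ) {k k' : ℝ≥0∞} (h : k ≤ k') :
    penalizedCost n k ≤ penalizedCost n k' := by
  unfold penalizedCost
  exact add_le_add_left (EReal.coe_ennreal_le_coe_ennreal_iff.2 (by gcongr)) _

lemma ennrealLog_le_penalizedCost (n : ℕ) (k : ℝ≥0∞) :
    ENNReal.log (n : ℝ≥0∞) ≤ penalizedCost n k := by
  rw [← penalizedCost_zero_right]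
  exact penalizedCost_mono n zero_le

lemma penalizedCost_ofReal {n : ℕ} (hn : 1 ≤ n) {r : ℝ} (hr : 0 ≤ r) :
    penalizedCost n (ENNReal.ofReal r) = ((n * r + Real.log n : ℝ) : EReal) := by
  rw [penalizedCost, ennrealLog_natCast hn, ← ENNReal.ofReal_natCast,
    ← ENNReal.ofReal_mul (Nat.cast_nonneg n), EReal.coe_ennreal_ofReal,
    max_eq_left (by positivity), EReal.coe_add]

lemma mul_le_log_of_penalizedCost_le {n m : ℕ} (hn : 1 ≤ n) {r : ℝ} (hr : 0 ≤ r) {k : ℝ≥0∞}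
    (hk : ENNReal.ofReal r ≤ k) (h : penalizedCost n k ≤ ENNReal.log (m : ℝ≥0∞)) :
    n * r ≤ Real.log m := by
  have h1 := (penalizedCost_mono n hk).trans h
  rw [penalizedCost_ofReal hn hr] at h1
  rcases Nat.eq_zero_or_pos m with rfl | hm
  · rw [Nat.cast_zero, ENNReal.log_zero, le_bot_iff] at h1
    exact absurd h1 (EReal.coe_ne_bot _)
  · rw [ennrealLog_natCast hm, EReal.coe_le_coe_iff] at h1
    have : 0 ≤ Real.log n := Real.log_natCast_nonneg n
    linarith

lemma log_le_of_log_le_penalizedCost {n m : ℕ} (hn : 1 ≤ n) {r : ℝ} (hr : 0 ≤ r) {k : ℝ≥0∞}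
    (hk : k ≤ ENNReal.ofReal r) (h : ENNReal.log (n : ℝ≥0∞) ≤ penalizedCost m k) :
    1 ≤ m ∧ Real.log n ≤ m * r + Real.log m := by
  rcases Nat.eq_zero_or_pos m with rfl | hm
  · rw [penalizedCost_zero_left, le_bot_iff, ennrealLog_natCast hn] at h
    exact absurd h (EReal.coe_ne_bot _)
  · refine ⟨hm, ?_⟩
    have h1 := h.trans (penalizedCost_mono m hk)
    rw [penalizedCost_ofReal hm hr, ennrealLog_natCast hn, EReal.coe_le_coe_iff] at h1
    exact h1

lemma ennrealLog_natCast_le_iff {n m : ℕ} :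
    ENNReal.log (n : ℝ≥0∞) ≤ ENNReal.log (m : ℝ≥0∞) ↔ n ≤ m := by
  rw [ENNReal.log_le_log_iff, Nat.cast_le]

lemma ennrealLog_natCast_lt_iff {n m : ℕ} :
    ENNReal.log (n : ℝ≥0∞) < ENNReal.log (m : ℝ≥0∞) ↔ n < m := by
  rw [ENNReal.log_lt_log_iff, Nat.cast_lt]

lemma log_le_mul_add {δ y : ℝ} (hδ : 0 < δ) (hy : 0 ≤ y) : Real.log y ≤ δ * y + |Real.log δ| := by
  rcases hy.eq_or_lt with rfl | hy
  · simp
  · have h := Real.log_le_sub_one_of_pos (mul_pos hδ hy)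
    rw [Real.log_mul hδ.ne' hy.ne'] at h
    linarith [neg_abs_le (Real.log δ)]

/-! ### Unimodal configurations -/

section Unimodal

variable {A : Type*} {fam : RewardFamily} {G : SimpleGraph A} {μ : A → ℝ} {astar : A}

lemma IsUnimodal.exists_adj_lt (hν : IsUnimodal fam G μ astar) {h : A} (hh : h ≠ astar) :
    ∃ b, G.Adj h b ∧ μ h < μ b := by
  obtain ⟨p, hp⟩ := hν.increasing_path h hh
  cases p with
  | nil => exact absurd rfl hh
  | cons hadj q =>
    refine ⟨_, hadj, ?_⟩
    rw [SimpleGraph.Walk.support_cons, ← SimpleGraph.Walk.cons_tail_support q] at hp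
    exact (List.isChain_cons_cons.1 hp).1

/-- In a tree, the means decrease away from the optimal arm: an arm cut off from `astar` together
with the neighbour `g` of `astar` has a smaller mean than `g`, because its increasing path to
`astar` runs through `g`. -/
lemma IsUnimodal.lt_of_mem_cutSubtree (hν : IsUnimodal fam G μ astar) (hG : G.IsTree) {g a : A}
    (hg : G.Adj astar g) (ha : a ∈ cutSubtree G astar g) (hag : a ≠ g) : μ a < μ g := by
  have hbridge : ¬ (G.deleteEdges {s(g, astar)}).Reachable g astar :=
    (SimpleGraph.isBridge_iff.1 (SimpleGraph.isAcyclic_iff_forall_isBridge.1 hG.isAcyclic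
      (hg.symm : s(g, astar) ∈ G.edgeSet)))
  have ha' : (G.deleteEdges {s(g, astar)}).Reachable g a := ha
  have hastar : a ≠ astar := fun h => hbridge (h ▸ ha')
  obtain ⟨p, hp⟩ := hν.increasing_path a hastar
  have hmem : s(g, astar) ∈ p.edges := by
    by_contra hne
    exact hbridge (ha'.trans ⟨p.toDeleteEdge _ hne⟩)
  have hgs : g ∈ p.support := p.fst_mem_support_of_mem_edges hmem
  have hpw : List.Pairwise (fun b b' => μ b < μ b') p.support := by
    have : IsTrans A (fun b b' => μ b < μ b') := ⟨fun _ _ _ h1 h2 => lt_trans h1 h2⟩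
    exact List.isChain_iff_pairwise.1 hp
  rw [← SimpleGraph.Walk.cons_tail_support p, List.pairwise_cons] at hpw
  rw [← SimpleGraph.Walk.cons_tail_support p, List.mem_cons] at hgs
  exact hpw.1 g (hgs.resolve_left hag.symm)

/-- `ε` is an admissible precision: up to errors of a few `ε`, means can be compared, and they stay
in the parameter space. -/
structure IsMargin (fam : RewardFamily) (μ : A → ℝ) (ε : ℝ) : Prop where
  pos : 0 < ε
  gap : ∀ a b, μ a < μ b → μ a + 5 * ε < μ b
  sub_mem : ∀ a, μ a - 2 * ε ∈ fam.means
  add_mem : ∀ a, μ a + 2 * ε ∈ fam.means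

lemma eventually_isMargin [Finite A] (hμ : ∀ a, μ a ∈ fam.means) :
    ∀ᶠ ε in 𝓝[>] (0 : ℝ), IsMargin fam μ ε := by
  have h1 : ∀ᶠ ε in 𝓝 (0 : ℝ), ∀ a b, μ a < μ b → μ a + 5 * ε < μ b := by
    refine eventually_all.2 fun a => eventually_all.2 fun b => ?_
    by_cases hab : μ a < μ b
    · have : Tendsto (fun ε : ℝ => μ a + 5 * ε) (𝓝 0) (𝓝 (μ a + 5 * 0)) :=
        (Continuous.tendsto (by fun_prop) 0)
      filter_upwards [this.eventually_lt_const (by simpa using hab)] with ε hε _ using hε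
    · exact Eventually.of_forall fun ε h => absurd h hab
  have h2 : ∀ᶠ ε in 𝓝 (0 : ℝ), ∀ a, μ a - 2 * ε ∈ fam.means := by
    refine eventually_all.2 fun a => ?_
    have : Tendsto (fun ε : ℝ => μ a - 2 * ε) (𝓝 0) (𝓝 (μ a - 2 * 0)) :=
      (Continuous.tendsto (by fun_prop) 0)
    exact this.eventually_mem (fam.isOpen_means.mem_nhds (by simpa using hμ a))
  have h3 : ∀ᶠ ε in 𝓝 (0 : ℝ), ∀ a, μ a + 2 * ε ∈ fam.means := by
    refine eventually_all.2 fun a => ?_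
    have : Tendsto (fun ε : ℝ => μ a + 2 * ε) (𝓝 0) (𝓝 (μ a + 2 * 0)) :=
      (Continuous.tendsto (by fun_prop) 0)
    exact this.eventually_mem (fam.isOpen_means.mem_nhds (by simpa using hμ a))
  filter_upwards [self_mem_nhdsWithin, nhdsWithin_le_nhds h1, nhdsWithin_le_nhds h2,
    nhdsWithin_le_nhds h3] with ε h0 h1 h2 h3 using ⟨h0, h1, h2, h3⟩

lemma IsMargin.mem_means {ε : ℝ} (hε : IsMargin fam μ ε) (a : A) {x : ℝ} (h1 : μ a - 2 * ε ≤ x)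
    (h2 : x ≤ μ a + 2 * ε) : x ∈ fam.means :=
  fam.ordConnected_means.out (hε.sub_mem a) (hε.add_mem a) ⟨h1, h2⟩

lemma IsMargin.exists_pos_le_klFormula [Fintype A] {ε : ℝ} (hε : IsMargin fam μ ε) :
    ∃ c > 0, ∀ a b, μ a < μ b → c ≤ fam.klFormula (μ a + ε) (μ b - 2 * ε) := by
  have hpos : ∀ a b, μ a < μ b → 0 < fam.klFormula (μ a + ε) (μ b - 2 * ε) := fun a b hab =>
    klFormula_pos (hε.mem_means a (by linarith [hε.pos]) (by linarith [hε.pos])) (hε.sub_mem b)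
      (by linarith [hε.gap a b hab, hε.pos])
  classical
  rcases isEmpty_or_nonempty A with hA | hA
  · exact ⟨1, one_pos, fun a => hA.elim a⟩
  obtain ⟨p, -, hp⟩ := Finset.exists_min_image (Finset.univ : Finset (A × A))
    (fun p => if μ p.1 < μ p.2 then fam.klFormula (μ p.1 + ε) (μ p.2 - 2 * ε) else 1)
    Finset.univ_nonempty
  refine ⟨if μ p.1 < μ p.2 then fam.klFormula (μ p.1 + ε) (μ p.2 - 2 * ε) else 1, ?_,
    fun a b hab => ?_⟩
  · split_ifs with h
    · exact hpos _ _ h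
    · exact one_pos
  · have := hp (a, b) (Finset.mem_univ _)
    dsimp only at this
    rw [if_pos hab] at this
    exact this

end Unimodal

/-! ### Trajectories outside the exceptional sample sizes -/

section Trajectory

variable {A : Type*} [Fintype A] {fam : RewardFamily} {G : SimpleGraph A} {μ : A → ℝ} {astar : A}
  {ε : ℝ} {arm : ℕ → A} {X : ℕ → ℝ}

/-- The limiting number of pulls of arm `a` per unit of `log T`, with precision `ε`. -/
noncomputable def explorationRate (fam : RewardFamily) (G : SimpleGraph A) (μ : A → ℝ) (astar : A)
    (ε : ℝ) (a : A) : ℝ :=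
  open scoped Classical in
  if G.Adj astar a then (fam.klFormula (μ a + ε) (μ astar - ε))⁻¹ else 0

open scoped Classical in
/-- The total number of pulls of suboptimal arms. -/
noncomputable def suboptimalPulls (astar : A) (arm : ℕ → A) (t : ℕ) : ℕ :=
  ∑ b with b ≠ astar, pulls arm b t

lemma pulls_le_suboptimalPulls {b : A} (hb : b ≠ astar) (t : ℕ) :
    pulls arm b t ≤ suboptimalPulls astar arm t := by
  classical
  exact Finset.single_le_sum (f := fun b => pulls arm b t) (fun _ _ => Nat.zero_le _) (by simp [hb])

omit [Fintype A] in
lemma abs_sub_lt_of_not_exceptional {n : ℕ} (hn : ¬ Exceptional fam μ ε arm X n) {b : A} {t : ℕ}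
    (hb : n ≤ pulls arm b t) : |empMean arm X b t - μ b| < ε := by
  by_contra! h
  exact hn ⟨b, Or.inr ⟨t, hb, h⟩⟩

lemma bestEmpMean_eq {h : A} {t : ℕ} (hh : h ∈ bestArms arm X t) :
    bestEmpMean arm X t = empMean arm X h t := by
  have : Nonempty A := ⟨h⟩
  exact le_antisymm (ciSup_le hh)
    (le_ciSup (f := fun a => empMean arm X a t) (Set.finite_range _).bddAbove h)

lemma imedIndex_eq_log {h : A} {t : ℕ} (hh : h ∈ bestArms arm X t) :
    imedIndex fam arm X t h = ENNReal.log (pulls arm h t : ℝ≥0∞) := by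
  rw [imedIndex, bestEmpMean_eq hh, KL_self, penalizedCost_zero_right]

omit [Fintype A] in
lemma exceptional_of_log_le (hext : ∀ b t, empMean arm X b t ∈ fam.extendedMeans)
    (hε : IsMargin fam μ ε) {b : A} {t n : ℕ} (hn : 1 ≤ n) {u : ℝ} (hu : empMean arm X b t ≤ u)
    (hub : u ≤ μ b - ε) (hlog : ENNReal.log (n : ℝ≥0∞)
      ≤ penalizedCost (pulls arm b t) (fam.KL (empMean arm X b t) u)) :
    Exceptional fam μ ε arm X n := by
  have hm : μ b - ε ∈ fam.means :=
    hε.mem_means b (by linarith [hε.pos]) (by linarith [hε.pos])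
  have hKL := KL_mono (hext b t) (fam.means_subset_extendedMeans hm) le_rfl hu hub
  rw [KL_eq_ofReal (hext b t) hm] at hKL
  obtain ⟨h1, h2⟩ := log_le_of_log_le_penalizedCost hn (klFormula_nonneg (hext b t) hm) hKL hlog
  exact ⟨b, Or.inl ⟨t, h1, hu.trans hub, h2⟩⟩

/-- If a suboptimal arm `h` is the current best arm, a better neighbour of `h` is underestimated;
if the indices around `h` are at least `log n`, this makes the level `n` exceptional. -/
lemma exceptional_of_leader_ne (hν : IsUnimodal fam G μ astar)
    (hext : ∀ b t, empMean arm X b t ∈ fam.extendedMeans) (hε : IsMargin fam μ ε) {h : A} {t n : ℕ}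
    (hh : h ∈ bestArms arm X t) (hne : h ≠ astar) (hn : 1 ≤ n) (hnh : n ≤ pulls arm h t)
    (hidx : ∀ b ∈ closedNbhd G h, ENNReal.log (n : ℝ≥0∞) ≤ imedIndex fam arm X t b) :
    Exceptional fam μ ε arm X n := by
  by_contra hexc
  have hest := abs_lt.1 (abs_sub_lt_of_not_exceptional hexc hnh)
  obtain ⟨b, hadj, hb⟩ := hν.exists_adj_lt hne
  have hgap := hε.gap h b hb
  refine hexc (exceptional_of_log_le (b := b) (t := t) hext hε hn (u := empMean arm X h t) (hh b)
    (by linarith [hε.pos]) ?_)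
  rw [← bestEmpMean_eq hh]
  exact hidx b (Or.inr hadj)

omit [Fintype A] in
/-- If arm `a` and a better arm `b` are well estimated, the divergence between the empirical mean of
`a` and any value above that of `b` is large. -/
lemma ofReal_klFormula_le_KL
    (hε : IsMargin fam μ ε) {a b : A} (hab : μ a < μ b) {x u v : ℝ}
    (hx : x ∈ fam.extendedMeans) (hxa : x ≤ μ a + ε) (hv : μ b - 2 * ε ≤ v) (hvb : v ≤ μ b)
    (hvu : v ≤ u) (hu : u ∈ fam.extendedMeans) :
    ENNReal.ofReal (fam.klFormula (μ a + ε) v) ≤ fam.KL x u := by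
  have hgap := hε.gap a b hab
  have hpos := hε.pos
  have hm : v ∈ fam.means := hε.mem_means b hv (by linarith)
  have hy : μ a + ε ∈ fam.means := hε.mem_means a (by linarith) (by linarith)
  rw [← KL_eq_ofReal (fam.means_subset_extendedMeans hy) hm]
  exact KL_mono hx hu hxa (by linarith) hvu

omit [Fintype A] in
lemma IsMargin.klFormula_pos (hε : IsMargin fam μ ε) {a b : A} (hab : μ a < μ b) :
    0 < fam.klFormula (μ a + ε) (μ b - ε) :=
  RewardFamily.klFormula_pos (hε.mem_means a (by linarith [hε.pos]) (by linarith [hε.pos]))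
    (hε.mem_means b (by linarith [hε.pos]) (by linarith [hε.pos]))
    (by linarith [hε.gap a b hab, hε.pos])

omit [Fintype A] in
lemma IsMargin.klFormula_nonneg (hε : IsMargin fam μ ε) {a b : A} {v : ℝ}
    (hv : μ b - 2 * ε ≤ v) (hvb : v ≤ μ b) : 0 ≤ fam.klFormula (μ a + ε) v :=
  RewardFamily.klFormula_nonneg (fam.means_subset_extendedMeans
    (hε.mem_means a (by linarith [hε.pos]) (by linarith [hε.pos])))
    (hε.mem_means b hv (by linarith [hε.pos]))

omit [Fintype A] in
lemma le_explorationRate_mul {a : A} (hadj : G.Adj astar a) (hε : IsMargin fam μ ε)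
    (hlt : μ a < μ astar) {n T : ℕ}
    (h : n * fam.klFormula (μ a + ε) (μ astar - ε) ≤ Real.log T) :
    (n : ℝ) ≤ explorationRate fam G μ astar ε a * Real.log T := by
  rw [explorationRate, if_pos hadj, inv_mul_eq_div, le_div_iff₀ (hε.klFormula_pos hlt)]
  exact h

omit [Fintype A] in
lemma explorationRate_nonneg (hν : IsUnimodal fam G μ astar) (hε : IsMargin fam μ ε) (a : A) :
    0 ≤ explorationRate fam G μ astar ε a := by
  rw [explorationRate]
  split_ifs with h
  · exact inv_nonneg.2 (hε.klFormula_pos (hν.lt_optimal a h.ne')).le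
  · exact le_rfl

/-- While the optimal arm leads, the IMED index limits the exploration of its neighbours. -/
lemma mul_klFormula_le_log_of_imedIndex_le (hν : IsUnimodal fam G μ astar)
    (hext : ∀ b t, empMean arm X b t ∈ fam.extendedMeans) (hε : IsMargin fam μ ε) {a : A} {t : ℕ}
    (hbest : astar ∈ bestArms arm X t) (ha : a ≠ astar) (hn : 1 ≤ pulls arm a t)
    (hle : pulls arm a t ≤ pulls arm astar t)
    (hexc : ¬ Exceptional fam μ ε arm X (pulls arm a t))
    (hidx : imedIndex fam arm X t a ≤ ENNReal.log (pulls arm astar t : ℝ≥0∞)) :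
    pulls arm a t * fam.klFormula (μ a + ε) (μ astar - ε) ≤ Real.log (pulls arm astar t) := by
  have hlt := hν.lt_optimal a ha
  have ha' := abs_lt.1 (abs_sub_lt_of_not_exceptional hexc le_rfl)
  have hs' := abs_lt.1 (abs_sub_lt_of_not_exceptional hexc hle)
  refine mul_le_log_of_penalizedCost_le hn (hε.klFormula_pos hlt).le ?_ hidx
  rw [bestEmpMean_eq hbest]
  exact ofReal_klFormula_le_KL hε hlt (hext a t) (by linarith) (by linarith [hε.pos])
    (by linarith [hε.pos]) (by linarith) (hext astar t)

omit [Fintype A] in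
lemma log_pulls_le (b : A) {t T : ℕ} (htT : t ≤ T) : Real.log (pulls arm b t) ≤ Real.log T := by
  rcases Nat.eq_zero_or_pos (pulls arm b t) with h | h
  · simp [h, Real.log_natCast_nonneg]
  · exact Real.log_le_log (by exact_mod_cast h) (by exact_mod_cast (pulls_le arm b t).trans htT)

/-! ### IMED-UB -/

lemma ImedUBStep.pulls_le (hν : IsUnimodal fam G μ astar)
    (hext : ∀ b t, empMean arm X b t ∈ fam.extendedMeans) (hε : IsMargin fam μ ε) {t T : ℕ}
    (hstep : ImedUBStep fam G arm X t) {a : A} (harm : arm (t + 1) = a) (ha : a ≠ astar)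
    (htT : t ≤ T) (hn : 1 ≤ pulls arm a t) (hexc : ¬ Exceptional fam μ ε arm X (pulls arm a t)) :
    (pulls arm a t : ℝ) ≤ explorationRate fam G μ astar ε a * Real.log T := by
  obtain ⟨h, hh, hmem, hmin⟩ := hstep
  rw [harm] at hmem hmin
  have hself : h ∈ closedNbhd G h := Or.inl rfl
  have hidx_le : imedIndex fam arm X t a ≤ ENNReal.log (pulls arm h t : ℝ≥0∞) := by
    rw [← imedIndex_eq_log (fam := fam) hh.1]
    exact hmin hself
  have hlog : ENNReal.log (pulls arm a t : ℝ≥0∞) ≤ imedIndex fam arm X t a :=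
    ennrealLog_le_penalizedCost _ _
  have hle : pulls arm a t ≤ pulls arm h t := ennrealLog_natCast_le_iff.1 (hlog.trans hidx_le)
  obtain rfl : h = astar := by
    by_contra hne
    exact hexc (exceptional_of_leader_ne hν hext hε hh.1 hne hn hle
      fun b hb => hlog.trans (hmin hb))
  have hadj : G.Adj h a := hmem.resolve_left ha
  exact le_explorationRate_mul hadj hε (hν.lt_optimal a ha)
    ((mul_klFormula_le_log_of_imedIndex_le hν hext hε hh.1 ha hn hle hexc hidx_le).trans
      (log_pulls_le h htT))

/-! ### d-IMED-UB -/

/-- Under d-IMED-UB an arm beyond the neighbours of `astar` is compared with a neighbour that has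
itself been pulled `O(log T)` times, hence is pulled `O(log log T)` times. -/
lemma exists_pulls_le_of_dImedUBStep (hν : IsUnimodal fam G μ astar) (hG : G.IsTree)
    (hε : IsMargin fam μ ε) {η : ℝ} (hη : 0 < η) :
    ∃ C ≥ 0, ∀ (arm : ℕ → A) (X : ℕ → ℝ), (∀ b t, empMean arm X b t ∈ fam.extendedMeans) →
      ∀ t T : ℕ, DImedUBStep fam G arm X t → ∀ a, arm (t + 1) = a → a ≠ astar → t ≤ T →
      1 ≤ pulls arm a t → ¬ Exceptional fam μ ε arm X (pulls arm a t) →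
      (pulls arm a t : ℝ) ≤ explorationRate fam G μ astar ε a * Real.log T + η * Real.log T + C := by
  obtain ⟨c, hc, hcle⟩ := hε.exists_pos_le_klFormula
  set δ := η * c ^ 2 with hδ
  have hδpos : 0 < δ := by positivity
  refine ⟨|Real.log δ| / c, by positivity, ?_⟩
  intro arm X hext t T hstep a harm ha htT hn hexc
  obtain ⟨h, hh, g, hg, hgmin, hcase⟩ := hstep
  have hlogT : 0 ≤ Real.log T := Real.log_natCast_nonneg T
  have hself : h ∈ closedNbhd G h := Or.inl rfl
  have hgidx : imedIndex fam arm X t g ≤ ENNReal.log (pulls arm h t : ℝ≥0∞) := by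
    rw [← imedIndex_eq_log (fam := fam) hh.1]
    exact hgmin hself
  have hglog : ENNReal.log (pulls arm g t : ℝ≥0∞) ≤ imedIndex fam arm X t g :=
    ennrealLog_le_penalizedCost _ _
  have hgh : pulls arm g t ≤ pulls arm h t := ennrealLog_natCast_le_iff.1 (hglog.trans hgidx)
  have hlead : ∀ n : ℕ, 1 ≤ n → n ≤ pulls arm g t → ¬ Exceptional fam μ ε arm X n → h = astar := by
    intro n hn1 hng hnexc
    by_contra hne
    exact hnexc (exceptional_of_leader_ne hν hext hε hh.1 hne hn1 (hng.trans hgh) fun b hb =>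
      (ennrealLog_natCast_le_iff.2 hng).trans (hglog.trans (hgmin hb)))
  rcases hcase with ⟨hgh', harm'⟩ | ⟨hgh', S, hgS, hSsub, haS, hSmin⟩
  · obtain rfl : a = g := harm.symm.trans harm'
    exact absurd (hgh'.trans (hlead _ hn le_rfl hexc)) ha
  rw [harm] at haS hSmin
  have hag : imedIndex₂ fam arm X t g a ≤ ENNReal.log (pulls arm g t : ℝ≥0∞) := by
    refine (hSmin hgS).trans (le_of_eq ?_)
    rw [imedIndex₂, KLplus, if_neg (lt_irrefl _), penalizedCost_zero_right]
  have hag' : pulls arm a t ≤ pulls arm g t :=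
    ennrealLog_natCast_le_iff.1 ((ennrealLog_le_penalizedCost _ _).trans hag)
  obtain rfl : h = astar := hlead _ hn hag' hexc
  have hadj : G.Adj h g := hg.resolve_left hgh'
  have hnn : 0 ≤ explorationRate fam G μ h ε a * Real.log T :=
    mul_nonneg (explorationRate_nonneg hν hε a) hlogT
  have hlt_g := hν.lt_optimal g hgh'
  -- A neighbour of the optimal arm, well estimated, has been pulled `O(log T)` times.
  have hgT : pulls arm g t * fam.klFormula (μ g + ε) (μ h - ε) ≤ Real.log T := by
    refine (mul_le_log_of_penalizedCost_le (hn.trans hag') (hε.klFormula_pos hlt_g).le ?_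
      hgidx).trans (log_pulls_le h htT)
    have hg' := abs_lt.1 (abs_sub_lt_of_not_exceptional hexc hag')
    have hs' := abs_lt.1 (abs_sub_lt_of_not_exceptional hexc (hag'.trans hgh))
    rw [bestEmpMean_eq hh.1]
    exact ofReal_klFormula_le_KL hε hlt_g (hext g t) (by linarith) (by linarith [hε.pos])
      (by linarith [hε.pos]) (by linarith) (hext h t)
  rcases eq_or_ne a g with rfl | hne
  · have := le_explorationRate_mul hadj hε hlt_g hgT
    have h2 : 0 ≤ η * Real.log T := by positivity
    have h3 : 0 ≤ |Real.log δ| / c := by positivity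
    linarith
  have hlt : μ a < μ g := hν.lt_of_mem_cutSubtree hG hadj (hSsub haS) hne
  have ha' := abs_lt.1 (abs_sub_lt_of_not_exceptional hexc le_rfl)
  have hg' := abs_lt.1 (abs_sub_lt_of_not_exceptional hexc hag')
  have hgap := hε.gap a g hlt
  have hna : pulls arm a t * fam.klFormula (μ a + ε) (μ g - 2 * ε)
      ≤ Real.log (pulls arm g t) := by
    refine mul_le_log_of_penalizedCost_le hn
      (hε.klFormula_nonneg le_rfl (by linarith [hε.pos])) ?_ hag
    rw [KLplus, if_pos (by linarith [hε.pos])]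
    exact ofReal_klFormula_le_KL hε hlt (hext a t) (by linarith) le_rfl (by linarith [hε.pos])
      (by linarith [hε.pos]) (hext g t)
  have hgc : (pulls arm g t : ℝ) * c ≤ Real.log T := by
    refine (mul_le_mul_of_nonneg_left ((hcle g h hlt_g).trans ?_) (Nat.cast_nonneg _)).trans hgT
    have h1 := hε.mem_means h (x := μ h - 2 * ε) le_rfl (by linarith [hε.pos])
    have h2 := hε.mem_means h (x := μ h - ε) (by linarith [hε.pos]) (by linarith [hε.pos])
    have h3 := klFormula_add_le (x := μ g + ε) h1 h2
      (by linarith [hε.gap g h hlt_g, hε.pos]) (by linarith [hε.pos])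
    linarith [RewardFamily.klFormula_nonneg (fam.means_subset_extendedMeans h1) h2]
  have hnc : (pulls arm a t : ℝ) * c ≤ δ * pulls arm g t + |Real.log δ| :=
    (mul_le_mul_of_nonneg_left (hcle a g hlt) (Nat.cast_nonneg _)).trans
      (hna.trans (log_le_mul_add hδpos (Nat.cast_nonneg _)))
  have hfin : (pulls arm a t : ℝ) ≤ (η * Real.log T) + |Real.log δ| / c := by
    rw [← mul_le_mul_iff_left₀ hc, add_mul, div_mul_cancel₀ _ hc.ne']
    have hδg : δ * pulls arm g t ≤ η * Real.log T * c := by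
      rw [hδ]
      nlinarith [mul_le_mul_of_nonneg_left hgc (mul_pos hη hc).le]
    linarith
  linarith

/-! ### KLUCB-UB: regular rounds -/

omit [Fintype A] in
lemma empMean_le_ucbIndex (hext : ∀ b t, empMean arm X b t ∈ fam.extendedMeans) (h : A) (t : ℕ) :
    (empMean arm X h t : EReal) ≤ ucbIndex fam arm X t h h := by
  rw [ucbIndex, if_neg (lt_irrefl _)]
  refine le_sSup (Set.mem_image_of_mem (fun u : ℝ => (u : EReal)) (x := empMean arm X h t) ?_)
  refine ⟨hext h t, le_rfl, ?_⟩
  rw [KL_self, penalizedCost_zero_right]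

omit [Fintype A] in
lemma log_le_penalizedCost_of_ucbIndex_lt {h b : A} {t : ℕ} {v : ℝ} (hv : v ∈ fam.extendedMeans)
    (hbv : empMean arm X b t ≤ v) (hlt : ucbIndex fam arm X t h b < (v : EReal)) :
    ENNReal.log (pulls arm h t : ℝ≥0∞)
      ≤ penalizedCost (pulls arm b t) (fam.KL (empMean arm X b t) v) := by
  rw [ucbIndex] at hlt
  split_ifs at hlt with hc
  · exact hc.le.trans (ennrealLog_le_penalizedCost _ _)
  · by_contra! hcost
    refine absurd (le_sSup (Set.mem_image_of_mem (fun u : ℝ => (u : EReal)) (x := v) ?_))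
      (not_le.2 hlt)
    exact ⟨hv, hbv, hcost.le⟩

omit [Fintype A] in
lemma exists_penalizedCost_le_of_lt_ucbIndex {h a : A} {t : ℕ} {v : ℝ}
    (hle : pulls arm a t ≤ pulls arm h t) (hlt : (v : EReal) < ucbIndex fam arm X t h a) :
    ∃ u ∈ fam.extendedMeans, v < u ∧ penalizedCost (pulls arm a t)
      (fam.KL (empMean arm X a t) u) ≤ ENNReal.log (pulls arm h t : ℝ≥0∞) := by
  rw [ucbIndex, if_neg (by rw [ennrealLog_natCast_lt_iff]; omega), lt_sSup_iff] at hlt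
  obtain ⟨_, ⟨u, ⟨hu, -, hcost⟩, rfl⟩, hvu⟩ := hlt
  exact ⟨u, hu, EReal.coe_lt_coe_iff.1 hvu, hcost⟩

omit [Fintype A] in
/-- The upper confidence bounds around a suboptimal current best arm `h` that is well estimated are
large, unless a better neighbour of `h` is underestimated. -/
lemma exists_lt_ucbIndex_of_leader_ne (hν : IsUnimodal fam G μ astar)
    (hext : ∀ b t, empMean arm X b t ∈ fam.extendedMeans) (hε : IsMargin fam μ ε) {h : A} {t n : ℕ}
    (hh : h ∈ bestArms arm X t) (hne : h ≠ astar) (hn : 1 ≤ n) (hnh : n ≤ pulls arm h t)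
    (hexc : ¬ Exceptional fam μ ε arm X n) :
    ∃ b ∈ closedNbhd G h, μ h < μ b ∧ ((μ b - ε : ℝ) : EReal) ≤ ucbIndex fam arm X t h b := by
  have hest := abs_lt.1 (abs_sub_lt_of_not_exceptional hexc hnh)
  obtain ⟨b, hadj, hb⟩ := hν.exists_adj_lt hne
  have hgap := hε.gap h b hb
  have hbv : empMean arm X b t ≤ μ b - ε := (hh b).trans (by linarith [hε.pos])
  refine ⟨b, Or.inr hadj, hb, ?_⟩
  by_contra! hlt
  refine hexc (exceptional_of_log_le (b := b) (t := t) hext hε hn hbv le_rfl ?_)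
  exact (ennrealLog_natCast_le_iff.2 hnh).trans (log_le_penalizedCost_of_ucbIndex_lt
    (fam.means_subset_extendedMeans
      (hε.mem_means b (by linarith [hε.pos]) (by linarith [hε.pos]))) hbv hlt)

omit [Fintype A] in
/-- KLUCB-UB pulls either an arm that has not been pulled more often than the current best arm, or
an arm that ties with it. -/
lemma KlucbUBStep.exists_leader (hext : ∀ b t, empMean arm X b t ∈ fam.extendedMeans) {t : ℕ}
    (hstep : KlucbUBStep fam G arm X t) {a : A} (harm : arm (t + 1) = a) :
    ∃ h ∈ leaders arm X t, a ∈ closedNbhd G h ∧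
      IsMaxOn (ucbIndex fam arm X t h) (closedNbhd G h) a ∧
      (pulls arm a t ≤ pulls arm h t ∨ (pulls arm h t < pulls arm a t ∧
        a ∈ bestArms arm X t ∧ ucbIndex fam arm X t h a = empMean arm X a t)) := by
  obtain ⟨h, hh, hmem, hmax⟩ := hstep
  rw [harm] at hmem hmax
  refine ⟨h, hh, hmem, hmax, ?_⟩
  rcases le_or_gt (pulls arm a t) (pulls arm h t) with hle | hlt
  · exact Or.inl hle
  · have hU : ucbIndex fam arm X t h a = empMean arm X a t := by
      rw [ucbIndex, if_pos (ennrealLog_natCast_lt_iff.2 hlt)]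
    refine Or.inr ⟨hlt, fun b => ?_, hU⟩
    have h1 : ucbIndex fam arm X t h h ≤ ucbIndex fam arm X t h a := hmax (Or.inl rfl)
    rw [hU] at h1
    exact (hh.1 b).trans (EReal.coe_le_coe_iff.1 ((empMean_le_ucbIndex hext h t).trans h1))

/-- In a regular round of KLUCB-UB, either the optimal arm leads and the exploration is limited by
`log T`, or a suboptimal arm leads and the exploration is limited by the logarithm of its own number
of pulls. -/
lemma exists_pulls_le_of_klucbUBStep (hν : IsUnimodal fam G μ astar) (hε : IsMargin fam μ ε) {η : ℝ}
    (hη : 0 < η) :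
    ∃ C ≥ 0, ∀ (arm : ℕ → A) (X : ℕ → ℝ), (∀ b t, empMean arm X b t ∈ fam.extendedMeans) →
      ∀ t T : ℕ, ∀ a h, a ≠ astar → t ≤ T → h ∈ leaders arm X t → a ∈ closedNbhd G h →
      IsMaxOn (ucbIndex fam arm X t h) (closedNbhd G h) a → pulls arm a t ≤ pulls arm h t →
      1 ≤ pulls arm a t → ¬ Exceptional fam μ ε arm X (pulls arm a t) →
      (h = astar ∧ (pulls arm a t : ℝ) ≤ explorationRate fam G μ astar ε a * Real.log T) ∨
      (pulls arm a t : ℝ) ≤ η * suboptimalPulls astar arm T + C := by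
  obtain ⟨c, hc, hcle⟩ := hε.exists_pos_le_klFormula
  set δ := η * c with hδ
  have hδpos : 0 < δ := by positivity
  refine ⟨|Real.log δ| / c, by positivity, ?_⟩
  intro arm X hext t T a h ha htT hh hmem hmax hle hn hexc
  have hpos := hε.pos
  rcases eq_or_ne h astar with rfl | hne
  · refine Or.inl ⟨rfl, ?_⟩
    have hadj : G.Adj h a := hmem.resolve_left ha
    have hlt := hν.lt_optimal a ha
    have ha' := abs_lt.1 (abs_sub_lt_of_not_exceptional hexc le_rfl)
    have hs' := abs_lt.1 (abs_sub_lt_of_not_exceptional hexc hle)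
    have hU : ((μ h - ε : ℝ) : EReal) < ucbIndex fam arm X t h a :=
      lt_of_lt_of_le (EReal.coe_lt_coe_iff.2 (by linarith))
        ((empMean_le_ucbIndex hext h t).trans (hmax (Or.inl rfl)))
    obtain ⟨u, hu, hvu, hcost⟩ := exists_penalizedCost_le_of_lt_ucbIndex hle hU
    refine le_explorationRate_mul hadj hε hlt
      ((mul_le_log_of_penalizedCost_le hn (hε.klFormula_pos hlt).le ?_ hcost).trans
        (log_pulls_le h htT))
    exact ofReal_klFormula_le_KL hε hlt (hext a t) (by linarith) (by linarith) (by linarith)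
      hvu.le hu
  · right
    obtain ⟨b, hb, hlt, hU⟩ := exists_lt_ucbIndex_of_leader_ne hν hext hε hh.1 hne hn hle hexc
    have hU' : ((μ b - 2 * ε : ℝ) : EReal) < ucbIndex fam arm X t h a :=
      lt_of_lt_of_le (EReal.coe_lt_coe_iff.2 (by linarith)) (hU.trans (hmax hb))
    obtain ⟨u, hu, hvu, hcost⟩ := exists_penalizedCost_le_of_lt_ucbIndex hle hU'
    have hs' := abs_lt.1 (abs_sub_lt_of_not_exceptional hexc hle)
    have hlog := mul_le_log_of_penalizedCost_le hn
      (hε.klFormula_nonneg le_rfl (by linarith [hε.pos]))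
      (ofReal_klFormula_le_KL hε hlt (hext a t) ((hh.1 a).trans (by linarith)) le_rfl
        (by linarith) hvu.le hu) hcost
    have hM : (pulls arm h t : ℝ) ≤ suboptimalPulls astar arm T := by
      exact_mod_cast (pulls_mono arm h htT).trans (pulls_le_suboptimalPulls hne T)
    have h1 : (pulls arm a t : ℝ) * c ≤ δ * pulls arm h t + |Real.log δ| :=
      (mul_le_mul_of_nonneg_left (hcle h b hlt) (Nat.cast_nonneg _)).trans
        (hlog.trans (log_le_mul_add hδpos (Nat.cast_nonneg _)))
    rw [← mul_le_mul_iff_left₀ hc, add_mul, div_mul_cancel₀ _ hc.ne']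
    have hδM : δ * pulls arm h t ≤ η * suboptimalPulls astar arm T * c := by
      rw [hδ]
      nlinarith [mul_le_mul_of_nonneg_left hM hδpos.le]
    linarith

end Trajectory

/-! ### KLUCB-UB: rounds in which the pulled arm ties with the current best arm -/

section Ties

variable {A : Type*} [Fintype A] {fam : RewardFamily} {G : SimpleGraph A} {μ : A → ℝ} {astar : A}
  {ε : ℝ} {arm : ℕ → A} {X : ℕ → ℝ}

open scoped Classical in
/-- The number of exceptional levels in `[1, T]`. -/
noncomputable def exceptionalCount (fam : RewardFamily) (μ : A → ℝ) (ε : ℝ) (arm : ℕ → A)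
    (X : ℕ → ℝ) (T : ℕ) : ℕ :=
  ((Finset.Icc 1 T).filter fun n => Exceptional fam μ ε arm X n).card

/-- In round `t + 1` arm `a` is pulled; it has the best empirical mean, which is not much below
`μ a`, but it has been pulled more often than another arm with the same empirical mean. -/
def IsTie (μ : A → ℝ) (ε : ℝ) (arm : ℕ → A) (X : ℕ → ℝ) (a : A) (t : ℕ) : Prop :=
  arm (t + 1) = a ∧ a ∈ bestArms arm X t ∧ a ∉ leaders arm X t ∧ μ a - ε < empMean arm X a t

omit [Fintype A] in
lemma pulls_succ_of_eq {a : A} {t : ℕ} (h : arm (t + 1) = a) :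
    pulls arm a (t + 1) = pulls arm a t + 1 := by
  simp [pulls_succ, h]

omit [Fintype A] in
lemma pulls_lt_pulls {a : A} {s t : ℕ} (h : arm (s + 1) = a) (hst : s < t) :
    pulls arm a s < pulls arm a t := by
  have h1 := pulls_mono arm a (Nat.succ_le_of_lt hst)
  have h2 := pulls_succ_of_eq h
  simp only [Nat.succ_eq_add_one] at h1
  omega

omit [Fintype A] in
/-- The number of pulls of `a` at the times at which `a` is pulled next identifies these times. -/
lemma pulls_injOn (a : A) : Set.InjOn (pulls arm a) {t | arm (t + 1) = a} := by
  intro s hs t ht hst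
  rcases lt_trichotomy s t with h | h | h
  · exact absurd hst (pulls_lt_pulls hs h).ne
  · exact h
  · exact absurd hst (pulls_lt_pulls ht h).ne'

omit [Fintype A] in
lemma empMean_eq_of_pulls_eq {b : A} {s t : ℕ} (hst : s ≤ t) (h : pulls arm b s = pulls arm b t) :
    empMean arm X b s = empMean arm X b t := by
  classical
  have : (Finset.Icc 1 s).filter (fun r => arm r = b) = (Finset.Icc 1 t).filter fun r => arm r = b :=
    Finset.eq_of_subset_of_card_le (Finset.filter_subset_filter _ (Finset.Icc_subset_Icc_right hst))
      (by simpa [pulls] using h.ge)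
  rw [empMean_eq_div, empMean_eq_div, h, rewardSum, rewardSum, this]

omit [Fintype A] in
lemma empMean_succ_lt {a : A} {t : ℕ} (harm : arm (t + 1) = a) (hn : 1 ≤ pulls arm a t)
    (hX : X (t + 1) < empMean arm X a t) : empMean arm X a (t + 1) < empMean arm X a t := by
  have hn' : (0 : ℝ) < pulls arm a t := by exact_mod_cast hn
  rw [empMean_eq_div, pulls_succ_of_eq harm, rewardSum_succ, if_pos harm,
    rewardSum_eq_pulls_mul_empMean, div_lt_iff₀ (by positivity)]
  push_cast
  linarith

omit [Fintype A] in
lemma exists_next_pull {a : A} {t o : ℕ} (hto : t < o) (ho : arm (o + 1) = a) :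
    ∃ r, t < r ∧ r ≤ o ∧ arm (r + 1) = a ∧ pulls arm a r = pulls arm a (t + 1) := by
  induction o using Nat.strong_induction_on with
  | _ o ih =>
    by_cases hex : ∃ s, t < s ∧ s < o ∧ arm (s + 1) = a
    · obtain ⟨s, h1, h2, h3⟩ := hex
      obtain ⟨r, h4, h5, h6⟩ := ih s h2 h1 h3
      exact ⟨r, h4, by omega, h6⟩
    · push Not at hex
      refine ⟨o, hto, le_rfl, ho, ?_⟩
      have key : ∀ d, t + 1 + d ≤ o → pulls arm a (t + 1 + d) = pulls arm a (t + 1) := by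
        intro d
        induction d with
        | zero => intro _; rfl
        | succ d ihd =>
          intro hd
          rw [← add_assoc, pulls_succ, if_neg (hex (t + 1 + d) (by omega) (by omega)),
            ihd (by omega), add_zero]
      have := key (o - (t + 1)) (by omega)
      rwa [show t + 1 + (o - (t + 1)) = o by omega] at this

omit [Fintype A] in
/-- A suboptimal arm that is well estimated can have the best empirical mean only if the optimal arm
has been pulled less often, and its number of pulls is zero or an exceptional level. -/
lemma optimal_of_tie (hν : IsUnimodal fam G μ astar) (hε : IsMargin fam μ ε) {a : A} {t : ℕ}
    (ha : a ≠ astar) (hbest : a ∈ bestArms arm X t)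
    (hexc : ¬ Exceptional fam μ ε arm X (pulls arm a t)) :
    pulls arm astar t < pulls arm a t ∧
      (pulls arm astar t = 0 ∨ Exceptional fam μ ε arm X (pulls arm astar t)) := by
  have ha' := abs_lt.1 (abs_sub_lt_of_not_exceptional hexc le_rfl)
  have hgap := hε.gap a astar (hν.lt_optimal a ha)
  have hpos := hε.pos
  have hb := hbest astar
  constructor
  · by_contra! hle
    have hs' := abs_lt.1 (abs_sub_lt_of_not_exceptional hexc hle)
    linarith
  · by_contra! hc
    have hs' := abs_lt.1 (abs_sub_lt_of_not_exceptional hc.2 le_rfl)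
    linarith

omit [Fintype A] in
/-- At a tie, the number of pulls of the current best arm is zero or an exceptional level. -/
lemma leader_of_tie (hν : IsUnimodal fam G μ astar)
    (hext : ∀ b t, empMean arm X b t ∈ fam.extendedMeans) (hε : IsMargin fam μ ε) {a h : A} {t : ℕ}
    (ha : a ≠ astar) (hh : h ∈ bestArms arm X t) (hbest : a ∈ bestArms arm X t)
    (hmax : IsMaxOn (ucbIndex fam arm X t h) (closedNbhd G h) a)
    (hU : ucbIndex fam arm X t h a = empMean arm X a t)
    (hexc : ¬ Exceptional fam μ ε arm X (pulls arm a t)) :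
    pulls arm h t = 0 ∨ Exceptional fam μ ε arm X (pulls arm h t) := by
  by_contra! hc
  obtain ⟨h0, hexc'⟩ := hc
  rcases eq_or_ne h astar with rfl | hne
  · rcases (optimal_of_tie hν hε ha hbest hexc).2 with h1 | h1
    · exact h0 h1
    · exact hexc' h1
  · obtain ⟨b, hb, hlt, hUb⟩ := exists_lt_ucbIndex_of_leader_ne hν hext hε hh hne
      (Nat.one_le_iff_ne_zero.2 h0) le_rfl hexc'
    have hest := abs_lt.1 (abs_sub_lt_of_not_exceptional hexc' le_rfl)
    have h1 := hUb.trans (hmax hb)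
    rw [hU, EReal.coe_le_coe_iff] at h1
    linarith [hε.gap h b hlt, hε.pos, hh a]

open scoped Classical in
/-- The number of ties of arm `a` before time `T` that are followed by a small reward. -/
noncomputable def brokenTies (μ : A → ℝ) (ε : ℝ) (arm : ℕ → A) (X : ℕ → ℝ) (a : A) (T : ℕ) : ℕ :=
  ((Finset.range T).filter fun t => IsTie μ ε arm X a t ∧ X (t + 1) < μ a - ε).card

open scoped Classical in
omit [Fintype A] in
lemma card_filter_exceptional_le {S : Finset ℕ} {f : ℕ → ℕ} {T : ℕ} (hf : Set.InjOn f S)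
    (hS : ∀ t ∈ S, f t ≤ T ∧ (f t = 0 ∨ Exceptional fam μ ε arm X (f t))) :
    S.card ≤ exceptionalCount fam μ ε arm X T + 1 := by
  rw [exceptionalCount, ← Finset.card_insert_of_notMem (a := 0) (by simp),
    ← Finset.card_image_of_injOn hf]
  refine Finset.card_le_card fun n hn => ?_
  obtain ⟨t, ht, rfl⟩ := Finset.mem_image.1 hn
  obtain ⟨h1, h2⟩ := hS t ht
  rcases h2 with h2 | h2
  · simp [h2]
  · rcases Nat.eq_zero_or_pos (f t) with h0 | h0
    · simp [h0]
    · exact Finset.mem_insert_of_mem (Finset.mem_filter.2 ⟨Finset.mem_Icc.2 ⟨h0, h1⟩, h2⟩)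

/-- Bound on the ties followed by a small reward. Such a tie of `a` with the current best arm `h`
breaks it: `a` drops below `h`. Hence, before the next pull of `a`, either `h` is pulled, and then
the pair of `h` and its (exceptional) number of pulls determines the tie; or the next pull of `a` is
a regular one. If then a suboptimal arm leads, such pulls are few; if the optimal arm leads, it has
been pulled more often than `a`, whereas at the tie it was underestimated with fewer pulls, so that
its (exceptional) number of pulls determines the tie. -/
lemma exists_brokenTies_le (hν : IsUnimodal fam G μ astar) (hε : IsMargin fam μ ε) {η : ℝ}
    (hη : 0 < η) :
    ∃ C ≥ 0, ∀ (arm : ℕ → A) (X : ℕ → ℝ), (∀ b t, empMean arm X b t ∈ fam.extendedMeans) →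
      (∀ t, 1 ≤ t → KlucbUBStep fam G arm X t) → ∀ T a, a ≠ astar →
      (brokenTies μ ε arm X a T : ℝ) ≤
        (Fintype.card A + 3) * (exceptionalCount fam μ ε arm X T + 1)
          + η * suboptimalPulls astar arm T + C := by
  obtain ⟨C, hC, hreg⟩ := exists_pulls_le_of_klucbUBStep hν hε hη
  refine ⟨C, hC, ?_⟩
  intro arm X hext hstep T a ha
  classical
  set Z := exceptionalCount fam μ ε arm X T with hZ
  set M : ℝ := η * suboptimalPulls astar arm T + C with hM
  set D := (Finset.range T).filter fun t => IsTie μ ε arm X a t ∧ X (t + 1) < μ a - ε with hD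
  have hM0 : 0 ≤ M := by positivity
  -- The properties of a single tie at a level that is not exceptional.
  have hlead : ∀ t, ∃ h, t ∈ D → ¬ Exceptional fam μ ε arm X (pulls arm a t) →
      h ∈ leaders arm X t ∧ (pulls arm h t = 0 ∨ Exceptional fam μ ε arm X (pulls arm h t)) := by
    intro t
    by_cases ht : t ∈ D ∧ ¬ Exceptional fam μ ε arm X (pulls arm a t)
    · obtain ⟨htD, hexc⟩ := ht
      obtain ⟨-, ⟨harm, hbest, hnl, -⟩, -⟩ := Finset.mem_filter.1 htD
      have ht1 : 1 ≤ t := by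
        by_contra! h0
        obtain rfl : t = 0 := by omega
        exact hnl ⟨hbest, fun b _ => by simp [pulls_zero]⟩
      obtain ⟨h, hh, hmem, hmax, hcase⟩ := (hstep t ht1).exists_leader hext harm
      refine ⟨h, fun _ _ => ⟨hh, ?_⟩⟩
      rcases hcase with hle | ⟨-, -, hU⟩
      · exact absurd ⟨hbest, fun b hb => hle.trans (hh.2 b hb)⟩ hnl
      · exact leader_of_tie hν hext hε ha hh.1 hbest hmax hU hexc
    · exact ⟨a, fun h1 h2 => absurd ⟨h1, h2⟩ ht⟩
  choose lead hlead using hlead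
  -- Apart from the ties at exceptional levels (`D₁`), either arm `a` is pulled again before the
  -- current best arm of the tie is (`D₂`) or not (`D₃`). In the first case, the next pull of `a`
  -- occurs at an exceptional level (`D₄`), while a suboptimal arm leads (`D₅`), or while the optimal
  -- arm leads (`D₆`).
  set D₁ := D.filter fun t => Exceptional fam μ ε arm X (pulls arm a t) with hD₁
  set D₂ := (D.filter fun t => ¬ Exceptional fam μ ε arm X (pulls arm a t)).filter fun t =>
    ∃ o, t < o ∧ o < T ∧ arm (o + 1) = a ∧ pulls arm (lead t) o = pulls arm (lead t) t with hD₂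
  set D₃ := (D.filter fun t => ¬ Exceptional fam μ ε arm X (pulls arm a t)).filter fun t =>
    ¬ ∃ o, t < o ∧ o < T ∧ arm (o + 1) = a ∧ pulls arm (lead t) o = pulls arm (lead t) t with hD₃
  set D₄ := D₂.filter fun t => Exceptional fam μ ε arm X (pulls arm a t + 1) with hD₄
  set D₅ := D₂.filter fun t => (pulls arm a t : ℝ) + 1 ≤ M with hD₅
  set D₆ := D₂.filter fun t => ∃ r, t < r ∧ pulls arm a r = pulls arm a t + 1 ∧
    pulls arm a t + 1 ≤ pulls arm astar r with hD₆
  have harmD : ∀ t ∈ D, arm (t + 1) = a := fun t ht => (Finset.mem_filter.1 ht).2.1.1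
  have hTD : ∀ t ∈ D, t < T := fun t ht => Finset.mem_range.1 (Finset.mem_filter.1 ht).1
  have hinj : Set.InjOn (pulls arm a) D := (pulls_injOn a).mono fun t ht => harmD t ht
  have hsub₂ : D₂ ⊆ D := (Finset.filter_subset _ _).trans (Finset.filter_subset _ _)
  have hsub₃ : D₃ ⊆ D := (Finset.filter_subset _ _).trans (Finset.filter_subset _ _)
  have hexc₂ : ∀ t ∈ D₂, ¬ Exceptional fam μ ε arm X (pulls arm a t) := fun t ht =>
    (Finset.mem_filter.1 (Finset.mem_filter.1 ht).1).2
  have hexc₃ : ∀ t ∈ D₃, ¬ Exceptional fam μ ε arm X (pulls arm a t) := fun t ht =>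
    (Finset.mem_filter.1 (Finset.mem_filter.1 ht).1).2
  have hle : ∀ b, ∀ t ∈ D, pulls arm b t ≤ T := fun b t ht =>
    (pulls_le arm b t).trans (hTD t ht).le
  have hcard₁ : D₁.card ≤ Z + 1 :=
    card_filter_exceptional_le (hinj.mono (Finset.filter_subset _ _)) fun t ht =>
      ⟨hle a t (Finset.mem_filter.1 ht).1, Or.inr (Finset.mem_filter.1 ht).2⟩
  have hcard₄ : D₄.card ≤ Z + 1 := by
    refine card_filter_exceptional_le (f := fun t => pulls arm a t + 1) ?_ fun t ht => ⟨?_, ?_⟩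
    · intro s hs t ht hst
      exact hinj (hsub₂ (Finset.mem_filter.1 hs).1) (hsub₂ (Finset.mem_filter.1 ht).1)
        (Nat.add_right_cancel hst)
    · have htD := hsub₂ (Finset.mem_filter.1 ht).1
      have h1 := pulls_succ_of_eq (harmD t htD)
      have h2 := pulls_le arm a (t + 1)
      have h3 := hTD t htD
      omega
    · exact Or.inr (Finset.mem_filter.1 ht).2
  have hcard₅ : (D₅.card : ℝ) ≤ M := by
    have h1 : D₅.card ≤ ⌊M⌋₊ := by
      rw [← Finset.card_image_of_injOn (f := pulls arm a)
        (hinj.mono ((Finset.filter_subset _ _).trans hsub₂)), ← Finset.card_range ⌊M⌋₊]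
      refine Finset.card_le_card fun n hn => ?_
      obtain ⟨t, ht, rfl⟩ := Finset.mem_image.1 hn
      refine Finset.mem_range.2 (Nat.lt_of_succ_le (Nat.le_floor ?_))
      have := (Finset.mem_filter.1 ht).2
      push_cast
      exact this
    exact (Nat.cast_le.2 h1).trans (Nat.floor_le hM0)
  have hopt : ∀ t ∈ D₂, pulls arm astar t < pulls arm a t ∧
      (pulls arm astar t = 0 ∨ Exceptional fam μ ε arm X (pulls arm astar t)) := fun t ht =>
    optimal_of_tie hν hε ha (Finset.mem_filter.1 (hsub₂ ht)).2.1.2.1 (hexc₂ t ht)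
  have hcard₆ : D₆.card ≤ Z + 1 := by
    have hlt : ∀ s ∈ D₆, ∀ t ∈ D₆, s < t → pulls arm astar s < pulls arm astar t := by
      intro s hs t ht hst
      obtain ⟨hs₂, r, hr1, hr2, hr3⟩ := Finset.mem_filter.1 hs
      have hrt : r ≤ t := by
        by_contra! htr
        have h1 := pulls_lt_pulls (harmD s (hsub₂ hs₂)) hst
        have h2 := pulls_lt_pulls (harmD t (hsub₂ (Finset.mem_filter.1 ht).1)) htr
        omega
      have h3 := pulls_mono arm astar hrt
      have h4 := (hopt s hs₂).1
      omega
    refine card_filter_exceptional_le (f := pulls arm astar) ?_ fun t ht =>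
      ⟨hle _ t (hsub₂ (Finset.mem_filter.1 ht).1), (hopt t (Finset.mem_filter.1 ht).1).2⟩
    intro s hs t ht hst
    rcases lt_trichotomy s t with h | h | h
    · exact absurd hst (hlt s hs t ht h).ne
    · exact h
    · exact absurd hst (hlt t ht s hs h).ne'
  have hcard₃ : D₃.card ≤ Fintype.card A * (Z + 1) := by
    rw [← Finset.card_univ, mul_comm]
    refine Finset.card_le_mul_card_image_of_maps_to (f := lead) (fun t _ => Finset.mem_univ _) _
      fun h _ => ?_
    refine card_filter_exceptional_le (f := pulls arm h) ?_ fun t ht => ?_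
    · have hlt : ∀ s ∈ D₃.filter (fun t => lead t = h), ∀ t ∈ D₃.filter (fun t => lead t = h),
          s < t → pulls arm h s ≠ pulls arm h t := by
        intro s hs t ht hst heq
        obtain ⟨hs₃, rfl⟩ := Finset.mem_filter.1 hs
        have htD := hsub₃ (Finset.mem_filter.1 ht).1
        exact (Finset.mem_filter.1 hs₃).2 ⟨t, hst, hTD t htD, harmD t htD, heq.symm⟩
      intro s hs t ht hst
      rcases lt_trichotomy s t with h | h | h
      · exact absurd hst (hlt s hs t ht h)
      · exact h
      · exact absurd hst.symm (hlt t ht s hs h)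
    · obtain ⟨ht₃, rfl⟩ := Finset.mem_filter.1 ht
      exact ⟨hle _ t (hsub₃ ht₃), (hlead t (hsub₃ ht₃) (hexc₃ t ht₃)).2⟩
  have hD₂sub : D₂ ⊆ D₄ ∪ (D₅ ∪ D₆) := by
    intro t ht
    have htD := hsub₂ ht
    obtain ⟨-, o, hto, hoT, hoarm, hopulls⟩ := Finset.mem_filter.1 ht
    obtain ⟨-, ⟨harm, hbest, hnl, hmean⟩, hX⟩ := Finset.mem_filter.1 htD
    obtain ⟨hh, hh2⟩ := hlead t htD (hexc₂ t ht)
    obtain ⟨r, htr, hro, hrarm, hrpulls⟩ := exists_next_pull hto hoarm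
    have hr1 : pulls arm a r = pulls arm a t + 1 := hrpulls.trans (pulls_succ_of_eq harm)
    by_cases hexc : Exceptional fam μ ε arm X (pulls arm a t + 1)
    · exact Finset.mem_union_left _ (Finset.mem_filter.2 ⟨ht, hexc⟩)
    refine Finset.mem_union_right _ ?_
    have hn : 1 ≤ pulls arm a t := by
      by_contra! h0
      exact hnl ⟨hbest, fun b _ => by omega⟩
    -- At time `r` arm `a` is below the arm that led at time `t`.
    have hlt : empMean arm X a r < empMean arm X (lead t) r := by
      rw [← empMean_eq_of_pulls_eq (Nat.succ_le_of_lt htr) hrpulls.symm,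
        ← empMean_eq_of_pulls_eq htr.le (le_antisymm (pulls_mono arm _ htr.le)
          ((pulls_mono arm _ hro).trans hopulls.le))]
      exact (empMean_succ_lt harm hn (by linarith)).trans_le (hh.1 a)
    obtain ⟨h, hhr, hmem, hmax, hcase⟩ := (hstep r (by omega)).exists_leader hext hrarm
    have hle_r : pulls arm a r ≤ pulls arm h r := by
      rcases hcase with hc | ⟨-, hc, -⟩
      · exact hc
      · exact absurd (hc (lead t)) (not_le.2 hlt)
    rcases hreg arm X hext r T a h ha (by omega) hhr hmem hmax hle_r (by omega)
      (by rwa [hr1]) with ⟨rfl, -⟩ | hsmall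
    · exact Finset.mem_union_right _ (Finset.mem_filter.2 ⟨ht, r, htr, hr1, by omega⟩)
    · refine Finset.mem_union_left _ (Finset.mem_filter.2 ⟨ht, ?_⟩)
      rw [hr1] at hsmall
      push_cast at hsmall
      exact hsmall
  have hDsub : D ⊆ D₁ ∪ (D₂ ∪ D₃) := by
    intro t ht
    simp only [hD₁, hD₂, hD₃, Finset.mem_union, Finset.mem_filter, ht, true_and, ← and_or_left,
      em, and_true]
  have h1 : D.card ≤ D₁.card + ((D₄.card + (D₅.card + D₆.card)) + D₃.card) := by
    refine (Finset.card_le_card hDsub).trans ((Finset.card_union_le _ _).trans ?_)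
    refine Nat.add_le_add_left ((Finset.card_union_le _ _).trans (Nat.add_le_add_right ?_ _)) _
    refine (Finset.card_le_card hD₂sub).trans ((Finset.card_union_le _ _).trans ?_)
    exact Nat.add_le_add_left (Finset.card_union_le _ _) _
  have h2 : (D.card : ℝ) ≤ D₁.card + ((D₄.card + (D₅.card + D₆.card)) + D₃.card) := by
    exact_mod_cast h1
  have c1 : (D₁.card : ℝ) ≤ Z + 1 := by exact_mod_cast hcard₁
  have c4 : (D₄.card : ℝ) ≤ Z + 1 := by exact_mod_cast hcard₄
  have c6 : (D₆.card : ℝ) ≤ Z + 1 := by exact_mod_cast hcard₆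
  have c3 : (D₃.card : ℝ) ≤ Fintype.card A * (Z + 1) := by exact_mod_cast hcard₃
  have e : brokenTies μ ε arm X a T = D.card := rfl
  rw [e]
  linarith

/-! ### Numbers of pulls along a trajectory -/

open scoped Classical in
omit [Fintype A] in
/-- Distinct pulls of `a` occur at distinct levels `pulls arm a t`, so at most `R` of them occur at
positive levels below `R`. The other pulls occur at level zero, at exceptional levels, or in one of
the rounds `Q`. -/
lemma pulls_le_of_forall {T : ℕ} {a : A} {R : ℝ} (hR : 0 ≤ R) (Q : ℕ → Prop)
    (h : ∀ t < T, arm (t + 1) = a → 1 ≤ pulls arm a t →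
      ¬ Exceptional fam μ ε arm X (pulls arm a t) → ¬ Q t → (pulls arm a t : ℝ) ≤ R) :
    (pulls arm a T : ℝ) ≤ exceptionalCount fam μ ε arm X T + 1 + R
      + ((Finset.range T).filter Q).card := by
  have e : pulls arm a T = ((Finset.range T).filter fun t => arm (t + 1) = a).card := by
    rw [pulls]
    refine (Finset.card_bij (fun t _ => t + 1) ?_ ?_ ?_).symm
    · intro t ht
      simp only [Finset.mem_filter, Finset.mem_range, Finset.mem_Icc] at ht ⊢
      exact ⟨by omega, ht.2⟩
    · intro s _ t _ hst
      omega
    · intro t ht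
      simp only [Finset.mem_filter, Finset.mem_Icc] at ht
      refine ⟨t - 1, ?_, by omega⟩
      simp only [Finset.mem_filter, Finset.mem_range]
      rw [show t - 1 + 1 = t by omega]
      exact ⟨by omega, ht.2⟩
  set D := (Finset.range T).filter fun t => arm (t + 1) = a with hD
  set D₁ := D.filter fun t => pulls arm a t = 0 ∨ Exceptional fam μ ε arm X (pulls arm a t) with hD₁
  set D₂ := D.filter fun t => 1 ≤ pulls arm a t ∧ (pulls arm a t : ℝ) ≤ R with hD₂
  have hinj : Set.InjOn (pulls arm a) D := (pulls_injOn a).mono fun t ht =>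
    (Finset.mem_filter.1 ht).2
  have hcard₁ : D₁.card ≤ exceptionalCount fam μ ε arm X T + 1 :=
    card_filter_exceptional_le (hinj.mono (Finset.filter_subset _ _)) fun t ht =>
      ⟨(pulls_le arm a t).trans
        (Finset.mem_range.1 (Finset.mem_filter.1 (Finset.mem_filter.1 ht).1).1).le,
        (Finset.mem_filter.1 ht).2⟩
  have hcard₂ : (D₂.card : ℝ) ≤ R := by
    have h1 : D₂.card ≤ ⌊R⌋₊ := by
      rw [← Finset.card_image_of_injOn (f := pulls arm a) (hinj.mono (Finset.filter_subset _ _))]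
      have : ⌊R⌋₊ = (Finset.Icc 1 ⌊R⌋₊).card := by simp
      rw [this]
      refine Finset.card_le_card fun n hn => ?_
      obtain ⟨t, ht, rfl⟩ := Finset.mem_image.1 hn
      have := (Finset.mem_filter.1 ht).2
      exact Finset.mem_Icc.2 ⟨this.1, Nat.le_floor this.2⟩
    exact (Nat.cast_le.2 h1).trans (Nat.floor_le hR)
  have hsub : D ⊆ D₁ ∪ (D₂ ∪ (Finset.range T).filter Q) := by
    intro t ht
    obtain ⟨htT, harm⟩ := Finset.mem_filter.1 ht
    by_cases h1 : pulls arm a t = 0 ∨ Exceptional fam μ ε arm X (pulls arm a t)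
    · exact Finset.mem_union_left _ (Finset.mem_filter.2 ⟨ht, h1⟩)
    push Not at h1
    refine Finset.mem_union_right _ ?_
    by_cases hQ : Q t
    · exact Finset.mem_union_right _ (Finset.mem_filter.2 ⟨htT, hQ⟩)
    have hn : 1 ≤ pulls arm a t := Nat.one_le_iff_ne_zero.2 h1.1
    exact Finset.mem_union_left _ (Finset.mem_filter.2 ⟨ht, hn,
      h t (Finset.mem_range.1 htT) harm hn h1.2 hQ⟩)
  have h1 : D.card ≤ D₁.card + (D₂.card + ((Finset.range T).filter Q).card) :=
    (Finset.card_le_card hsub).trans ((Finset.card_union_le _ _).trans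
      (Nat.add_le_add_left (Finset.card_union_le _ _) _))
  have h2 : (D.card : ℝ) ≤ D₁.card + (D₂.card + ((Finset.range T).filter Q).card) := by
    exact_mod_cast h1
  have c1 : (D₁.card : ℝ) ≤ exceptionalCount fam μ ε arm X T + 1 := by exact_mod_cast hcard₁
  rw [e]
  linarith

end Ties

/-! ### Expected numbers of pulls -/

section Expectation

variable {A : Type*} [Fintype A] {Ω : Type*} {mΩ : MeasurableSpace Ω} {P : Measure Ω}
  [IsProbabilityMeasure P] {ℱ : Filtration ℕ mΩ} {arm : ℕ → Ω → A} {X : ℕ → Ω → ℝ}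
  {fam : RewardFamily} {G : SimpleGraph A} {μ : A → ℝ} {astar : A} {ε : ℝ}

/-- A sequence that is `o(1 / n)` has partial sums `o(log T)`. -/
lemma exists_sum_Icc_le {q : ℕ → ℝ} (hq0 : ∀ n, 0 ≤ q n)
    (hq : Tendsto (fun n : ℕ => (n : ℝ) * q n) atTop (𝓝 0)) {η : ℝ} (hη : 0 < η) :
    ∃ C ≥ 0, ∀ T : ℕ, ∑ n ∈ Finset.Icc 1 T, q n ≤ η * Real.log T + C := by
  obtain ⟨N, hN⟩ := eventually_atTop.1 (hq.eventually_lt_const hη)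
  refine ⟨∑ n ∈ Finset.range N, q n + η,
    add_nonneg (Finset.sum_nonneg fun n _ => hq0 n) hη.le, fun T => ?_⟩
  have h1 : ∑ n ∈ Finset.Icc 1 T, q n
      ≤ ∑ n ∈ Finset.Icc 1 T, ((if n < N then q n else 0) + η * (n : ℝ)⁻¹) := by
    refine Finset.sum_le_sum fun n hn => ?_
    have hn0 : (0 : ℝ) < n := by exact_mod_cast (Finset.mem_Icc.1 hn).1
    split_ifs with h
    · have : 0 ≤ η * (n : ℝ)⁻¹ := by positivity
      linarith
    · rw [zero_add, ← div_eq_mul_inv, le_div_iff₀ hn0, mul_comm]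
      exact (hN n (not_lt.1 h)).le
  have h2 : ∑ n ∈ Finset.Icc 1 T, (if n < N then q n else 0) ≤ ∑ n ∈ Finset.range N, q n := by
    rw [← Finset.sum_filter]
    refine Finset.sum_le_sum_of_subset_of_nonneg (fun n hn => ?_) fun n _ _ => hq0 n
    exact Finset.mem_range.2 (Finset.mem_filter.1 hn).2
  have h3 : ∑ n ∈ Finset.Icc 1 T, (n : ℝ)⁻¹ ≤ 1 + Real.log T := by
    have := harmonic_le_one_add_log T
    rw [harmonic_eq_sum_Icc] at this
    push_cast at this
    exact this
  rw [Finset.sum_add_distrib, ← Finset.mul_sum] at h1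
  have := mul_le_mul_of_nonneg_left h3 hη.le
  linarith

omit [Fintype A] [IsProbabilityMeasure P] in
lemma integral_card_filter [IsFiniteMeasure P] {S : Finset ℕ} {Q : ℕ → Set Ω}
    {dec : ∀ ω, DecidablePred fun t => ω ∈ Q t} (hQ : ∀ t, MeasurableSet (Q t)) :
    Integrable (fun ω => ((S.filter fun t => ω ∈ Q t).card : ℝ)) P ∧
    ∫ ω, ((S.filter fun t => ω ∈ Q t).card : ℝ) ∂P = ∑ t ∈ S, P.real (Q t) := by
  have e : (fun ω => ((S.filter fun t => ω ∈ Q t).card : ℝ))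
      = fun ω => ∑ t ∈ S, (Q t).indicator (fun _ => (1 : ℝ)) ω := by
    ext ω
    rw [Finset.card_filter]
    push_cast
    exact Finset.sum_congr rfl fun t _ => by simp [Set.indicator_apply]
  have hi : ∀ t ∈ S, Integrable ((Q t).indicator fun _ => (1 : ℝ)) P := fun t _ =>
    (integrable_const 1).indicator (hQ t)
  rw [e]
  refine ⟨integrable_finsetSum S hi, ?_⟩
  rw [integral_finsetSum S hi]
  exact Finset.sum_congr rfl fun t _ => by rw [integral_indicator_const _ (hQ t)]; simp

/-- The number of exceptional levels has expectation `o(log T)`. (It need not be measurable, hence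
the measurable upper bound.) -/
lemma exists_exceptionalCount_le (hμ : ∀ a, μ a ∈ fam.means)
    (h : IsBanditProcess (fun a => fam.law (μ a)) P ℱ arm X) (hε : IsMargin fam μ ε) {η : ℝ}
    (hη : 0 < η) :
    ∃ C ≥ 0, ∀ T : ℕ, ∃ Z : Ω → ℝ, Integrable Z P ∧
      (∀ ω, (exceptionalCount fam μ ε (fun s => arm s ω) (fun s => X s ω) T : ℝ) ≤ Z ω) ∧
      ∫ ω, Z ω ∂P ≤ η * Real.log T + C := by
  classical
  set E : ℕ → Set Ω := fun n => {ω | Exceptional fam μ ε (fun s => arm s ω) (fun s => X s ω) n}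
    with hE
  have hlim := tendsto_mul_measure_exceptional hμ h hε.pos fun a =>
    hε.mem_means a (x := μ a - ε) (by linarith [hε.pos]) (by linarith [hε.pos])
  obtain ⟨C, hC, hsum⟩ := exists_sum_Icc_le (q := fun n => P.real (E n))
    (fun n => measureReal_nonneg) hlim hη
  refine ⟨C, hC, fun T => ?_⟩
  have hint := integral_card_filter (P := P) (S := Finset.Icc 1 T)
    (Q := fun n => toMeasurable P (E n)) (dec := fun _ _ => Classical.propDecidable _)
    fun n => measurableSet_toMeasurable P _
  refine ⟨_, hint.1, fun ω => ?_, ?_⟩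
  · rw [exceptionalCount]
    refine Nat.cast_le.2 (Finset.card_le_card fun n hn => ?_)
    rw [Finset.mem_filter] at hn ⊢
    exact ⟨hn.1, subset_toMeasurable P (E n) hn.2⟩
  · rw [hint.2]
    refine le_trans (le_of_eq (Finset.sum_congr rfl fun n _ => ?_)) (hsum T)
    rw [measureReal_def, measure_toMeasurable, measureReal_def]

omit [Fintype A] in
lemma IsBanditProcess.integrable_pulls {ν : A → Measure ℝ} (h : IsBanditProcess ν P ℱ arm X) (a : A)
    (T : ℕ) : Integrable (fun ω => (pulls (fun s => arm s ω) a T : ℝ)) P := by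
  refine Integrable.of_bound (C := T)
    ((measurable_from_top.comp ((h.measurable_pulls a T).mono (ℱ.le T) le_rfl)).aestronglyMeasurable)
    (ae_of_all _ fun ω => ?_)
  rw [Real.norm_of_nonneg (Nat.cast_nonneg _)]
  exact_mod_cast pulls_le _ a T

/-- The expected number of pulls of `a` in the first `T` rounds. -/
noncomputable def expPulls (P : Measure Ω) (arm : ℕ → Ω → A) (a : A) (T : ℕ) : ℝ :=
  ∫ ω, (pulls (fun s => arm s ω) a T : ℝ) ∂P

/-- The expected number of pulls of suboptimal arms in the first `T` rounds. -/
noncomputable def expSuboptimalPulls (P : Measure Ω) (arm : ℕ → Ω → A) (astar : A) (T : ℕ) : ℝ :=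
  ∫ ω, (suboptimalPulls astar (fun s => arm s ω) T : ℝ) ∂P

lemma IsBanditProcess.integrable_suboptimalPulls {ν : A → Measure ℝ}
    (h : IsBanditProcess ν P ℱ arm X) (T : ℕ) :
    Integrable (fun ω => (suboptimalPulls astar (fun s => arm s ω) T : ℝ)) P := by
  simp_rw [suboptimalPulls, Nat.cast_sum]
  exact integrable_finsetSum _ fun a _ => h.integrable_pulls a T

open scoped Classical in
lemma IsBanditProcess.expSuboptimalPulls_eq {ν : A → Measure ℝ}
    (h : IsBanditProcess ν P ℱ arm X) (T : ℕ) :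
    expSuboptimalPulls P arm astar T = ∑ a with a ≠ astar, expPulls P arm a T := by
  simp_rw [expSuboptimalPulls, suboptimalPulls, Nat.cast_sum]
  exact integral_finsetSum _ fun a _ => h.integrable_pulls a T

/-- Arm `a` is pulled at most `κ a * log T` times, up to `o(log T)` and a negligible fraction of the
pulls of suboptimal arms. -/
def HasPullRate (P : Measure Ω) (arm : ℕ → Ω → A) (astar : A) (κ : A → ℝ) : Prop :=
  ∀ η > 0, ∀ a, a ≠ astar → ∃ C ≥ 0, ∀ T : ℕ, expPulls P arm a T ≤
    κ a * Real.log T + η * (Real.log T + expSuboptimalPulls P arm astar T) + C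

/-- The limiting exploration rate is continuous in the precision. -/
lemma exists_isMargin_explorationRate_le (hν : IsUnimodal fam G μ astar) {η : ℝ} (hη : 0 < η) :
    ∃ ε, IsMargin fam μ ε ∧
      ∀ a, explorationRate fam G μ astar ε a ≤ explorationRate fam G μ astar 0 a + η := by
  have h1 : ∀ᶠ ε in 𝓝[>] (0 : ℝ), ∀ a,
      explorationRate fam G μ astar ε a ≤ explorationRate fam G μ astar 0 a + η := by
    refine eventually_all.2 fun a => nhdsWithin_le_nhds ?_
    by_cases hadj : G.Adj astar a
    · have hpos := klFormula_pos (hν.mem_means a) (hν.mem_means astar) (hν.lt_optimal a hadj.ne')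
      have hlim := (tendsto_klFormula fam (hν.mem_means a) (hν.mem_means astar)).inv₀ hpos.ne'
      simp only [explorationRate, if_pos hadj, add_zero, sub_zero]
      filter_upwards [hlim.eventually_lt_const (lt_add_of_pos_right _ hη)] with ε hε using hε.le
    · simp only [explorationRate, if_neg hadj]
      exact Eventually.of_forall fun _ => by linarith
  obtain ⟨ε, h2, h3⟩ := ((eventually_isMargin hν.mem_means).and h1).exists
  exact ⟨ε, h2, h3⟩

/-- The case of the IMED policies, whose exploration is bounded along trajectories. -/
lemma hasPullRate_of_pulls_le (hν : IsUnimodal fam G μ astar)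
    (h : IsBanditProcess (fun a => fam.law (μ a)) P ℱ arm X)
    (hstep : ∀ ε, IsMargin fam μ ε → ∀ η > 0, ∃ C ≥ 0, ∀ᵐ ω ∂P, ∀ t T : ℕ, 1 ≤ t → t ≤ T →
      ∀ a, arm (t + 1) ω = a → a ≠ astar → 1 ≤ pulls (fun s => arm s ω) a t →
      ¬ Exceptional fam μ ε (fun s => arm s ω) (fun s => X s ω) (pulls (fun s => arm s ω) a t) →
      (pulls (fun s => arm s ω) a t : ℝ)
        ≤ explorationRate fam G μ astar ε a * Real.log T + η * Real.log T + C) :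
    HasPullRate P arm astar (explorationRate fam G μ astar 0) := by
  intro η hη a ha
  have hη3 : 0 < η / 3 := by positivity
  obtain ⟨ε, hε, hrate⟩ := exists_isMargin_explorationRate_le hν hη3
  obtain ⟨C₁, hC₁, hbound⟩ := hstep ε hε (η / 3) hη3
  obtain ⟨C₂, hC₂, hexc⟩ := exists_exceptionalCount_le hν.mem_means h hε hη3
  refine ⟨C₁ + C₂ + 1, by positivity, fun T => ?_⟩
  obtain ⟨Z, hZint, hZle, hZ⟩ := hexc T
  have hlogT : 0 ≤ Real.log T := Real.log_natCast_nonneg T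
  set R := explorationRate fam G μ astar ε a * Real.log T + η / 3 * Real.log T + C₁ with hR
  have hR0 : 0 ≤ R := by
    have := mul_nonneg (explorationRate_nonneg hν hε a) hlogT
    positivity
  have hle : expPulls P arm a T ≤ ∫ ω, (Z ω + (1 + R)) ∂P := by
    refine integral_mono_ae (h.integrable_pulls a T) (hZint.add (integrable_const _)) ?_
    filter_upwards [hbound] with ω hω
    have := pulls_le_of_forall (fam := fam) (μ := μ) (ε := ε) (arm := fun s => arm s ω)
      (X := fun s => X s ω) (T := T) (a := a) hR0 (fun _ => False) (by
        intro t htT harm hn hnexc _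
        have ht : 1 ≤ t := hn.trans (pulls_le _ a t)
        exact hω t T ht htT.le a harm ha hn hnexc)
    simp only [Finset.filter_false, Finset.card_empty, Nat.cast_zero, add_zero] at this
    linarith [hZle ω]
  rw [integral_add hZint (integrable_const _), integral_const, probReal_univ, one_smul] at hle
  have h1 := mul_le_mul_of_nonneg_right (hrate a) hlogT
  have h2 : 0 ≤ expSuboptimalPulls P arm astar T := integral_nonneg fun _ => Nat.cast_nonneg _
  have h3 : 0 ≤ η * expSuboptimalPulls P arm astar T := by positivity
  linarith

lemma hasPullRate_imedUB (hν : IsUnimodal fam G μ astar)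
    (h : IsBanditProcess (fun a => fam.law (μ a)) P ℱ arm X)
    (hstrat : FollowsImedUB fam G P arm X) :
    HasPullRate P arm astar (explorationRate fam G μ astar 0) := by
  refine hasPullRate_of_pulls_le hν h fun ε hε η hη => ⟨0, le_rfl, ?_⟩
  filter_upwards [hstrat, h.ae_empMean_mem hν.mem_means] with ω hω hext t T ht htT a harm ha hn hexc
  have h1 := (hω t ht).pulls_le hν hext hε harm ha htT hn hexc
  have h2 : 0 ≤ η * Real.log T := mul_nonneg (le_of_lt hη) (Real.log_natCast_nonneg T)
  linarith

lemma hasPullRate_dImedUB (hν : IsUnimodal fam G μ astar) (hG : G.IsTree)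
    (h : IsBanditProcess (fun a => fam.law (μ a)) P ℱ arm X)
    (hstrat : FollowsDImedUB fam G P arm X) :
    HasPullRate P arm astar (explorationRate fam G μ astar 0) := by
  refine hasPullRate_of_pulls_le hν h fun ε hε η hη => ?_
  obtain ⟨C, hC, hbound⟩ := exists_pulls_le_of_dImedUBStep hν hG hε hη
  refine ⟨C, hC, ?_⟩
  filter_upwards [hstrat, h.ae_empMean_mem hν.mem_means] with ω hω hext t T ht htT a harm ha hn hexc
  exact hbound _ _ hext t T (hω t ht) a harm ha htT hn hexc

omit [IsProbabilityMeasure P] in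
lemma IsBanditProcess.measurableSet_isTie {ν : A → Measure ℝ} (h : IsBanditProcess ν P ℱ arm X)
    (a : A) (t : ℕ) :
    MeasurableSet[ℱ t] {ω | IsTie μ ε (fun s => arm s ω) (fun s => X s ω) a t} := by
  have hbest : ∀ b, MeasurableSet[ℱ t] {ω | b ∈ bestArms (fun s => arm s ω) (fun s => X s ω) t} := by
    intro b
    have : {ω | b ∈ bestArms (fun s => arm s ω) (fun s => X s ω) t} = ⋂ c,
        {ω | empMean (fun s => arm s ω) (fun s => X s ω) c t
          ≤ empMean (fun s => arm s ω) (fun s => X s ω) b t} := by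
      ext ω; simp [bestArms]
    rw [this]
    exact MeasurableSet.iInter fun c =>
      measurableSet_le (h.measurable_empMean c t) (h.measurable_empMean b t)
  have hlead : MeasurableSet[ℱ t]
      {ω | a ∈ leaders (fun s => arm s ω) (fun s => X s ω) t} := by
    have : {ω | a ∈ leaders (fun s => arm s ω) (fun s => X s ω) t}
        = {ω | a ∈ bestArms (fun s => arm s ω) (fun s => X s ω) t} ∩ ⋂ b,
          ({ω | b ∈ bestArms (fun s => arm s ω) (fun s => X s ω) t}ᶜ ∪
          {ω | pulls (fun s => arm s ω) a t ≤ pulls (fun s => arm s ω) b t}) := by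
      ext ω; simp [leaders, imp_iff_not_or]
    rw [this]
    exact (hbest a).inter (MeasurableSet.iInter fun b => (hbest b).compl.union
      (measurableSet_le (h.measurable_pulls a t) (h.measurable_pulls b t)))
  have : {ω | IsTie μ ε (fun s => arm s ω) (fun s => X s ω) a t}
      = {ω | arm (t + 1) ω = a} ∩ ({ω | a ∈ bestArms (fun s => arm s ω) (fun s => X s ω) t} ∩
        ({ω | a ∈ leaders (fun s => arm s ω) (fun s => X s ω) t}ᶜ ∩
        {ω | μ a - ε < empMean (fun s => arm s ω) (fun s => X s ω) a t})) := by
    ext ω; simp [IsTie]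
  rw [this]
  exact (h.arm_predictable t a).inter ((hbest a).inter (hlead.compl.inter
    (measurableSet_lt measurable_const (h.measurable_empMean a t))))

open scoped Classical in
/-- A fixed proportion of the ties is followed by a small reward. -/
lemma IsBanditProcess.integral_brokenTies
    (h : IsBanditProcess (fun a => fam.law (μ a)) P ℱ arm X) (a : A) (T : ℕ) :
    Integrable (fun ω => (((Finset.range T).filter fun t =>
      IsTie μ ε (fun s => arm s ω) (fun s => X s ω) a t).card : ℝ)) P ∧
    Integrable (fun ω => (brokenTies μ ε (fun s => arm s ω) (fun s => X s ω) a T : ℝ)) P ∧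
    ∫ ω, (brokenTies μ ε (fun s => arm s ω) (fun s => X s ω) a T : ℝ) ∂P
      = (∫ ω, (((Finset.range T).filter fun t =>
          IsTie μ ε (fun s => arm s ω) (fun s => X s ω) a t).card : ℝ) ∂P)
        * (fam.law (μ a)).real (Set.Iio (μ a - ε)) := by
  set Q : ℕ → Set Ω := fun t => {ω | IsTie μ ε (fun s => arm s ω) (fun s => X s ω) a t} with hQ
  set Q' : ℕ → Set Ω := fun t => Q t ∩ X (t + 1) ⁻¹' Set.Iio (μ a - ε) with hQ'
  have hQm : ∀ t, MeasurableSet (Q t) := fun t => ℱ.le t _ (h.measurableSet_isTie a t)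
  have h1 := integral_card_filter (P := P) (S := Finset.range T) (Q := Q)
    (dec := fun _ _ => Classical.propDecidable _) hQm
  have hB : (fun ω => (((Finset.range T).filter fun t => ω ∈ Q' t).card : ℝ))
      = fun ω => (brokenTies μ ε (fun s => arm s ω) (fun s => X s ω) a T : ℝ) := by
    ext ω
    unfold brokenTies
    congr!
  have h2 : Integrable (fun ω => (brokenTies μ ε (fun s => arm s ω) (fun s => X s ω) a T : ℝ)) P ∧
      ∫ ω, (brokenTies μ ε (fun s => arm s ω) (fun s => X s ω) a T : ℝ) ∂P
        = ∑ t ∈ Finset.range T, P.real (Q' t) := by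
    rw [← hB]
    exact integral_card_filter fun t => (hQm t).inter (h.measurable_reward t measurableSet_Iio)
  refine ⟨h1.1, h2.1, h2.2.trans ?_⟩
  have e : ∫ ω, (((Finset.range T).filter fun t =>
          IsTie μ ε (fun s => arm s ω) (fun s => X s ω) a t).card : ℝ) ∂P
      = ∑ t ∈ Finset.range T, P.real (Q t) := h1.2
  rw [e, Finset.sum_mul]
  refine Finset.sum_congr rfl fun t _ => ?_
  rw [measureReal_def, h.measure_inter_preimage (h.measurableSet_isTie a t)
    (fun ω hω => hω.1) measurableSet_Iio, ENNReal.toReal_mul]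
  rfl

lemma hasPullRate_klucbUB (hν : IsUnimodal fam G μ astar)
    (h : IsBanditProcess (fun a => fam.law (μ a)) P ℱ arm X)
    (hstrat : FollowsKlucbUB fam G P arm X) :
    HasPullRate P arm astar (explorationRate fam G μ astar 0) := by
  classical
  intro η hη a ha
  obtain ⟨ε, hε, hrate⟩ := exists_isMargin_explorationRate_le hν (half_pos hη)
  set p := (fam.law (μ a)).real (Set.Iio (μ a - ε)) with hp
  have hp0 : 0 < p := measureReal_law_Iio_pos fam (hν.mem_means a)
    (hε.mem_means a (by linarith [hε.pos]) (by linarith [hε.pos]))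
  set K : ℝ := Fintype.card A + 3 with hK
  have hK0 : 0 < K := by positivity
  set η₁ := η / 2 / (1 + K / p) with hη₁
  set η₂ := η / (1 + 1 / p) with hη₂
  have hη₁0 : 0 < η₁ := by positivity
  have hη₂0 : 0 < η₂ := by positivity
  obtain ⟨C₁, hC₁, hexc⟩ := exists_exceptionalCount_le hν.mem_means h hε hη₁0
  obtain ⟨C₂, hC₂, hreg⟩ := exists_pulls_le_of_klucbUBStep hν hε hη₂0
  obtain ⟨C₃, hC₃, hbroken⟩ := exists_brokenTies_le hν hε hη₂0
  refine ⟨C₁ + 1 + C₂ + (K * (C₁ + 1) + C₃) / p, by positivity, fun T => ?_⟩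
  obtain ⟨Z, hZint, hZle, hZ⟩ := hexc T
  have hlogT : 0 ≤ Real.log T := Real.log_natCast_nonneg T
  obtain ⟨hTint, hBint, hties⟩ := h.integral_brokenTies (ε := ε) a T
  set F := expSuboptimalPulls P arm astar T with hF
  have hMint := h.integrable_suboptimalPulls (astar := astar) T
  set R := explorationRate fam G μ astar ε a * Real.log T + C₂ with hR
  have hrate0 := mul_nonneg (explorationRate_nonneg hν hε a) hlogT
  have hi₁ : Integrable (fun ω => Z ω + (1 + R)) P := hZint.add (integrable_const _)
  have hi₂ : Integrable (fun ω => η₂ * (suboptimalPulls astar (fun s => arm s ω) T : ℝ)) P :=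
    hMint.const_mul _
  have hi₃ : Integrable (fun ω => Z ω + (1 + R)
      + η₂ * (suboptimalPulls astar (fun s => arm s ω) T : ℝ)) P := hi₁.add hi₂
  have hi₄ : Integrable (fun ω => Z ω + 1) P := hZint.add (integrable_const _)
  have hi₅ : Integrable (fun ω => K * (Z ω + 1)
      + η₂ * (suboptimalPulls astar (fun s => arm s ω) T : ℝ)) P := (hi₄.const_mul K).add hi₂
  -- Regular rounds and ties
  have hle : expPulls P arm a T ≤ ∫ ω, (Z ω + (1 + R)
      + η₂ * (suboptimalPulls astar (fun s => arm s ω) T : ℝ)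
      + (((Finset.range T).filter fun t =>
          IsTie μ ε (fun s => arm s ω) (fun s => X s ω) a t).card : ℝ)) ∂P := by
    refine integral_mono_ae (h.integrable_pulls a T)
      (hi₃.add hTint) ?_
    filter_upwards [hstrat, h.ae_empMean_mem hν.mem_means] with ω hω hext
    have hM0 : 0 ≤ η₂ * (suboptimalPulls astar (fun s => arm s ω) T : ℝ) := by positivity
    have := pulls_le_of_forall (fam := fam) (μ := μ) (ε := ε) (arm := fun s => arm s ω)
      (X := fun s => X s ω) (T := T) (a := a)
      (R := R + η₂ * (suboptimalPulls astar (fun s => arm s ω) T : ℝ)) (by positivity)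
      (fun t => IsTie μ ε (fun s => arm s ω) (fun s => X s ω) a t) (by
        intro t htT harm hn hnexc hnt
        have ht : 1 ≤ t := hn.trans (pulls_le _ a t)
        obtain ⟨b, hb, hmem, hmax, hcase⟩ := (hω t ht).exists_leader hext harm
        rcases hcase with hab | ⟨hlt, hbest, -⟩
        · rcases hreg _ _ hext t T a b ha htT.le hb hmem hmax hab hn hnexc with ⟨-, h1⟩ | h1 <;>
          linarith
        · have hest := abs_lt.1 (abs_sub_lt_of_not_exceptional hnexc le_rfl)
          exact absurd ⟨harm, hbest, fun hl => absurd (hl.2 b hb.1) (not_le.2 hlt),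
            by linarith⟩ hnt)
    linarith [hZle ω]
  rw [integral_add hi₃ hTint, integral_add hi₁ hi₂,
    integral_add hZint (integrable_const _), integral_const, probReal_univ, one_smul,
    integral_const_mul] at hle
  -- The ties are at most `1 / p` times as many as the broken ties.
  have hle₂ : ∫ ω, (brokenTies μ ε (fun s => arm s ω) (fun s => X s ω) a T : ℝ) ∂P
      ≤ ∫ ω, (K * (Z ω + 1) + η₂ * (suboptimalPulls astar (fun s => arm s ω) T : ℝ) + C₃) ∂P := by
    refine integral_mono_ae hBint (hi₅.add (integrable_const _)) ?_
    filter_upwards [hstrat, h.ae_empMean_mem hν.mem_means] with ω hω hext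
    refine (hbroken _ _ hext hω T a ha).trans ?_
    have := mul_le_mul_of_nonneg_left (hZle ω) hK0.le
    linarith
  rw [integral_add hi₅ (integrable_const _), integral_add (hi₄.const_mul K) hi₂,
    integral_const_mul, integral_add hZint (integrable_const _), integral_const, integral_const,
    probReal_univ, one_smul, one_smul, integral_const_mul, hties] at hle₂
  set W := ∫ ω, (((Finset.range T).filter fun t =>
          IsTie μ ε (fun s => arm s ω) (fun s => X s ω) a t).card : ℝ) ∂P with hW
  have hW' : W ≤ (K * (η₁ * Real.log T + C₁ + 1) + η₂ * F + C₃) / p := by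
    rw [le_div_iff₀ hp0]
    have := mul_le_mul_of_nonneg_left hZ hK0.le
    have e : ∫ ω, (suboptimalPulls astar (fun s => arm s ω) T : ℝ) ∂P = F := rfl
    rw [e] at hle₂
    linarith
  have e : ∫ ω, (suboptimalPulls astar (fun s => arm s ω) T : ℝ) ∂P = F := rfl
  rw [e] at hle
  have h1 := mul_le_mul_of_nonneg_right (hrate a) hlogT
  have e1 : η₁ * (1 + K / p) = η / 2 := by rw [hη₁]; field_simp
  have e2 : η₂ * (1 + 1 / p) = η := by rw [hη₂]; field_simp
  have e3 : (K * (η₁ * Real.log T + C₁ + 1) + η₂ * F + C₃) / p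
      = η₁ * (K / p) * Real.log T + η₂ * (1 / p) * F + (K * (C₁ + 1) + C₃) / p := by
    field_simp
    ring
  have e4 : η₁ * Real.log T + η₁ * (K / p) * Real.log T = η / 2 * Real.log T := by
    rw [← e1]; ring
  have e5 : η₂ * F + η₂ * (1 / p) * F = η * F := by
    rw [← e2]; ring
  linarith

/-! ### The regret -/

lemma IsBanditProcess.integrable_reward (hμ : ∀ a, μ a ∈ fam.means)
    (h : IsBanditProcess (fun a => fam.law (μ a)) P ℱ arm X) (t : ℕ) :
    Integrable (X (t + 1)) P ∧
      ∫ ω, X (t + 1) ω ∂P = ∑ a, μ a * P.real {ω | arm (t + 1) ω = a} := by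
  have hm : ∀ a, MeasurableSet {ω | arm (t + 1) ω = a} := fun a => ℱ.le t _ (h.arm_predictable t a)
  have hU : (⋃ a, {ω | arm (t + 1) ω = a}) = Set.univ := by ext ω; simp
  have hmap := fun a => h.map_restrict (h.arm_predictable t a) (subset_refl {ω | arm (t + 1) ω = a})
  have hi : ∀ a, IntegrableOn (X (t + 1)) {ω | arm (t + 1) ω = a} P := by
    intro a
    have h1 : Integrable (fun x : ℝ => x)
        ((P.restrict {ω | arm (t + 1) ω = a}).map (X (t + 1))) := by
      rw [hmap]
      exact (integrable_id_law fam (hμ a)).smul_measure (measure_ne_top _ _)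
    exact h1.comp_measurable (h.measurable_reward t)
  constructor
  · rw [← integrableOn_univ, ← hU]
    exact integrableOn_finite_iUnion.2 hi
  · rw [← setIntegral_univ, ← hU, integral_iUnion_fintype hm ?_ hi]
    · refine Finset.sum_congr rfl fun a _ => ?_
      have h1 : ∫ x, x ∂((P.restrict {ω | arm (t + 1) ω = a}).map (X (t + 1)))
          = ∫ ω in {ω | arm (t + 1) ω = a}, X (t + 1) ω ∂P :=
        integral_map (h.measurable_reward t).aemeasurable (by fun_prop)
      rw [← h1, hmap, integral_smul_measure, integral_id_law fam (hμ a), smul_eq_mul, mul_comm]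
      rfl
    · intro a b hab
      exact Set.disjoint_left.2 fun ω h1 h2 => hab (h1.symm.trans h2)

lemma IsUnimodal.iSup_eq (hν : IsUnimodal fam G μ astar) : ⨆ b, μ b = μ astar := by
  have : Nonempty A := ⟨astar⟩
  refine le_antisymm (ciSup_le fun b => ?_) (le_ciSup (f := μ) (Set.finite_range _).bddAbove astar)
  rcases eq_or_ne b astar with rfl | hb
  · exact le_rfl
  · exact (hν.lt_optimal b hb).le

omit [Fintype A] in
lemma IsBanditProcess.expPulls_eq {ν : A → Measure ℝ} (h : IsBanditProcess ν P ℱ arm X)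
    (a : A) (T : ℕ) :
    expPulls P arm a T = ∑ t ∈ Finset.range T, P.real {ω | arm (t + 1) ω = a} := by
  induction T with
  | zero => simp [expPulls, pulls_zero]
  | succ T ih =>
    classical
    have hm : MeasurableSet {ω | arm (T + 1) ω = a} := ℱ.le T _ (h.arm_predictable T a)
    have hi : Integrable ({ω | arm (T + 1) ω = a}.indicator (1 : Ω → ℝ)) P :=
      (integrable_const (1 : ℝ)).indicator hm
    rw [Finset.sum_range_succ, ← ih, expPulls, expPulls, ← integral_indicator_one hm,
      ← integral_add (h.integrable_pulls a T) hi]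
    refine integral_congr_ae (ae_of_all _ fun ω => ?_)
    by_cases hω : arm (T + 1) ω = a <;> simp [pulls_succ, hω]

/-- The regret decomposes over the pulls of the suboptimal arms. -/
lemma regret_eq (hν : IsUnimodal fam G μ astar)
    (h : IsBanditProcess (fun a => fam.law (μ a)) P ℱ arm X) (T : ℕ) :
    regret μ P X T = ∑ a, (μ astar - μ a) * expPulls P arm a T := by
  have hX := h.integrable_reward hν.mem_means
  have hi : ∀ t ∈ Finset.Icc 1 T, Integrable (fun ω => μ astar - X t ω) P := by
    intro t ht
    obtain ⟨t, rfl⟩ := Nat.exists_eq_add_of_le' (Finset.mem_Icc.1 ht).1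
    exact (integrable_const _).sub (hX t).1
  rw [regret, hν.iSup_eq, integral_finsetSum _ hi]
  simp_rw [h.expPulls_eq, Finset.mul_sum]
  rw [Finset.sum_comm, Finset.range_eq_Ico, Finset.sum_Ico_add' (fun t => ∑ a, (μ astar - μ a)
    * P.real {ω | arm t ω = a}) 0 T 1, zero_add, Finset.Ico_add_one_right_eq_Icc]
  refine Finset.sum_congr rfl fun t ht => ?_
  obtain ⟨t, rfl⟩ := Nat.exists_eq_add_of_le' (Finset.mem_Icc.1 ht).1
  rw [integral_sub (integrable_const _) (hX t).1, (hX t).2, integral_const, probReal_univ, one_smul]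
  have h1 : ∑ a, P.real {ω | arm (t + 1) ω = a} = 1 := by
    have hU : (⋃ a, {ω | arm (t + 1) ω = a}) = Set.univ := by ext ω; simp
    rw [← measureReal_iUnion_fintype (fun a b hab => Set.disjoint_left.2 fun ω h1 h2 =>
      hab (h1.symm.trans h2)) (fun a => ℱ.le t _ (h.arm_predictable t a)), hU, probReal_univ]
  simp_rw [sub_mul]
  rw [Finset.sum_sub_distrib, ← Finset.mul_sum, h1, mul_one]

lemma complexity_eq (hν : IsUnimodal fam G μ astar) :
    complexity fam G μ astar = ∑ a, (μ astar - μ a) * explorationRate fam G μ astar 0 a := by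
  classical
  rw [complexity, hν.iSup_eq, Finset.sum_filter]
  refine Finset.sum_congr rfl fun a _ => ?_
  rw [explorationRate]
  split_ifs with hadj
  · rw [toReal_KL (fam.means_subset_extendedMeans (hν.mem_means a)) (hν.mem_means astar), add_zero,
      sub_zero, div_eq_mul_inv]
  · rw [mul_zero]

/-- Pull rates determine the asymptotic regret. The fraction of the suboptimal pulls that the rates
allow for is absorbed by summing the rates over the suboptimal arms. -/
lemma limsup_regret_le (hν : IsUnimodal fam G μ astar)
    (h : IsBanditProcess (fun a => fam.law (μ a)) P ℱ arm X)
    (hrate : HasPullRate P arm astar (explorationRate fam G μ astar 0)) :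
    limsup (fun T : ℕ => ((regret μ P X T / Real.log T : ℝ) : EReal)) atTop ≤
      ((complexity fam G μ astar : ℝ) : EReal) := by
  classical
  set κ := explorationRate fam G μ astar 0 with hκ
  set F : ℕ → ℝ := expSuboptimalPulls P arm astar with hF
  have hκ0 : ∀ a, 0 ≤ κ a := by
    intro a
    rw [hκ, explorationRate]
    split_ifs with hadj
    · rw [add_zero, sub_zero]
      exact inv_nonneg.2 (klFormula_pos (hν.mem_means a) (hν.mem_means astar)
        (hν.lt_optimal a hadj.ne')).le
    · exact le_rfl
  -- Constants uniform in the arm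
  have hunif : ∀ η > 0, ∃ C ≥ 0, ∀ a, a ≠ astar → ∀ T : ℕ, expPulls P arm a T ≤
      κ a * Real.log T + η * (Real.log T + F T) + C := by
    intro η hη
    have hC : ∀ a, ∃ C ≥ 0, a ≠ astar → ∀ T : ℕ, expPulls P arm a T ≤
        κ a * Real.log T + η * (Real.log T + F T) + C := by
      intro a
      by_cases ha : a = astar
      · exact ⟨0, le_rfl, fun h => absurd ha h⟩
      · obtain ⟨C, h1, h2⟩ := hrate η hη a ha
        exact ⟨C, h1, fun _ => h2⟩
    choose C hC0 hC using hC
    refine ⟨∑ a, C a, Finset.sum_nonneg fun a _ => hC0 a, fun a ha T => (hC a ha T).trans ?_⟩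
    have := Finset.single_le_sum (f := C) (fun a _ => hC0 a) (Finset.mem_univ a)
    linarith
  set m : ℝ := (Fintype.card A : ℝ) with hm
  have hm0 : 0 ≤ m := Nat.cast_nonneg _
  -- The suboptimal arms are pulled `O(log T)` times.
  obtain ⟨Λ, C', hΛ, hC', hFle⟩ : ∃ Λ C' : ℝ, 0 ≤ Λ ∧ 0 ≤ C' ∧ ∀ T : ℕ,
      F T ≤ Λ * Real.log T + C' := by
    obtain ⟨C, hC, hle⟩ := hunif (1 / (2 * (m + 1))) (by positivity)
    refine ⟨2 * (∑ a, κ a + 1), 2 * (m * C), by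
      have := Finset.sum_nonneg fun a (_ : a ∈ Finset.univ) => hκ0 a
      positivity, by positivity, fun T => ?_⟩
    have hlogT : 0 ≤ Real.log T := Real.log_natCast_nonneg T
    have hF0 : 0 ≤ F T := integral_nonneg fun _ => Nat.cast_nonneg _
    have h1 : F T ≤ ∑ a : A, (κ a * Real.log T
        + 1 / (2 * (m + 1)) * (Real.log T + F T) + C) := by
      refine (h.expSuboptimalPulls_eq T).le.trans ?_
      refine (Finset.sum_le_sum fun (a : A) ha => hle a (Finset.mem_filter.1 ha).2 T).trans ?_
      refine Finset.sum_le_sum_of_subset_of_nonneg (Finset.filter_subset _ _) fun a _ _ => ?_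
      have := mul_nonneg (hκ0 a) hlogT
      positivity
    rw [Finset.sum_add_distrib, Finset.sum_add_distrib, ← Finset.sum_mul, Finset.sum_const,
      Finset.sum_const, Finset.card_univ, nsmul_eq_mul, nsmul_eq_mul, ← hm] at h1
    have h2 : m * (1 / (2 * (m + 1)) * (Real.log T + F T)) ≤ 1 / 2 * (Real.log T + F T) := by
      rw [← mul_assoc]
      refine mul_le_mul_of_nonneg_right ?_ (by positivity)
      rw [mul_one_div, div_le_div_iff₀ (by positivity) two_pos]
      linarith
    linarith
  have hΔ : ∀ a, 0 ≤ μ astar - μ a := by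
    intro a
    rcases eq_or_ne a astar with rfl | ha
    · simp
    · exact (sub_pos.2 (hν.lt_optimal a ha)).le
  set S := ∑ a, (μ astar - μ a) with hS
  have hS0 : 0 ≤ S := Finset.sum_nonneg fun a _ => hΔ a
  set c := complexity fam G μ astar with hc
  have hreg : ∀ θ > 0, ∃ C'' : ℝ, ∀ T : ℕ, regret μ P X T ≤ (c + θ) * Real.log T + C'' := by
    intro θ hθ
    set η := θ / (S * (1 + Λ) + 1) with hη
    have hden : 0 < S * (1 + Λ) + 1 := by positivity
    have hη0 : 0 < η := by positivity
    obtain ⟨C, hC, hle⟩ := hunif η hη0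
    refine ⟨S * (η * C' + C), fun T => ?_⟩
    have hlogT : 0 ≤ Real.log T := Real.log_natCast_nonneg T
    have h1 : regret μ P X T ≤ ∑ a, (μ astar - μ a) * (κ a * Real.log T
        + (η * (1 + Λ) * Real.log T + (η * C' + C))) := by
      rw [regret_eq hν h]
      refine Finset.sum_le_sum fun a _ => ?_
      rcases eq_or_ne a astar with rfl | ha
      · simp
      refine mul_le_mul_of_nonneg_left ((hle a ha T).trans ?_) (hΔ a)
      have := mul_le_mul_of_nonneg_left (hFle T) hη0.le
      linarith
    have h2 : ∑ a, (μ astar - μ a) * (κ a * Real.log T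
        + (η * (1 + Λ) * Real.log T + (η * C' + C)))
        = c * Real.log T + S * (η * (1 + Λ) * Real.log T + (η * C' + C)) := by
      rw [hc, complexity_eq hν, Finset.sum_mul, hS, Finset.sum_mul, ← Finset.sum_add_distrib]
      exact Finset.sum_congr rfl fun a _ => by ring
    have h3 : S * (η * (1 + Λ)) ≤ θ := by
      have : η * (S * (1 + Λ) + 1) = θ := by rw [hη, div_mul_cancel₀ _ hden.ne']
      linarith
    have h4 := mul_le_mul_of_nonneg_right h3 hlogT
    linarith
  refine EReal.le_of_forall_lt_iff_le.1 fun z hz => ?_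
  rw [EReal.coe_lt_coe_iff] at hz
  obtain ⟨C'', hC''⟩ := hreg ((z - c) / 2) (by linarith)
  refine limsup_le_of_le (by isBoundedDefault) ?_
  have hlog : Tendsto (fun T : ℕ => Real.log (T : ℝ)) atTop atTop :=
    Real.tendsto_log_atTop.comp tendsto_natCast_atTop_atTop
  filter_upwards [hlog.eventually_ge_atTop 1,
    hlog.eventually_ge_atTop (2 * C'' / (z - c))] with T h1 h2
  rw [EReal.coe_le_coe_iff, div_le_iff₀ (by linarith)]
  rw [div_le_iff₀ (by linarith)] at h2
  have := hC'' T
  linarith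

end Expectation

end UnimodalBandit

theorem mainTheorem2 {A : Type*} [Fintype A] (fam : UnimodalBandit.RewardFamily)
    (G : SimpleGraph A) (μ : A → ℝ) (astar : A)
    (hν : UnimodalBandit.IsUnimodal fam G μ astar)
    {Ω : Type*} [MeasurableSpace Ω] (P : Measure Ω) [IsProbabilityMeasure P]
    (ℱ : Filtration ℕ ‹MeasurableSpace Ω›) (arm : ℕ → Ω → A) (X : ℕ → Ω → ℝ)
    (hproc : UnimodalBandit.IsBanditProcess (fun a => fam.law (μ a)) P ℱ arm X) :
    (∀ t : ℕ, 1 ≤ t → Integrable (X t) P) ∧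
    (UnimodalBandit.FollowsImedUB fam G P arm X →
      limsup (fun T : ℕ => ((UnimodalBandit.regret μ P X T / Real.log T : ℝ) : EReal)) atTop ≤
        ((UnimodalBandit.complexity fam G μ astar : ℝ) : EReal)) ∧
    (UnimodalBandit.FollowsKlucbUB fam G P arm X →
      limsup (fun T : ℕ => ((UnimodalBandit.regret μ P X T / Real.log T : ℝ) : EReal)) atTop ≤
        ((UnimodalBandit.complexity fam G μ astar : ℝ) : EReal)) ∧
    (G.IsTree → UnimodalBandit.FollowsDImedUB fam G P arm X →
      limsup (fun T : ℕ => ((UnimodalBandit.regret μ P X T / Real.log T : ℝ) : EReal)) atTop ≤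
        ((UnimodalBandit.complexity fam G μ astar : ℝ) : EReal)) := by
  refine ⟨fun t ht => ?_, fun hs => ?_, fun hs => ?_, fun hG hs => ?_⟩
  · obtain ⟨t, rfl⟩ := Nat.exists_eq_add_of_le' ht
    exact (hproc.integrable_reward hν.mem_means t).1
  · exact UnimodalBandit.limsup_regret_le hν hproc (UnimodalBandit.hasPullRate_imedUB hν hproc hs)
  · exact UnimodalBandit.limsup_regret_le hν hproc (UnimodalBandit.hasPullRate_klucbUB hν hproc hs)
  · exact UnimodalBandit.limsup_regret_le hν hproc
      (UnimodalBandit.hasPullRate_dImedUB hν hG hproc hs)
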